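/- Let $h_1=1$ and, for $k=2^n+j$ with $n\ge 0$, $1\le j\le 2^n$, let $h_k=2^{n/2}$ on $[\frac{j-1}{2^n},\frac{2j-1}{2^{n+1}})$, $h_k=-2^{n/2}$ on $[\frac{2j-1}{2^{n+1}},\frac{j}{2^n})$ and $h_k=0$ elsewhere (the Haar system on $[0,1]$). For integrable real functions $g$ on $[0,1]$ let $$S(g)(x)=\Big(\sum_{k\ge 1}\langle g,h_k\rangle^2h_k(x)^2\Big)^{1/2},\qquad \langle g,h\rangle=\int_0^1 gh .$$ For $k=2^n+j$ as above put $n_k=n$ and $t_k=\frac{2j-1}{2^{n+1}}$, and put $n_1=0$, $t_1=\frac12$. Let $1<p<\infty$, $0<\delta<1$, $0<\alpha\le 1$, $c>0$, and $\xi(x)=(1+|x|)^{-1-\delta}$. There is a constant $C$ depending only on $p,\delta,\alpha,c$ such that the following holds. Let $\{\phi_k\}_{k\ge 1}$ be an orthonormal system of real functions on $[0,1]$ (a wavelet type system) with * $\int_0^1\phi_k=0$ for $k\ge 2$; * $|\phi_k(x)|\le c\,2^{n_k/2}\,\xi(2^{n_k}(x-t_k))$ for $k\ge 1$ and $x\in[0,1]$;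 * $|\phi_k(t)-\phi_k(t')|\le c\,2^{n_k/2}(2^{n_k}|t-t'|)^\alpha\,\xi(2^{n_k}(t-t_k))$ for $k\ge 1$ and $t,t'\in[0,1]$ with $|t-t'|\le 2^{-n_k}$. Let $f\in L^p(0,1)$ be real and $a_k=\langle f,\phi_k\rangle$. Then for every real sequence $\lambda=(\lambda_k)$ with $|\lambda_k|\le 1$ for all $k$ the series $\sum_k\lambda_ka_k\phi_k$ converges unconditionally in $L^p$, the function $\sup_{|\lambda_k|\le1}S\big(\sum_k\lambda_ka_k\phi_k\big)$ (pointwise supremum over all such sequences) is measurable, up to modification on a null set, and $$\Big\|\sup_{|\lambda_k|\le 1}S\Big(\sum_k\lambda_ka_k\phi_k\Big)\Big\|_p\le C\,\|f\|_p .$$ -/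

import Mathlib

open MeasureTheory Filter Topology
open scoped ENNReal NNReal

noncomputable section

/-- Lebesgue measure on `[0,1]`; functions on `[0,1]` are represented by functions `ℝ → ℝ`
of which only the restriction to `[0,1]` is ever used. -/
abbrev unitMeasure : Measure ℝ := volume.restrict (Set.Icc (0 : ℝ) 1)

/-- The pairing `⟨f, g⟩ = ∫₀¹ f g`. -/
def pairing (f g : ℝ → ℝ) : ℝ := ∫ t in Set.Icc (0 : ℝ) 1, f t * g t

/-- The level `n` of an index `k = 2 ^ n + j`, `1 ≤ j ≤ 2 ^ n`; the index `1` gets level `0`. -/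
def level (k : ℕ+) : ℕ := Nat.log 2 ((k : ℕ) - 1)

/-- The position `j` of an index `k = 2 ^ n + j`, `1 ≤ j ≤ 2 ^ n` (used for `k ≥ 2` only). -/
def position (k : ℕ+) : ℕ := (k : ℕ) - 2 ^ level k

/-- The decomposition `k = 2 ^ n + j` is the intended one. -/
theorem level_position_eq (k : ℕ+) (n j : ℕ) (hj1 : 1 ≤ j) (hj2 : j ≤ 2 ^ n)
    (hk : (k : ℕ) = 2 ^ n + j) : level k = n ∧ position k = j := by
  have h : level k = n := by
    unfold level
    refine (Nat.log_eq_iff (Or.inr ⟨by norm_num, by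
      have := Nat.one_le_two_pow (n := n); omega⟩)).2 ⟨by omega, ?_⟩
    rw [pow_succ]; omega
  refine ⟨h, ?_⟩
  unfold position
  rw [h, hk]; omega

/-- The points `t₁ = 1/2` and `t_k = (2 j - 1) / 2 ^ (n + 1)` for `k = 2 ^ n + j ≥ 2`. -/
def center (k : ℕ+) : ℝ :=
  if k = 1 then 1 / 2 else (2 * (position k : ℝ) - 1) / 2 ^ (level k + 1)

/-- `ξ(x) = (1 + |x|) ^ (-(1 + δ))`. -/
def xi (δ x : ℝ) : ℝ := 1 / (1 + |x|) ^ (1 + δ)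

/-- Orthonormal systems of wavelet type on `[0,1]` with parameters `δ`, `α` and constant `c`. -/
structure IsWaveletType (δ α c : ℝ) (φ : ℕ+ → ℝ → ℝ) : Prop where
  orthonormal : ∀ j k : ℕ+, pairing (φ j) (φ k) = if j = k then 1 else 0
  mean_zero : ∀ k : ℕ+, 2 ≤ k → ∫ t in Set.Icc (0 : ℝ) 1, φ k t = 0
  decay : ∀ k : ℕ+, ∀ x ∈ Set.Icc (0 : ℝ) 1,
    |φ k x| ≤ c * (2 : ℝ) ^ ((level k : ℝ) / 2) * xi δ (2 ^ level k * (x - center k))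
  holder : ∀ k : ℕ+, ∀ t ∈ Set.Icc (0 : ℝ) 1, ∀ t' ∈ Set.Icc (0 : ℝ) 1,
    |t - t'| ≤ 1 / 2 ^ level k →
      |φ k t - φ k t'| ≤ c * (2 : ℝ) ^ ((level k : ℝ) / 2) * (2 ^ level k * |t - t'|) ^ α
        * xi δ (2 ^ level k * (t - center k))

/-- The `L²`-normalized Haar system on `[0,1]`. -/
def haar (k : ℕ+) (x : ℝ) : ℝ :=
  if k = 1 then 1
  else if ((position k : ℝ) - 1) / 2 ^ level k ≤ x ∧
      x < (2 * (position k : ℝ) - 1) / 2 ^ (level k + 1) then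
    (2 : ℝ) ^ ((level k : ℝ) / 2)
  else if (2 * (position k : ℝ) - 1) / 2 ^ (level k + 1) ≤ x ∧
      x < (position k : ℝ) / 2 ^ level k then
    -(2 : ℝ) ^ ((level k : ℝ) / 2)
  else 0

/-- The Haar square function `S(f)(x) = (∑ₖ ⟨f, hₖ⟩² hₖ(x)²) ^ (1/2)`, with values in `[0, ∞]`. -/
def haarSquare (f : ℝ → ℝ) (x : ℝ) : ℝ≥0∞ :=
  (∑' k : ℕ+, ENNReal.ofReal (pairing f (haar k) ^ 2 * haar k x ^ 2)) ^ (1 / 2 : ℝ)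

/-- The series `∑ₖ uₖ` converges unconditionally to `g` in `L^p(0,1)`. -/
def HasLpSum (p : ℝ≥0∞) (u : ℕ+ → ℝ → ℝ) (g : ℝ → ℝ) : Prop :=
  (∀ k, MemLp (u k) p unitMeasure) ∧ MemLp g p unitMeasure ∧
    Tendsto (fun s : Finset ℕ+ => eLpNorm (fun x => g x - ∑ k ∈ s, u k x) p unitMeasure)
      atTop (𝓝 0)

/-- The series `∑ₖ uₖ` converges unconditionally in `L^p(0,1)`. -/
def LpSummable (p : ℝ≥0∞) (u : ℕ+ → ℝ → ℝ) : Prop := ∃ g, HasLpSum p u g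

open Classical in
/-- The sum in `L^p(0,1)` of an unconditionally convergent series (a representative of it, which is
unique up to null sets; `0` if the series does not converge). -/
def lpSum (p : ℝ≥0∞) (u : ℕ+ → ℝ → ℝ) : ℝ → ℝ :=
  if h : LpSummable p u then h.choose else 0

theorem LpSummable.hasLpSum {p : ℝ≥0∞} {u : ℕ+ → ℝ → ℝ} (h : LpSummable p u) :
    HasLpSum p u (lpSum p u) := by
  unfold lpSum
  rw [dif_pos h]
  exact h.choose_spec

/-- The terms `λₖ ⟨f, φₖ⟩ φₖ` of the series obtained from the Fourier series of `f` by the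
multiplier sequence `l = (λₖ)`. -/
def multiplierTerm (φ : ℕ+ → ℝ → ℝ) (f : ℝ → ℝ) (l : ℕ+ → ℝ) (k : ℕ+) (x : ℝ) : ℝ :=
  l k * pairing f (φ k) * φ k x

/-- The function `x ↦ sup S(∑ₖ λₖ ⟨f, φₖ⟩ φₖ)(x)`, the supremum being taken over all real sequences
with `|λₖ| ≤ 1`, and the series being summed in `L^p`. -/
def maximalHaarSquare (p : ℝ≥0∞) (φ : ℕ+ → ℝ → ℝ) (f : ℝ → ℝ) (x : ℝ) : ℝ≥0∞ :=
  ⨆ (l : ℕ+ → ℝ) (_ : ∀ k, |l k| ≤ 1), haarSquare (lpSum p (multiplierTerm φ f l)) x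

end

/-!
Let `A` be the matrix of the numbers `|⟨φₖ, hⱼ⟩|`, and measure a sequence `b` by the norm
`‖(∑ₖ bₖ² hₖ²)^(1/2)‖_p`. The idea is that in this norm everything can be done with absolute
values. If `aₖ = |⟨f, φₖ⟩|` and `|λₖ| ≤ 1`, then the Haar coefficients of `g = ∑ₖ λₖ ⟨f, φₖ⟩ φₖ`
satisfy `|⟨g, hⱼ⟩| ≤ (A a)ⱼ`, so that `sup_λ S(g) ≤ (∑ⱼ (A a)ⱼ² hⱼ²)^(1/2)` pointwise; the supremum
costs nothing as soon as `A` is bounded on the sequence space (`exists_matMul_bound`). Likewise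
`aₖ ≤ ∑ⱼ Aⱼₖ |⟨f, hⱼ⟩|`, and the transpose of `A` together with the Paley inequality
`‖S(f)‖_p ≤ C ‖f‖_p` (`exists_lintegral_haarSquare_le`) bounds `a` by `f`
(`exists_lintegral_coef_le`). The same bound in the dual exponent gives the reverse inequality for
finite sums `∑ bₖ φₖ` (`exists_lintegral_sum_le`), and hence unconditional convergence in `L^p`.

Three facts carry this.

* The matrix `A` is almost diagonal (`exists_almostDiag_pairing`). For a Haar function finer than
  the wavelet this is the Hölder condition. For a fine wavelet and a coarse Haar function no gain in
  the single entry is available when the wavelet sits at a jump of the Haar function; but few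
  wavelets do, and since their primitives decay away from the center, the *sums* over all wavelets
  of one level still show a gain. The notion `AlmostDiag` asks for no more than that.
* Almost diagonal matrices are bounded for `p ≥ 2` by Schur's test in a weighted form
  (`exists_weighted_schur`): `∫ S(A b)² g ≤ C ∫ S(b)² M_q g` for all weights `g ≥ 0`, where
  `M_q g = (M g^q)^(1/q)` with the Hardy-Littlewood maximal function `M`. Testing with all `g` in
  the dual of `L^(p/2)` gives the norm inequality (`exists_lintegral_rpow_le_of_weighted`). The
  exponents `p < 2` follow by duality, using an explicit extremal sequence (`exists_dual_seq`).
* The Paley inequality for `p ≥ 2` follows from an inequality of the same weighted type, and for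
  `p < 2` from uniform convexity of `x ^ p`, which turns the telescoping `L^p` norms of the dyadic
  averages of a nonnegative function into a bound for its Haar coefficients.

Sequences and square functions have values in `[0, ∞]`, so that no summability has to be discussed
before the last step. Measurability of the supremum holds because each partial sum of a square
function depends on finitely many Haar functions, hence takes finitely many values as a function
of the point (`measurable_iSup_seqSquare`).
-/

noncomputable section

namespace HaarWavelet

/-! ### Dyadic intervals and the Haar system -/

/-- The index `2 ^ n + i + 1`, that is, the index of level `n` and position `i + 1`. -/
def idx (n i : ℕ) : ℕ+ := ⟨2 ^ n + i + 1, Nat.succ_pos _⟩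

/-- The dyadic interval `[i / 2 ^ n, (i + 1) / 2 ^ n)`. -/
def dyad (n i : ℕ) : Set ℝ := Set.Ico ((i : ℝ) / 2 ^ n) (((i : ℝ) + 1) / 2 ^ n)

theorem level_idx {n i : ℕ} (hi : i < 2 ^ n) : level (idx n i) = n :=
  (level_position_eq (idx n i) n (i + 1) (by omega) (by omega) rfl).1

theorem position_idx {n i : ℕ} (hi : i < 2 ^ n) : position (idx n i) = i + 1 :=
  (level_position_eq (idx n i) n (i + 1) (by omega) (by omega) rfl).2

theorem idx_ne_one (n i : ℕ) : idx n i ≠ 1 := by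
  intro h
  have h1 : 2 ^ n + i + 1 = 1 := congrArg (fun k : ℕ+ => (k : ℕ)) h
  have := Nat.one_le_two_pow (n := n)
  omega

theorem level_one : level 1 = 0 := by simp [level]

theorem exists_eq_idx {k : ℕ+} (hk : k ≠ 1) : ∃ i, i < 2 ^ level k ∧ k = idx (level k) i := by
  have hk1 : (k : ℕ) ≠ 1 := fun h => hk (PNat.coe_injective h)
  have hk0 := k.pos
  have h1 : 2 ^ level k ≤ (k : ℕ) - 1 := Nat.pow_log_le_self 2 (by omega)
  have h2 : (k : ℕ) - 1 < 2 ^ (level k + 1) := Nat.lt_pow_succ_log_self (by norm_num) _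
  rw [pow_succ] at h2
  refine ⟨(k : ℕ) - 1 - 2 ^ level k, by omega, PNat.coe_injective ?_⟩
  change (k : ℕ) = 2 ^ level k + ((k : ℕ) - 1 - 2 ^ level k) + 1
  omega

theorem idx_injective (n : ℕ) : Function.Injective (idx n) := by
  intro i j h
  have h1 : 2 ^ n + i + 1 = 2 ^ n + j + 1 := congrArg (fun k : ℕ+ => (k : ℕ)) h
  omega

theorem center_idx {n i : ℕ} (hi : i < 2 ^ n) :
    center (idx n i) = (2 * (i : ℝ) + 1) / 2 ^ (n + 1) := by
  unfold center
  rw [if_neg (idx_ne_one n i), level_idx hi, position_idx hi]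
  push_cast
  ring

theorem dyad_left (n i : ℕ) : dyad (n + 1) (2 * i) =
    Set.Ico ((i : ℝ) / 2 ^ n) ((2 * (i : ℝ) + 1) / 2 ^ (n + 1)) := by
  unfold dyad
  congr 1
  · push_cast; rw [pow_succ]; field_simp
  · push_cast; rfl

theorem dyad_right (n i : ℕ) : dyad (n + 1) (2 * i + 1) =
    Set.Ico ((2 * (i : ℝ) + 1) / 2 ^ (n + 1)) (((i : ℝ) + 1) / 2 ^ n) := by
  unfold dyad
  congr 1
  · push_cast; rfl
  · push_cast; rw [pow_succ]; field_simp; ring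

theorem left_lt_mid (n i : ℕ) : (i : ℝ) / 2 ^ n < (2 * (i : ℝ) + 1) / 2 ^ (n + 1) := by
  rw [pow_succ, div_lt_div_iff₀ (by positivity) (by positivity)]
  have : (0 : ℝ) < 2 ^ n := by positivity
  nlinarith

theorem mid_lt_right (n i : ℕ) : (2 * (i : ℝ) + 1) / 2 ^ (n + 1) < ((i : ℝ) + 1) / 2 ^ n := by
  rw [pow_succ, div_lt_div_iff₀ (by positivity) (by positivity)]
  have : (0 : ℝ) < 2 ^ n := by positivity
  nlinarith

theorem dyad_union (n i : ℕ) : dyad (n + 1) (2 * i) ∪ dyad (n + 1) (2 * i + 1) = dyad n i := by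
  rw [dyad_left, dyad_right, dyad]
  exact Set.Ico_union_Ico_eq_Ico (left_lt_mid n i).le (mid_lt_right n i).le

theorem dyad_children_disjoint (n i : ℕ) :
    Disjoint (dyad (n + 1) (2 * i)) (dyad (n + 1) (2 * i + 1)) := by
  rw [dyad_left, dyad_right]
  rw [Set.disjoint_left]
  intro x hx hy
  exact absurd hx.2 (not_lt.2 hy.1)

theorem measurableSet_dyad (n i : ℕ) : MeasurableSet (dyad n i) := measurableSet_Ico

theorem dyad_subset_Icc {n i : ℕ} (hi : i < 2 ^ n) : dyad n i ⊆ Set.Icc 0 1 := by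
  intro x hx
  have h2 : (0 : ℝ) < 2 ^ n := by positivity
  refine ⟨le_trans (by positivity) hx.1, hx.2.le.trans ?_⟩
  rw [div_le_one h2]
  exact_mod_cast hi

theorem volume_dyad (n i : ℕ) : volume (dyad n i) = ENNReal.ofReal (1 / 2 ^ n) := by
  unfold dyad
  rw [Real.volume_Ico]
  congr 1
  ring

theorem mem_dyad_unique {n i j : ℕ} {x : ℝ} (hi : x ∈ dyad n i) (hj : x ∈ dyad n j) : i = j := by
  have h2 : (0 : ℝ) < 2 ^ n := by positivity
  have a1 := hi.1; have a2 := hi.2; have b1 := hj.1; have b2 := hj.2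
  rw [div_le_iff₀ h2] at a1 b1
  rw [lt_div_iff₀ h2] at a2 b2
  have c1 : (i : ℝ) < j + 1 := by linarith
  have c2 : (j : ℝ) < i + 1 := by linarith
  have d1 : i < j + 1 := by exact_mod_cast c1
  have d2 : j < i + 1 := by exact_mod_cast c2
  omega

theorem dyad_disjoint (n : ℕ) {i j : ℕ} (h : i ≠ j) : Disjoint (dyad n i) (dyad n j) :=
  Set.disjoint_left.2 fun _ hx hy => h (mem_dyad_unique hx hy)

theorem iUnion_dyad (n : ℕ) : ⋃ i ∈ Finset.range (2 ^ n), dyad n i = Set.Ico 0 1 := by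
  have h2 : (0 : ℝ) < 2 ^ n := by positivity
  ext x
  simp only [Set.mem_iUnion, Finset.mem_range, exists_prop]
  constructor
  · rintro ⟨i, hi, hx⟩
    refine ⟨(dyad_subset_Icc hi hx).1, hx.2.trans_le ?_⟩
    rw [div_le_one h2]
    exact_mod_cast hi
  · intro hx
    refine ⟨⌊x * 2 ^ n⌋₊, ?_, ?_, ?_⟩
    · rw [Nat.floor_lt (mul_nonneg hx.1 h2.le)]
      push_cast
      nlinarith [hx.2]
    · rw [div_le_iff₀ h2]
      exact Nat.floor_le (mul_nonneg hx.1 h2.le)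
    · rw [lt_div_iff₀ h2]
      exact Nat.lt_floor_add_one _

theorem haar_one (x : ℝ) : haar 1 x = 1 := by simp [haar]

theorem haar_idx {n i : ℕ} (hi : i < 2 ^ n) (x : ℝ) : haar (idx n i) x =
    (2 : ℝ) ^ ((n : ℝ) / 2) * ((dyad (n + 1) (2 * i)).indicator 1 x -
      (dyad (n + 1) (2 * i + 1)).indicator 1 x) := by
  unfold haar
  rw [if_neg (idx_ne_one n i), level_idx hi, position_idx hi, dyad_left, dyad_right]
  have e1 : (((i + 1 : ℕ) : ℝ) - 1) = i := by push_cast; ring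
  have e2 : (2 * ((i + 1 : ℕ) : ℝ) - 1) = 2 * i + 1 := by push_cast; ring
  rw [e1, e2]
  simp only [Set.indicator_apply, Set.mem_Ico, Pi.one_apply]
  push_cast
  have h1 := left_lt_mid n i
  have h2 := mid_lt_right n i
  split_ifs with h h' h' <;> first | (exfalso; linarith [h.2, h'.1]) | ring

theorem measurable_haar (k : ℕ+) : Measurable (haar k) := by
  by_cases hk : k = 1
  · subst hk
    simp only [funext haar_one]
    exact measurable_const
  · obtain ⟨i, hi, h⟩ := exists_eq_idx hk
    rw [h]
    simp only [funext (haar_idx hi)]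
    exact ((measurable_one.indicator (measurableSet_dyad _ _)).sub
      (measurable_one.indicator (measurableSet_dyad _ _))).const_mul _

/-- The weight `hₖ ^ 2`: the indicator function of the support of `hₖ`, normalized in `L¹`. -/
def haarWeight (k : ℕ+) (x : ℝ) : ℝ≥0∞ := ENNReal.ofReal (haar k x ^ 2)

theorem measurable_haarWeight (k : ℕ+) : Measurable (haarWeight k) :=
  ((measurable_haar k).pow_const 2).ennreal_ofReal

theorem haarWeight_one (x : ℝ) : haarWeight 1 x = 1 := by simp [haarWeight, haar_one]

theorem two_rpow_half_sq (n : ℕ) : ((2 : ℝ) ^ ((n : ℝ) / 2)) ^ 2 = 2 ^ n := by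
  rw [← Real.rpow_natCast ((2 : ℝ) ^ ((n : ℝ) / 2)) 2, ← Real.rpow_mul (by norm_num)]
  rw [← Real.rpow_natCast]
  congr 1
  push_cast; ring

theorem haar_idx_sq {n i : ℕ} (hi : i < 2 ^ n) (x : ℝ) :
    haar (idx n i) x ^ 2 = (dyad n i).indicator (fun _ => 2 ^ n) x := by
  rw [haar_idx hi, mul_pow, two_rpow_half_sq, ← dyad_union n i]
  have h := dyad_children_disjoint n i
  rw [Set.disjoint_left] at h
  classical
  simp only [Set.indicator_apply, Set.mem_union, Pi.one_apply]
  by_cases h1 : x ∈ dyad (n + 1) (2 * i)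
  · simp [h1, h h1]
  · by_cases h2 : x ∈ dyad (n + 1) (2 * i + 1) <;> simp [h1, h2]

theorem ofReal_two_pow (n : ℕ) : ENNReal.ofReal (2 ^ n) = 2 ^ n := by
  rw [ENNReal.ofReal_pow (by norm_num)]; norm_num

theorem haarWeight_idx {n i : ℕ} (hi : i < 2 ^ n) (x : ℝ) :
    haarWeight (idx n i) x = (dyad n i).indicator (fun _ => 2 ^ n) x := by
  unfold haarWeight
  rw [haar_idx_sq hi]
  by_cases h : x ∈ dyad n i <;> simp [h]

theorem lintegral_haarWeight (k : ℕ+) : ∫⁻ x, haarWeight k x ∂unitMeasure = 1 := by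
  by_cases hk : k = 1
  · subst hk
    simp [funext haarWeight_one]
  · obtain ⟨i, hi, h⟩ := exists_eq_idx hk
    rw [h]
    simp only [haarWeight_idx hi]
    rw [lintegral_indicator (measurableSet_dyad _ _), setLIntegral_const,
      Measure.restrict_apply (measurableSet_dyad _ _), Set.inter_eq_left.2 (dyad_subset_Icc hi),
      volume_dyad, ← ofReal_two_pow, ← ENNReal.ofReal_mul (by positivity)]
    simp

theorem haarWeight_le (k : ℕ+) (x : ℝ) : haarWeight k x ≤ 2 ^ level k := by
  by_cases hk : k = 1
  · subst hk
    simp [haarWeight_one, level_one]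
  · obtain ⟨i, hi, h⟩ := exists_eq_idx hk
    generalize level k = n at hi h
    rw [h, haarWeight_idx hi]
    by_cases hx : x ∈ dyad n i <;> simp [hx]

theorem haarWeight_eq_of_ne_zero {k : ℕ+} {x : ℝ} (h : haarWeight k x ≠ 0) :
    haarWeight k x = 2 ^ level k := by
  by_cases hk : k = 1
  · subst hk
    simp [haarWeight_one, level_one]
  · obtain ⟨i, hi, h'⟩ := exists_eq_idx hk
    generalize level k = n at hi h'
    subst h'
    rw [haarWeight_idx hi] at h ⊢
    by_cases hx : x ∈ dyad n i
    · simp [hx]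
    · simp [hx] at h

theorem abs_sub_center_le {k : ℕ+} {x : ℝ} (hx : x ∈ Set.Icc (0 : ℝ) 1) (h : haarWeight k x ≠ 0) :
    |x - center k| ≤ 1 / 2 ^ level k / 2 := by
  by_cases hk : k = 1
  · subst hk
    rw [level_one, center, if_pos rfl, abs_le]
    constructor <;> norm_num <;> linarith [hx.1, hx.2]
  · obtain ⟨i, hi, h'⟩ := exists_eq_idx hk
    generalize level k = n at hi h'
    subst h'
    rw [haarWeight_idx hi] at h
    rw [center_idx hi]
    have hx : x ∈ dyad n i := by
      by_contra hx
      simp [hx] at h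
    have h2 : (0 : ℝ) < 2 ^ n := by positivity
    have e : (2 * (i : ℝ) + 1) / 2 ^ (n + 1) = i / 2 ^ n + 1 / 2 ^ n / 2 := by
      rw [pow_succ]; field_simp
    have e2 : ((i : ℝ) + 1) / 2 ^ n = i / 2 ^ n + 1 / 2 ^ n := by ring
    have h3 := hx.1
    have h4 := hx.2
    rw [e2] at h4
    rw [e, abs_le]
    constructor <;> linarith

theorem center_mem (k : ℕ+) : center k ∈ Set.Icc (0 : ℝ) 1 := by
  by_cases hk : k = 1
  · subst hk
    rw [center, if_pos rfl]
    constructor <;> norm_num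
  · obtain ⟨i, hi, h'⟩ := exists_eq_idx hk
    generalize level k = n at hi h'
    subst h'
    rw [center_idx hi]
    refine dyad_subset_Icc hi ?_
    exact ⟨(left_lt_mid n i).le, mid_lt_right n i⟩

/-! ### Sums over the indices of one level -/

theorem tsum_level_eq (F : ℕ+ → ℝ≥0∞) (n : ℕ) :
    ∑' k, (if level k = n then F k else 0) =
      (if n = 0 then F 1 else 0) + ∑ i ∈ Finset.range (2 ^ n), F (idx n i) := by
  classical
  have hsum : ∀ s : Finset ℕ+, (∀ k ∉ s, level k = n → False) →
      ∑' k, (if level k = n then F k else 0) = ∑ k ∈ s, if level k = n then F k else 0 := by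
    intro s hs
    refine tsum_eq_sum fun k hk => if_neg fun h => hs k hk h
  rw [hsum (insert 1 ((Finset.range (2 ^ n)).map ⟨idx n, idx_injective n⟩))]
  · rw [Finset.sum_insert (by simp [idx_ne_one]), level_one, Finset.sum_map]
    congr 1
    · simp only [eq_comm]
    · refine Finset.sum_congr rfl fun i hi => ?_
      exact if_pos (level_idx (Finset.mem_range.1 hi))
  · intro k hk hn
    simp only [Finset.mem_insert, Finset.mem_map, Finset.mem_range, not_or] at hk
    obtain ⟨i, hi, h⟩ := exists_eq_idx hk.1
    rw [hn] at hi h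
    exact hk.2 ⟨i, hi, h.symm⟩

theorem tsum_eq_tsum_level (F : ℕ+ → ℝ≥0∞) :
    ∑' k, F k = ∑' n, ∑' k, (if level k = n then F k else 0) := by
  rw [ENNReal.tsum_comm]
  refine tsum_congr fun k => ?_
  rw [tsum_eq_single (level k) fun n hn => if_neg hn.symm, if_pos rfl]

theorem tsum_eq_add_tsum_idx (F : ℕ+ → ℝ≥0∞) :
    ∑' k, F k = F 1 + ∑' n, ∑ i ∈ Finset.range (2 ^ n), F (idx n i) := by
  rw [tsum_eq_tsum_level]
  simp_rw [tsum_level_eq]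
  rw [ENNReal.tsum_add, tsum_ite_eq]

theorem tsum_le_of_forall_sum_idx_le {F : ℕ+ → ℝ≥0∞} {B : ℝ≥0∞}
    (h : ∀ N, F 1 + ∑ n ∈ Finset.range N, ∑ i ∈ Finset.range (2 ^ n), F (idx n i) ≤ B) :
    ∑' k, F k ≤ B := by
  rw [tsum_eq_add_tsum_idx, ENNReal.tsum_eq_iSup_nat, ENNReal.add_iSup]
  exact iSup_le h

theorem sum_haarWeight_idx_le (n : ℕ) (x : ℝ) :
    ∑ i ∈ Finset.range (2 ^ n), haarWeight (idx n i) x ≤ 2 ^ n := by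
  by_cases h : ∃ i ∈ Finset.range (2 ^ n), x ∈ dyad n i
  · obtain ⟨i, hi, hx⟩ := h
    rw [Finset.sum_eq_single_of_mem i hi]
    · exact (haarWeight_le _ x).trans_eq (by rw [level_idx (Finset.mem_range.1 hi)])
    · intro j hj hji
      rw [haarWeight_idx (Finset.mem_range.1 hj),
        Set.indicator_of_notMem fun h => hji (mem_dyad_unique h hx)]
  · push Not at h
    rw [Finset.sum_eq_zero]
    · exact zero_le
    · intro j hj
      rw [haarWeight_idx (Finset.mem_range.1 hj), Set.indicator_of_notMem (h j hj)]

theorem tsum_level_haarWeight_le (n : ℕ) (x : ℝ) :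
    ∑' k, (if level k = n then haarWeight k x else 0) ≤ 2 * 2 ^ n := by
  rw [tsum_level_eq, two_mul]
  refine add_le_add ?_ (sum_haarWeight_idx_le n x)
  split_ifs
  · rw [haarWeight_one]
    exact one_le_pow₀ (by norm_num)
  · exact zero_le

/-! ### Averages over dyadic intervals -/

/-- The average of `f` over the dyadic interval `[i / 2 ^ n, (i + 1) / 2 ^ n)`. -/
def dyadAvg (f : ℝ → ℝ) (n i : ℕ) : ℝ := 2 ^ n * ∫ x in dyad n i, f x

theorem setIntegral_mul_indicator_dyad (f : ℝ → ℝ) {n i : ℕ} (hi : i < 2 ^ n) :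
    ∫ x in Set.Icc (0 : ℝ) 1, f x * (dyad n i).indicator 1 x = ∫ x in dyad n i, f x := by
  have : ∀ x, f x * (dyad n i).indicator 1 x = (dyad n i).indicator f x := by
    intro x
    by_cases h : x ∈ dyad n i <;> simp [h]
  simp_rw [this]
  rw [setIntegral_indicator (measurableSet_dyad _ _), Set.inter_eq_right.2 (dyad_subset_Icc hi)]

theorem IntegrableOn.dyad {f : ℝ → ℝ} (hf : Integrable f unitMeasure) {n i : ℕ} (hi : i < 2 ^ n) :
    IntegrableOn f (dyad n i) :=
  IntegrableOn.mono_set (show IntegrableOn f (Set.Icc 0 1) volume from hf) (dyad_subset_Icc hi)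

theorem child_lt {n i : ℕ} (hi : i < 2 ^ n) : 2 * i < 2 ^ (n + 1) ∧ 2 * i + 1 < 2 ^ (n + 1) := by
  rw [pow_succ]; omega

theorem pairing_haar_idx {f : ℝ → ℝ} (hf : Integrable f unitMeasure) {n i : ℕ} (hi : i < 2 ^ n) :
    pairing f (haar (idx n i)) = 2 ^ ((n : ℝ) / 2) *
      (∫ x in dyad (n + 1) (2 * i), f x) - 2 ^ ((n : ℝ) / 2) *
      ∫ x in dyad (n + 1) (2 * i + 1), f x := by
  have hint : ∀ j, Integrable (fun x => f x * (dyad (n + 1) j).indicator 1 x) unitMeasure := by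
    intro j
    have : (fun x => f x * (dyad (n + 1) j).indicator 1 x) = (dyad (n + 1) j).indicator f := by
      funext x
      by_cases h : x ∈ dyad (n + 1) j <;> simp [h]
    rw [this]
    exact hf.indicator (measurableSet_dyad _ _)
  rw [← setIntegral_mul_indicator_dyad f (child_lt hi).1,
    ← setIntegral_mul_indicator_dyad f (child_lt hi).2, ← integral_const_mul, ← integral_const_mul,
    ← integral_sub ((hint _).const_mul _) ((hint _).const_mul _)]
  refine integral_congr_ae (Eventually.of_forall fun x => ?_)
  simp only [haar_idx hi]
  ring

theorem integral_dyad_eq_add {f : ℝ → ℝ} (hf : Integrable f unitMeasure) {n i : ℕ}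
    (hi : i < 2 ^ n) : ∫ x in dyad n i, f x =
      (∫ x in dyad (n + 1) (2 * i), f x) + ∫ x in dyad (n + 1) (2 * i + 1), f x := by
  rw [← dyad_union, setIntegral_union (dyad_children_disjoint n i) (measurableSet_dyad _ _)
    (IntegrableOn.dyad hf (child_lt hi).1) (IntegrableOn.dyad hf (child_lt hi).2)]

theorem two_rpow_half_mul (n : ℕ) : (2 : ℝ) ^ ((n : ℝ) / 2) * 2 ^ ((n : ℝ) / 2) = 2 ^ n := by
  rw [← sq, two_rpow_half_sq]

theorem dyadAvg_left {f : ℝ → ℝ} (hf : Integrable f unitMeasure) {n i : ℕ} (hi : i < 2 ^ n) :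
    dyadAvg f (n + 1) (2 * i) =
      dyadAvg f n i + 2 ^ ((n : ℝ) / 2) * pairing f (haar (idx n i)) := by
  unfold dyadAvg
  rw [pairing_haar_idx hf hi, integral_dyad_eq_add hf hi, mul_sub, ← mul_assoc, ← mul_assoc,
    two_rpow_half_mul]
  ring

theorem dyadAvg_right {f : ℝ → ℝ} (hf : Integrable f unitMeasure) {n i : ℕ} (hi : i < 2 ^ n) :
    dyadAvg f (n + 1) (2 * i + 1) =
      dyadAvg f n i - 2 ^ ((n : ℝ) / 2) * pairing f (haar (idx n i)) := by
  unfold dyadAvg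
  rw [pairing_haar_idx hf hi, integral_dyad_eq_add hf hi, mul_sub, ← mul_assoc, ← mul_assoc,
    two_rpow_half_mul]
  ring

theorem dyadAvg_zero (f : ℝ → ℝ) : dyadAvg f 0 0 = pairing f (haar 1) := by
  unfold dyadAvg pairing dyad
  simp only [haar_one, mul_one, pow_zero, one_mul, Nat.cast_zero, zero_add, div_one]
  exact (integral_Icc_eq_integral_Ico).symm

theorem sum_range_two_mul {M : Type*} [AddCommMonoid M] (F : ℕ → M) (m : ℕ) :
    ∑ i ∈ Finset.range (2 * m), F i = ∑ i ∈ Finset.range m, (F (2 * i) + F (2 * i + 1)) := by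
  induction m with
  | zero => simp
  | succ m ih =>
    rw [show 2 * (m + 1) = 2 * m + 1 + 1 by ring, Finset.sum_range_succ, Finset.sum_range_succ, ih,
      Finset.sum_range_succ, add_assoc]

/-- Parseval's identity for the conditional expectations on the dyadic intervals of level `N`. -/
theorem sum_dyadAvg_mul_dyadAvg {f g : ℝ → ℝ} (hf : Integrable f unitMeasure)
    (hg : Integrable g unitMeasure) (N : ℕ) :
    ∑ i ∈ Finset.range (2 ^ N), dyadAvg f N i * dyadAvg g N i / 2 ^ N =
      pairing f (haar 1) * pairing g (haar 1) + ∑ n ∈ Finset.range N, ∑ i ∈ Finset.range (2 ^ n),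
        pairing f (haar (idx n i)) * pairing g (haar (idx n i)) := by
  induction N with
  | zero => simp [dyadAvg_zero]
  | succ N ih =>
    rw [Finset.sum_range_succ, ← add_assoc, ← ih, pow_succ' 2 N, sum_range_two_mul,
      ← Finset.sum_add_distrib]
    refine Finset.sum_congr rfl fun i hi => ?_
    have hi := Finset.mem_range.1 hi
    rw [dyadAvg_left hf hi, dyadAvg_left hg hi, dyadAvg_right hf hi, dyadAvg_right hg hi]
    have h2 := two_rpow_half_mul N
    have h3 : (0 : ℝ) < 2 ^ N := by positivity
    rw [pow_succ]
    generalize (2 : ℝ) ^ ((N : ℝ) / 2) = r at h2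
    rw [← h2] at h3 ⊢
    have hr : r ≠ 0 := by rintro rfl; simp at h3
    field_simp
    ring

/-! ### The dyadic-radius maximal function -/

/-- The average (up to a factor `2`) of `g` over the interval of radius `2 ^ (-n)` around `x`, taken
with respect to Lebesgue measure on `[0,1]`. -/
def ballAvg (n : ℕ) (g : ℝ → ℝ≥0∞) (x : ℝ) : ℝ≥0∞ :=
  2 ^ n * ∫⁻ y in Metric.closedBall x (1 / 2 ^ n), g y ∂unitMeasure

/-- The centred Hardy-Littlewood maximal function on `[0,1]`; only the radii `2 ^ (-n)` are used, so
that it is a countable supremum. -/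
def maxFun (g : ℝ → ℝ≥0∞) (x : ℝ) : ℝ≥0∞ := ⨆ n, ballAvg n g x

theorem ballAvg_le_maxFun (n : ℕ) (g : ℝ → ℝ≥0∞) (x : ℝ) : ballAvg n g x ≤ maxFun g x :=
  le_iSup (fun n => ballAvg n g x) n

theorem measurable_ballAvg (n : ℕ) {g : ℝ → ℝ≥0∞} (hg : Measurable g) :
    Measurable (ballAvg n g) := by
  unfold ballAvg
  refine Measurable.const_mul ?_ _
  have h : ∀ x, ∫⁻ y in Metric.closedBall x (1 / 2 ^ n), g y ∂unitMeasure =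
      ∫⁻ y, {z : ℝ × ℝ | dist z.2 z.1 ≤ 1 / 2 ^ n}.indicator (fun z => g z.2) (x, y)
        ∂unitMeasure := by
    intro x
    rw [← lintegral_indicator Metric.isClosed_closedBall.measurableSet]
    rfl
  simp_rw [h]
  refine Measurable.lintegral_prod_right ?_
  refine (hg.comp measurable_snd).indicator ?_
  exact measurableSet_le (measurable_snd.dist measurable_fst) measurable_const

theorem measurable_maxFun {g : ℝ → ℝ≥0∞} (hg : Measurable g) : Measurable (maxFun g) :=
  Measurable.iSup fun n => measurable_ballAvg n hg

theorem maxFun_mono {g h : ℝ → ℝ≥0∞} (H : ∀ x, g x ≤ h x) (x : ℝ) : maxFun g x ≤ maxFun h x := by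
  refine iSup_mono fun n => ?_
  unfold ballAvg
  gcongr
  exact H _

theorem maxFun_add_le {g h : ℝ → ℝ≥0∞} (hg : Measurable g) (x : ℝ) :
    maxFun (fun y => g y + h y) x ≤ maxFun g x + maxFun h x := by
  refine iSup_le fun n => ?_
  refine le_trans (le_of_eq ?_) (add_le_add (ballAvg_le_maxFun n g x) (ballAvg_le_maxFun n h x))
  unfold ballAvg
  rw [lintegral_add_left hg, mul_add]

theorem maxFun_const_le (a : ℝ≥0∞) (x : ℝ) : maxFun (fun _ => a) x ≤ 2 * a := by
  refine iSup_le fun n => ?_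
  unfold ballAvg
  rw [setLIntegral_const]
  have h : unitMeasure (Metric.closedBall x (1 / 2 ^ n)) ≤ ENNReal.ofReal (2 * (1 / 2 ^ n)) := by
    refine (Measure.restrict_apply_le _ _).trans ?_
    rw [Real.volume_closedBall]
  have h2 : (2 : ℝ≥0∞) ^ n * ENNReal.ofReal (2 * (1 / 2 ^ n)) = 2 := by
    have : (2 : ℝ≥0∞) ^ n = ENNReal.ofReal (2 ^ n) := by
      rw [ENNReal.ofReal_pow (by norm_num)]; norm_num
    rw [this, ← ENNReal.ofReal_mul (by positivity)]
    have : (2 : ℝ) ^ n * (2 * (1 / 2 ^ n)) = 2 := by field_simp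
    rw [this]; norm_num
  calc 2 ^ n * (a * unitMeasure (Metric.closedBall x (1 / 2 ^ n)))
      ≤ 2 ^ n * (a * ENNReal.ofReal (2 * (1 / 2 ^ n))) := by gcongr
    _ = (2 ^ n * ENNReal.ofReal (2 * (1 / 2 ^ n))) * a := by ring
    _ = 2 * a := by rw [h2]

/-- The weak type `(1,1)` inequality, from the Vitali covering theorem. -/
theorem mul_measure_maxFun_le (g : ℝ → ℝ≥0∞) (t : ℝ≥0∞) :
    t * unitMeasure {x | t < maxFun g x} ≤ 10 * ∫⁻ y, g y ∂unitMeasure := by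
  set S := {x | t < maxFun g x} with hS
  have hn : ∀ x : ℝ, ∃ n : ℕ, x ∈ S → t < ballAvg n g x := by
    intro x
    by_cases hx : x ∈ S
    · obtain ⟨n, hn⟩ := lt_iSup_iff.1 (show t < ⨆ n, ballAvg n g x from hx)
      exact ⟨n, fun _ => hn⟩
    · exact ⟨0, fun h => absurd h hx⟩
  choose n hn using hn
  -- enlarging by the factor `5` gives intervals of length `10 * 2 ^ (-n)`, whence the constant `10`
  obtain ⟨u, huS, hdisj, hcov⟩ := Vitali.exists_disjoint_subfamily_covering_enlargement_closedBall
    S (fun x => x) (fun x => 1 / 2 ^ n x) 1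
    (fun x _ => by
      rw [div_le_one (by positivity)]
      exact one_le_pow₀ (by norm_num)) 5 (by norm_num)
  have hpos : ∀ x, (0 : ℝ) < 1 / 2 ^ n x := fun x => by positivity
  have hcount : u.Countable := by
    refine hdisj.countable_of_nonempty_interior fun x _ => ?_
    exact ⟨x, Metric.ball_subset_interior_closedBall (Metric.mem_ball_self (hpos x))⟩
  have hsub : S ⊆ ⋃ b ∈ u, Metric.closedBall b (5 * (1 / 2 ^ n b)) := by
    intro x hx
    obtain ⟨b, hb, h⟩ := hcov x hx
    exact Set.mem_biUnion hb (h (Metric.mem_closedBall_self (hpos x).le))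
  have hball : ∀ b ∈ u, t * volume (Metric.closedBall b (5 * (1 / 2 ^ n b))) ≤
      10 * ∫⁻ y in Metric.closedBall b (1 / 2 ^ n b), g y ∂unitMeasure := by
    intro b hb
    have h1 := (hn b (huS hb)).le
    unfold ballAvg at h1
    rw [Real.volume_closedBall]
    have h2 : (2 : ℝ≥0∞) ^ n b * ENNReal.ofReal (2 * (5 * (1 / 2 ^ n b))) = 10 := by
      have : (2 : ℝ≥0∞) ^ n b = ENNReal.ofReal (2 ^ n b) := by
        rw [ENNReal.ofReal_pow (by norm_num)]; norm_num
      rw [this, ← ENNReal.ofReal_mul (by positivity)]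
      have : (2 : ℝ) ^ n b * (2 * (5 * (1 / 2 ^ n b))) = 10 := by field_simp; norm_num
      rw [this]; norm_num
    calc t * ENNReal.ofReal (2 * (5 * (1 / 2 ^ n b)))
        ≤ (2 ^ n b * ∫⁻ y in Metric.closedBall b (1 / 2 ^ n b), g y ∂unitMeasure) *
          ENNReal.ofReal (2 * (5 * (1 / 2 ^ n b))) := by gcongr
      _ = (2 ^ n b * ENNReal.ofReal (2 * (5 * (1 / 2 ^ n b)))) *
          ∫⁻ y in Metric.closedBall b (1 / 2 ^ n b), g y ∂unitMeasure := by ring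
      _ = _ := by rw [h2]
  have : Countable u := hcount
  calc t * unitMeasure S ≤ t * volume S := by gcongr; exact Measure.restrict_le_self
    _ ≤ t * ∑' b : u, volume (Metric.closedBall (b : ℝ) (5 * (1 / 2 ^ n b))) := by
        gcongr
        exact (measure_mono hsub).trans (measure_biUnion_le _ hcount _)
    _ = ∑' b : u, t * volume (Metric.closedBall (b : ℝ) (5 * (1 / 2 ^ n b))) :=
        ENNReal.tsum_mul_left.symm
    _ ≤ ∑' b : u, 10 * ∫⁻ y in Metric.closedBall (b : ℝ) (1 / 2 ^ n b), g y ∂unitMeasure :=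
        ENNReal.tsum_le_tsum fun b => hball b b.2
    _ = 10 * ∑' b : u, ∫⁻ y in Metric.closedBall (b : ℝ) (1 / 2 ^ n b), g y ∂unitMeasure :=
        ENNReal.tsum_mul_left
    _ = 10 * ∫⁻ y in ⋃ b ∈ u, Metric.closedBall b (1 / 2 ^ n b), g y ∂unitMeasure := by
        rw [lintegral_biUnion hcount
          (fun b _ => Metric.isClosed_closedBall.measurableSet) hdisj]
    _ ≤ 10 * ∫⁻ y, g y ∂unitMeasure := by gcongr; exact Measure.restrict_le_self

/-- The layer cake formula for a single number of `[0, ∞]`. -/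
theorem lintegral_indicator_lt_eq_rpow (a : ℝ≥0∞) {r : ℝ} (hr : 0 < r) :
    ∫⁻ t in Set.Ioi (0 : ℝ), ENNReal.ofReal (r * t ^ (r - 1)) *
      (if ENNReal.ofReal t < a then 1 else 0) = a ^ r := by
  have key : ∀ b : ℝ, 0 ≤ b → ∫⁻ t in Set.Ioi (0 : ℝ), ENNReal.ofReal (r * t ^ (r - 1)) *
      (if t < b then 1 else 0) = ENNReal.ofReal (b ^ r) := by
    intro b hb
    have h := lintegral_rpow_eq_lintegral_meas_lt_mul (Measure.dirac ())
      (f := fun _ : Unit => b) (Eventually.of_forall fun _ => hb) aemeasurable_const hr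
    rw [lintegral_dirac] at h
    rw [h, ← lintegral_const_mul' _ _ ENNReal.ofReal_ne_top]
    refine lintegral_congr fun t => ?_
    rw [ENNReal.ofReal_mul hr.le, mul_assoc, mul_comm (ENNReal.ofReal (t ^ (r - 1)))]
    by_cases htb : t < b <;> simp [htb]
  rcases eq_or_ne a ⊤ with rfl | ha
  · rw [ENNReal.top_rpow_of_pos hr]
    refine ENNReal.eq_top_of_forall_nnreal_le fun c => ?_
    have h := key ((c : ℝ) ^ (1 / r)) (by positivity)
    rw [← Real.rpow_mul (NNReal.coe_nonneg c), one_div_mul_cancel hr.ne', Real.rpow_one,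
      ENNReal.ofReal_coe_nnreal] at h
    rw [← h]
    refine lintegral_mono fun t => ?_
    gcongr
    simp only [ENNReal.ofReal_lt_top, if_true]
    split_ifs <;> simp
  · have h := key a.toReal ENNReal.toReal_nonneg
    rw [← ENNReal.ofReal_rpow_of_nonneg ENNReal.toReal_nonneg hr.le, ENNReal.ofReal_toReal ha] at h
    rw [← h]
    refine setLIntegral_congr_fun measurableSet_Ioi fun t ht => ?_
    simp only [ENNReal.ofReal_lt_iff_lt_toReal (le_of_lt ht) ha]

/-- The maximal function is bounded on `L^r(0,1)` for `1 < r < ∞`. -/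
theorem exists_lintegral_maxFun_rpow_le {r : ℝ} (hr : 1 < r) :
    ∃ C : ℝ≥0, ∀ g : ℝ → ℝ≥0∞, Measurable g →
      ∫⁻ x, maxFun g x ^ r ∂unitMeasure ≤ C * ∫⁻ x, g x ^ r ∂unitMeasure := by
  refine ⟨⟨20 * (r / (r - 1)) * 4 ^ (r - 1), by
    have : 0 < r - 1 := by linarith
    positivity⟩, fun g hg => ?_⟩
  have hr0 : 0 < r := by linarith
  have hr1 : 0 < r - 1 := by linarith
  -- the part of `g` below height `t / 4` contributes at most `t / 2` to the maximal function, so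
  -- the level set at height `t` is controlled by the part of `g` above `t / 4`
  have hlevel : ∀ t : ℝ, 0 < t → ENNReal.ofReal (r * t ^ (r - 1)) *
      unitMeasure {x | ENNReal.ofReal t < maxFun g x} ≤
      ENNReal.ofReal (20 * (r / (r - 1)) * ((r - 1) * t ^ (r - 1 - 1))) *
        ∫⁻ y, (if ENNReal.ofReal t < 4 * g y then g y else 0) ∂unitMeasure := by
    intro t ht
    set g1 : ℝ → ℝ≥0∞ := fun y => if ENNReal.ofReal t < 4 * g y then g y else 0 with hg1
    have hg1m : Measurable g1 :=
      Measurable.ite (measurableSet_lt measurable_const (hg.const_mul 4)) hg measurable_const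
    have hsub : {x | ENNReal.ofReal t < maxFun g x} ⊆
        {x | ENNReal.ofReal (t / 2) < maxFun g1 x} := by
      intro x hx
      have h1 : maxFun g x ≤ maxFun g1 x + 2 * ENNReal.ofReal (t / 4) := by
        refine le_trans (maxFun_mono (h := fun y => g1 y + ENNReal.ofReal (t / 4)) ?_ x) ?_
        · intro y
          simp only [hg1]
          split_ifs with h
          · exact le_self_add
          · rw [zero_add]
            have h4 : 4 * g y ≤ 4 * ENNReal.ofReal (t / 4) := by
              refine (not_lt.1 h).trans (le_of_eq ?_)
              rw [show (4 : ℝ≥0∞) = ENNReal.ofReal 4 by norm_num,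
                ← ENNReal.ofReal_mul (by norm_num)]
              congr 1; ring
            exact (ENNReal.mul_le_mul_iff_right (by norm_num) (by norm_num)).1 h4
        · exact (maxFun_add_le hg1m x).trans (by gcongr; exact maxFun_const_le _ x)
      by_contra hcon
      have h2 : maxFun g1 x ≤ ENNReal.ofReal (t / 2) := not_lt.1 hcon
      have h3 : maxFun g x ≤ ENNReal.ofReal t := by
        refine h1.trans ((add_le_add_left h2 _).trans (le_of_eq ?_))
        rw [show (2 : ℝ≥0∞) = ENNReal.ofReal 2 by norm_num,
          ← ENNReal.ofReal_mul (by norm_num), ← ENNReal.ofReal_add (by positivity) (by positivity)]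
        congr 1; ring
      exact absurd hx (not_lt.2 h3)
    have hw := mul_measure_maxFun_le g1 (ENNReal.ofReal (t / 2))
    have e1 : r * t ^ (r - 1) = (2 * r * t ^ (r - 1 - 1)) * (t / 2) := by
      have : t ^ (r - 1) = t ^ (r - 1 - 1) * t := by
        rw [Real.rpow_sub_one ht.ne' (r - 1)]; field_simp
      rw [this]; ring
    have e2 : 20 * (r / (r - 1)) * ((r - 1) * t ^ (r - 1 - 1)) =
        (2 * r * t ^ (r - 1 - 1)) * 10 := by field_simp; norm_num
    rw [e1, e2, ENNReal.ofReal_mul (by positivity),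
      ENNReal.ofReal_mul (p := 2 * r * t ^ (r - 1 - 1)) (by positivity),
      mul_assoc (ENNReal.ofReal _), mul_assoc (ENNReal.ofReal _)]
    refine mul_le_mul' le_rfl ?_
    rw [show ENNReal.ofReal 10 = 10 by norm_num]
    refine le_trans ?_ hw
    gcongr
  have hM := measurable_maxFun hg
  calc ∫⁻ x, maxFun g x ^ r ∂unitMeasure
      = ∫⁻ x, (∫⁻ t in Set.Ioi (0 : ℝ), ENNReal.ofReal (r * t ^ (r - 1)) *
          (if ENNReal.ofReal t < maxFun g x then 1 else 0)) ∂unitMeasure := by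
        refine lintegral_congr fun x => ?_
        rw [lintegral_indicator_lt_eq_rpow _ hr0]
    _ = ∫⁻ t in Set.Ioi (0 : ℝ), ∫⁻ x, ENNReal.ofReal (r * t ^ (r - 1)) *
          (if ENNReal.ofReal t < maxFun g x then 1 else 0) ∂unitMeasure := by
        refine lintegral_lintegral_swap (Measurable.aemeasurable ?_)
        refine Measurable.mul (by fun_prop) ?_
        exact Measurable.ite (measurableSet_lt (by fun_prop) (hM.comp measurable_fst))
          measurable_const measurable_const
    _ = ∫⁻ t in Set.Ioi (0 : ℝ), ENNReal.ofReal (r * t ^ (r - 1)) *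
          unitMeasure {x | ENNReal.ofReal t < maxFun g x} := by
        refine lintegral_congr fun t => ?_
        rw [lintegral_const_mul' _ _ ENNReal.ofReal_ne_top]
        congr 1
        rw [← lintegral_indicator_one (measurableSet_lt measurable_const hM)]
        refine lintegral_congr fun x => ?_
        simp [Set.indicator_apply]
    _ ≤ ∫⁻ t in Set.Ioi (0 : ℝ), ENNReal.ofReal (20 * (r / (r - 1)) *
          ((r - 1) * t ^ (r - 1 - 1))) *
          ∫⁻ y, (if ENNReal.ofReal t < 4 * g y then g y else 0) ∂unitMeasure :=
        setLIntegral_mono' measurableSet_Ioi fun t ht => hlevel t ht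
    _ = ∫⁻ t in Set.Ioi (0 : ℝ), ∫⁻ y, ENNReal.ofReal (20 * (r / (r - 1)) *
          ((r - 1) * t ^ (r - 1 - 1))) *
          (if ENNReal.ofReal t < 4 * g y then g y else 0) ∂unitMeasure := by
        refine lintegral_congr fun t => ?_
        rw [lintegral_const_mul' _ _ ENNReal.ofReal_ne_top]
    _ = ∫⁻ y, (∫⁻ t in Set.Ioi (0 : ℝ), ENNReal.ofReal (20 * (r / (r - 1)) *
          ((r - 1) * t ^ (r - 1 - 1))) *
          (if ENNReal.ofReal t < 4 * g y then g y else 0)) ∂unitMeasure := by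
        refine lintegral_lintegral_swap (Measurable.aemeasurable ?_)
        refine Measurable.mul (by fun_prop) ?_
        exact Measurable.ite (measurableSet_lt (by fun_prop)
          ((hg.comp measurable_snd).const_mul 4)) (hg.comp measurable_snd) measurable_const
    _ = ∫⁻ y, ENNReal.ofReal (20 * (r / (r - 1)) * 4 ^ (r - 1)) * g y ^ r ∂unitMeasure := by
        refine lintegral_congr fun y => ?_
        have h := lintegral_indicator_lt_eq_rpow (4 * g y) hr1
        have e : ∀ t : ℝ, ENNReal.ofReal (20 * (r / (r - 1)) * ((r - 1) * t ^ (r - 1 - 1))) *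
            (if ENNReal.ofReal t < 4 * g y then g y else 0) =
            ENNReal.ofReal (20 * (r / (r - 1))) * g y * (ENNReal.ofReal ((r - 1) *
              t ^ (r - 1 - 1)) * (if ENNReal.ofReal t < 4 * g y then 1 else 0)) := by
          intro t
          rw [ENNReal.ofReal_mul (by positivity)]
          split_ifs <;> ring
        simp_rw [e]
        rw [lintegral_const_mul _ (by
          refine Measurable.mul (by fun_prop) ?_
          exact Measurable.ite (measurableSet_lt (by fun_prop) measurable_const)
            measurable_const measurable_const), h,
          ENNReal.mul_rpow_of_nonneg _ _ hr1.le]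
        have : g y ^ r = g y * g y ^ (r - 1) := by
          conv_lhs => rw [show r = 1 + (r - 1) by ring,
            ENNReal.rpow_add_of_nonneg _ _ zero_le_one hr1.le, ENNReal.rpow_one]
        rw [this, ENNReal.ofReal_mul (p := 20 * (r / (r - 1))) (by positivity),
          ← ENNReal.ofReal_rpow_of_nonneg (by norm_num) hr1.le]
        rw [show ENNReal.ofReal 4 = 4 by norm_num]
        ring
    _ = _ := by
        rw [lintegral_const_mul' _ _ ENNReal.ofReal_ne_top]
        congr 1
        exact ENNReal.ofReal_eq_coe_nnreal _

/-! ### Extracting `L^s` bounds from weighted inequalities -/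

/-- The `L^q` variant `(M (g ^ q)) ^ (1 / q)` of the maximal function. -/
def maxFunPow (q : ℝ) (g : ℝ → ℝ≥0∞) (x : ℝ) : ℝ≥0∞ := maxFun (fun y => g y ^ q) x ^ (1 / q)

theorem measurable_maxFunPow (q : ℝ) {g : ℝ → ℝ≥0∞} (hg : Measurable g) :
    Measurable (maxFunPow q g) :=
  (measurable_maxFun (hg.pow_const q)).pow_const _

/-- An inequality `X ≤ D X ^ (1 / s')` with finite `X` self-improves to `X ≤ D ^ s`. -/
theorem le_rpow_of_le_mul_rpow {s s' : ℝ} (h : s.HolderConjugate s') {X D : ℝ≥0∞} (hX : X ≠ ⊤)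
    (hXD : X ≤ D * X ^ (1 / s')) : X ≤ D ^ s := by
  rcases eq_or_ne X 0 with rfl | h0
  · exact zero_le
  have hs := h.pos
  have h1 : X ^ (1 / s) ≤ D := by
    have e : X = X ^ (1 / s) * X ^ (1 / s') := by
      rw [← ENNReal.rpow_add _ _ h0 hX, one_div, one_div, h.inv_add_inv_eq_one, ENNReal.rpow_one]
    rw [e, ← e] at hXD
    have hY0 : X ^ (1 / s') ≠ 0 := (ENNReal.rpow_pos (pos_iff_ne_zero.2 h0) hX).ne'
    have hYt : X ^ (1 / s') ≠ ⊤ := ENNReal.rpow_ne_top_of_nonneg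
      (one_div_nonneg.2 h.symm.pos.le) hX
    refine (ENNReal.mul_le_mul_iff_left hY0 hYt).1 ?_
    rw [← e]; exact hXD
  calc X = (X ^ (1 / s)) ^ s := by
        rw [← ENNReal.rpow_mul, one_div_mul_cancel hs.ne', ENNReal.rpow_one]
    _ ≤ D ^ s := ENNReal.rpow_le_rpow h1 hs.le

/-- Bounds for `∫ F ^ s` pass from the truncations of `F` to `F`. -/
theorem lintegral_rpow_le_of_forall_min {μ : Measure ℝ} {F : ℝ → ℝ≥0∞} (hF : Measurable F) {s : ℝ}
    (hs : 0 ≤ s) {B : ℝ≥0∞} (h : ∀ n : ℕ, ∫⁻ x, min (F x) n ^ s ∂μ ≤ B) :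
    ∫⁻ x, F x ^ s ∂μ ≤ B := by
  refine le_of_tendsto' (lintegral_tendsto_of_tendsto_of_monotone
    (f := fun (n : ℕ) x => min (F x) n ^ s) (fun n => ?_) ?_ ?_) h
  · exact ((hF.min measurable_const).pow_const s).aemeasurable
  · refine Eventually.of_forall fun x n m hnm => ?_
    exact ENNReal.rpow_le_rpow (min_le_min le_rfl (by exact_mod_cast hnm)) hs
  · refine Eventually.of_forall fun x => ?_
    refine (ENNReal.continuous_rpow_const.tendsto _).comp ?_
    have := (tendsto_const_nhds (x := F x)).min ENNReal.tendsto_nat_nhds_top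
    simpa using this

theorem exists_lintegral_maxFunPow_rpow_le {q r : ℝ} (hq : 0 < q) (hqr : q < r) :
    ∃ C : ℝ≥0, ∀ g : ℝ → ℝ≥0∞, Measurable g →
      ∫⁻ x, maxFunPow q g x ^ r ∂unitMeasure ≤ C * ∫⁻ x, g x ^ r ∂unitMeasure := by
  obtain ⟨C, hC⟩ := exists_lintegral_maxFun_rpow_le (r := r / q) ((one_lt_div hq).2 hqr)
  refine ⟨C, fun g hg => ?_⟩
  have h := hC (fun y => g y ^ q) (hg.pow_const q)
  simp_rw [← ENNReal.rpow_mul] at h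
  rw [mul_div_cancel₀ _ hq.ne'] at h
  refine le_trans (le_of_eq (lintegral_congr fun x => ?_)) h
  unfold maxFunPow
  rw [← ENNReal.rpow_mul]
  congr 1
  ring

/-- If `∫ F g ≤ K ∫ H M_q g` for all weights `g`, with `q` close enough to `1`, then `‖F‖_s` is
bounded by a multiple of `K ‖H‖_s`: test with `g = F ^ (s - 1)` and use that `M_q` is bounded on
the dual space of `L^s`. -/
theorem exists_lintegral_rpow_le_of_weighted {s : ℝ} (hs : 1 ≤ s) :
    ∃ q : ℝ, 1 < q ∧ ∃ C : ℝ≥0, ∀ F H : ℝ → ℝ≥0∞, Measurable F → Measurable H → ∀ K : ℝ≥0∞,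
      (∀ g : ℝ → ℝ≥0∞, Measurable g →
        ∫⁻ x, F x * g x ∂unitMeasure ≤ K * ∫⁻ x, H x * maxFunPow q g x ∂unitMeasure) →
      ∫⁻ x, F x ^ s ∂unitMeasure ≤ C * K ^ s * ∫⁻ x, H x ^ s ∂unitMeasure := by
  rcases hs.eq_or_lt with rfl | hs
  -- for `s = 1` the weight `g = 1` suffices, and any `q` will do
  · refine ⟨2, by norm_num, 2, fun F H hF hH K h => ?_⟩
    have h1 := h (fun _ => 1) measurable_const
    simp only [mul_one, ENNReal.rpow_one] at h1 ⊢
    refine h1.trans ?_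
    rw [mul_comm ((2 : ℝ≥0) : ℝ≥0∞) K, mul_assoc, ← lintegral_const_mul _ hH]
    refine mul_le_mul' le_rfl (lintegral_mono fun x => ?_)
    rw [mul_comm]
    refine mul_le_mul' ?_ le_rfl
    unfold maxFunPow
    simp only [ENNReal.one_rpow]
    calc maxFun (fun _ => 1) x ^ (1 / 2 : ℝ) ≤ (2 * 1 : ℝ≥0∞) ^ (1 / 2 : ℝ) :=
          ENNReal.rpow_le_rpow (maxFun_const_le 1 x) (by norm_num)
      _ ≤ (2 * 1 : ℝ≥0∞) ^ (1 : ℝ) :=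
          ENNReal.rpow_le_rpow_of_exponent_le (by norm_num) (by norm_num)
      _ = ((2 : ℝ≥0) : ℝ≥0∞) := by norm_num
  · have hconj : s.HolderConjugate (s / (s - 1)) := Real.HolderConjugate.conjExponent hs
    set s' := s / (s - 1) with hs'
    have hs'1 : 1 < s' := hconj.symm.lt
    -- `M_q` is bounded on `L^{s'}` for every `q < s'`; the midpoint of `1` and `s'` is one choice
    obtain ⟨C, hC⟩ := exists_lintegral_maxFunPow_rpow_le (q := (1 + s') / 2) (r := s')
      (by linarith) (by linarith)
    refine ⟨(1 + s') / 2, by linarith, C ^ (s / s'), fun F H hF hH K h => ?_⟩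
    -- the truncation makes `X` finite, which is needed to divide by a power of it at the end
    refine lintegral_rpow_le_of_forall_min hF hconj.pos.le fun n => ?_
    set X := ∫⁻ x, min (F x) n ^ s ∂unitMeasure with hX
    have hXt : X ≠ ⊤ := by
      refine ne_top_of_le_ne_top (b := ((n : ℝ≥0∞) ^ s) * unitMeasure Set.univ) ?_ ?_
      · refine ENNReal.mul_ne_top (ENNReal.rpow_ne_top_of_nonneg hconj.pos.le (by simp)) ?_
        exact measure_ne_top _ _
      · rw [← lintegral_const]
        refine lintegral_mono fun x => ENNReal.rpow_le_rpow (min_le_right _ _) hconj.pos.le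
    set g : ℝ → ℝ≥0∞ := fun x => min (F x) n ^ (s - 1) with hg
    have hgm : Measurable g := (hF.min measurable_const).pow_const _
    have hgs : ∀ x, g x ^ s' = min (F x) n ^ s := by
      intro x
      simp only [hg]
      rw [← ENNReal.rpow_mul]
      congr 1
      rw [hs']; field_simp [hconj.sub_one_ne_zero]
    have h1 : X ≤ (K * (C : ℝ≥0∞) ^ (1 / s') * (∫⁻ x, H x ^ s ∂unitMeasure) ^ (1 / s)) *
        X ^ (1 / s') := by
      calc X ≤ ∫⁻ x, F x * g x ∂unitMeasure := by
            refine lintegral_mono fun x => ?_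
            simp only [hg]
            calc min (F x) (n : ℝ≥0∞) ^ s = min (F x) (n : ℝ≥0∞) ^ (1 + (s - 1)) := by
                  congr 1; ring
              _ = min (F x) n * min (F x) n ^ (s - 1) := by
                  rw [ENNReal.rpow_add_of_nonneg _ _ zero_le_one (by linarith), ENNReal.rpow_one]
              _ ≤ F x * min (F x) n ^ (s - 1) := by gcongr; exact min_le_left _ _
        _ ≤ K * ∫⁻ x, H x * maxFunPow ((1 + s') / 2) g x ∂unitMeasure := h g hgm
        _ ≤ K * ((∫⁻ x, H x ^ s ∂unitMeasure) ^ (1 / s) *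
            (∫⁻ x, maxFunPow ((1 + s') / 2) g x ^ s' ∂unitMeasure) ^ (1 / s')) := by
            gcongr
            exact ENNReal.lintegral_mul_le_Lp_mul_Lq _ hconj hH.aemeasurable
              (measurable_maxFunPow _ hgm).aemeasurable
        _ ≤ K * ((∫⁻ x, H x ^ s ∂unitMeasure) ^ (1 / s) * (C * X) ^ (1 / s')) := by
            have := hC g hgm
            simp_rw [hgs] at this
            have h0 := hconj.symm.pos
            gcongr
        _ = _ := by
            rw [ENNReal.mul_rpow_of_nonneg _ _ (one_div_nonneg.2 hconj.symm.pos.le)]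
            ring
    refine (le_rpow_of_le_mul_rpow hconj hXt h1).trans (le_of_eq ?_)
    rw [ENNReal.mul_rpow_of_nonneg _ _ hconj.pos.le, ENNReal.mul_rpow_of_nonneg _ _ hconj.pos.le,
      ← ENNReal.rpow_mul, ← ENNReal.rpow_mul, one_div_mul_cancel hconj.pos.ne', ENNReal.rpow_one,
      ENNReal.coe_rpow_of_nonneg _ (div_nonneg hconj.pos.le hconj.symm.pos.le),
      one_div_mul_eq_div, mul_comm (K ^ s)]

/-! ### Powers of two in `[0, ∞]` -/

theorem two_rpow_add (a b : ℝ) : (2 : ℝ≥0∞) ^ (a + b) = 2 ^ a * 2 ^ b :=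
  ENNReal.rpow_add _ _ (by norm_num) (by norm_num)

theorem two_rpow_ne_top (a : ℝ) : (2 : ℝ≥0∞) ^ a ≠ ⊤ := by
  intro h
  rw [ENNReal.rpow_eq_top_iff] at h
  rcases h with h | h
  · exact absurd h.1 (by norm_num)
  · exact absurd h.1 (by norm_num)

theorem two_rpow_mono {a b : ℝ} (h : a ≤ b) : (2 : ℝ≥0∞) ^ a ≤ 2 ^ b :=
  ENNReal.rpow_le_rpow_of_exponent_le (by norm_num) h

theorem ofReal_two_rpow (a : ℝ) : ENNReal.ofReal ((2 : ℝ) ^ a) = 2 ^ a := by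
  rw [← ENNReal.ofReal_rpow_of_pos (by norm_num)]; norm_num

theorem tsum_two_rpow_ne_top {η : ℝ} (hη : 0 < η) : ∑' l : ℕ, (2 : ℝ≥0∞) ^ (-(η * l)) ≠ ⊤ := by
  have h : ∀ l : ℕ, (2 : ℝ≥0∞) ^ (-(η * l)) = ((2 : ℝ≥0∞) ^ (-η)) ^ l := by
    intro l
    rw [← ENNReal.rpow_natCast, ← ENNReal.rpow_mul]
    congr 1; ring
  simp_rw [h]
  rw [ENNReal.tsum_geometric]
  refine ENNReal.inv_ne_top.2 ?_
  rw [← pos_iff_ne_zero, tsub_pos_iff_lt]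
  rw [ENNReal.rpow_neg]
  exact ENNReal.inv_lt_one.2 (ENNReal.one_lt_rpow (by norm_num) hη)

theorem tsum_comp_abs_sub_le (F : ℝ → ℝ≥0∞) (hF : ∀ a b, a ≤ b → F b ≤ F a) (n : ℕ) :
    ∑' m : ℕ, F |(m : ℝ) - n| ≤ 2 * ∑' l : ℕ, F l := by
  have h1 : ∑ m ∈ Finset.range n, F |(m : ℝ) - n| ≤ ∑ l ∈ Finset.range n, F l := by
    rw [← Finset.sum_range_reflect (fun l : ℕ => F l)]
    refine Finset.sum_le_sum fun l hl => ?_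
    have hl := Finset.mem_range.1 hl
    have h1 : (((n - 1 - l : ℕ) : ℝ)) = n - 1 - l := by
      rw [Nat.cast_sub (by omega), Nat.cast_sub (by omega)]; simp
    have h2 : (l : ℝ) ≤ n := by exact_mod_cast hl.le
    rw [h1, abs_of_nonpos (by linarith)]
    exact hF _ _ (by linarith)
  have h2 : ∀ l : ℕ, F |((l + n : ℕ) : ℝ) - n| = F l := by
    intro l
    rw [Nat.cast_add, add_sub_cancel_right, abs_of_nonneg (Nat.cast_nonneg l)]
  have h3 := ENNReal.summable.sum_add_tsum_nat_add' (f := fun m : ℕ => F |(m : ℝ) - n|) (k := n)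
  simp only [h2] at h3
  rw [← h3, two_mul]
  exact add_le_add (h1.trans (ENNReal.sum_le_tsum _)) le_rfl

theorem tsum_two_rpow_abs_le {η : ℝ} (hη : 0 ≤ η) (n : ℕ) :
    ∑' m : ℕ, (2 : ℝ≥0∞) ^ (-(η * |(m : ℝ) - n|)) ≤ 2 * ∑' l : ℕ, (2 : ℝ≥0∞) ^ (-(η * l)) :=
  tsum_comp_abs_sub_le (fun a : ℝ => (2 : ℝ≥0∞) ^ (-(η * a)))
    (fun _ _ h => two_rpow_mono (neg_le_neg (mul_le_mul_of_nonneg_left h hη))) n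

/-! ### The decay kernel and the maximal function -/

/-- The kernel `ξ (2 ^ n (x - y))` with values in `[0, ∞]`. -/
def decayKernel (δ : ℝ) (n : ℕ) (x y : ℝ) : ℝ≥0∞ := ENNReal.ofReal (xi δ (2 ^ n * (x - y)))

theorem xi_neg (δ x : ℝ) : xi δ (-x) = xi δ x := by simp [xi]

theorem decayKernel_comm (δ : ℝ) (n : ℕ) (x y : ℝ) :
    decayKernel δ n x y = decayKernel δ n y x := by
  unfold decayKernel
  rw [← xi_neg, ← mul_neg, neg_sub]

theorem xi_le_one {δ : ℝ} (hδ : 0 < δ) (x : ℝ) : xi δ x ≤ 1 := by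
  unfold xi
  rw [div_le_one (by positivity)]
  exact Real.one_le_rpow (by linarith [abs_nonneg x]) (by linarith)

theorem xi_le_of_abs_sub_le {δ : ℝ} (hδ0 : 0 < δ) (hδ1 : δ < 1) {u v : ℝ} (h : |u - v| ≤ 1) :
    xi δ u ≤ 4 * xi δ v := by
  unfold xi
  have h1 : 1 + |v| ≤ 2 * (1 + |u|) := by
    have := abs_sub_abs_le_abs_sub v u
    rw [abs_sub_comm] at this
    linarith [abs_nonneg u]
  have h2 : (1 + |v|) ^ (1 + δ) ≤ 4 * (1 + |u|) ^ (1 + δ) := by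
    calc (1 + |v|) ^ (1 + δ) ≤ (2 * (1 + |u|)) ^ (1 + δ) :=
          Real.rpow_le_rpow (by positivity) h1 (by linarith)
      _ = 2 ^ (1 + δ) * (1 + |u|) ^ (1 + δ) := Real.mul_rpow (by norm_num) (by positivity)
      _ ≤ 4 * (1 + |u|) ^ (1 + δ) := by
          gcongr
          calc (2 : ℝ) ^ (1 + δ) ≤ 2 ^ (2 : ℝ) :=
                Real.rpow_le_rpow_of_exponent_le (by norm_num) (by linarith)
            _ = 4 := by norm_num
  rw [mul_one_div, div_le_div_iff₀ (by positivity) (by positivity)]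
  linarith

theorem decayKernel_le_of_abs_sub_le {δ : ℝ} (hδ0 : 0 < δ) (hδ1 : δ < 1) {n : ℕ} {x x' : ℝ} (y : ℝ)
    (h : |x - x'| ≤ 1 / 2 ^ n) : decayKernel δ n x y ≤ 4 * decayKernel δ n x' y := by
  unfold decayKernel
  rw [show (4 : ℝ≥0∞) = ENNReal.ofReal 4 by norm_num, ← ENNReal.ofReal_mul (by norm_num)]
  refine ENNReal.ofReal_le_ofReal (xi_le_of_abs_sub_le hδ0 hδ1 ?_)
  have h2 : (0 : ℝ) < 2 ^ n := by positivity
  rw [← mul_sub, show x - y - (x' - y) = x - x' by ring, abs_mul, abs_of_pos h2]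
  rw [le_div_iff₀ h2] at h
  linarith

theorem measurable_xi (δ : ℝ) : Measurable (xi δ) := by
  unfold xi
  fun_prop

theorem measurable_decayKernel (δ : ℝ) (n : ℕ) (y : ℝ) :
    Measurable fun x => decayKernel δ n x y := by
  unfold decayKernel
  have := measurable_xi δ
  fun_prop

/-- The kernel is dominated by a combination of indicator functions of intervals around its center:
the interval of radius `2 ^ (l - n)` has the coefficient `4 * 2 ^ (-(1 + δ) l)`. Radii up to `1` are
enough, so that `l ≤ n` and the subtraction in ℕ is the true one. -/
theorem decayKernel_le_sum {δ : ℝ} (hδ0 : 0 < δ) (hδ1 : δ < 1) (n : ℕ) {x y : ℝ}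
    (hx : x ∈ Set.Icc (0 : ℝ) 1) (hy : y ∈ Set.Icc (0 : ℝ) 1) :
    decayKernel δ n y x ≤ ∑ l ∈ Finset.range (n + 1), 4 * (2 : ℝ≥0∞) ^ (-((1 + δ) * l)) *
      (Metric.closedBall x (1 / 2 ^ (n - l))).indicator 1 y := by
  classical
  have h2 : (0 : ℝ) < 2 ^ n := by positivity
  have hex : ∃ l : ℕ, 2 ^ n * |y - x| ≤ 2 ^ l := by
    refine ⟨n, ?_⟩
    have : |y - x| ≤ 1 := by
      rw [abs_le]; constructor <;> linarith [hx.1, hx.2, hy.1, hy.2]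
    nlinarith
  set l := Nat.find hex with hl
  have hl1 : 2 ^ n * |y - x| ≤ 2 ^ l := Nat.find_spec hex
  have hln : l ≤ n := Nat.find_min' hex (by
    have : |y - x| ≤ 1 := by
      rw [abs_le]; constructor <;> linarith [hx.1, hx.2, hy.1, hy.2]
    nlinarith)
  have hmem : y ∈ Metric.closedBall x (1 / 2 ^ (n - l)) := by
    rw [Metric.mem_closedBall, Real.dist_eq, le_div_iff₀ (by positivity)]
    have e : (2 : ℝ) ^ n = 2 ^ (n - l) * 2 ^ l := by rw [← pow_add, Nat.sub_add_cancel hln]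
    rw [e] at hl1
    have h3 : (0 : ℝ) < 2 ^ l := by positivity
    nlinarith
  refine le_trans ?_ (Finset.single_le_sum (fun _ _ => zero_le) (Finset.mem_range.2
    (Nat.lt_succ_of_le hln)))
  rw [Set.indicator_of_mem hmem, Pi.one_apply, mul_one, show (4 : ℝ≥0∞) = ENNReal.ofReal 4 by
    norm_num, ← ofReal_two_rpow, ← ENNReal.ofReal_mul (by norm_num)]
  refine ENNReal.ofReal_le_ofReal ?_
  rcases Nat.eq_zero_or_pos l with h0 | h0
  · rw [h0]
    refine (xi_le_one hδ0 _).trans ?_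
    norm_num
  · have h3 : ¬ (2 ^ n * |y - x| ≤ 2 ^ (l - 1)) := Nat.find_min hex (by omega)
    push Not at h3
    unfold xi
    rw [abs_mul, abs_of_pos h2, Real.rpow_neg (by norm_num), ← div_eq_mul_inv,
      div_le_div_iff₀ (by positivity) (by positivity), one_mul]
    have e : (2 : ℝ) ^ ((1 + δ) * l) = (2 * 2 ^ (l - 1)) ^ (1 + δ) := by
      rw [← pow_succ', Nat.sub_add_cancel h0, ← Real.rpow_natCast, ← Real.rpow_mul (by norm_num)]
      congr 1; ring
    rw [e, Real.mul_rpow (by norm_num) (by positivity)]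
    refine mul_le_mul ?_ ?_ (by positivity) (by norm_num)
    · calc (2 : ℝ) ^ (1 + δ) ≤ 2 ^ (2 : ℝ) :=
            Real.rpow_le_rpow_of_exponent_le (by norm_num) (by linarith)
        _ = 4 := by norm_num
    · exact Real.rpow_le_rpow (by positivity) (by linarith) (by linarith)

/-- Convolution with the normalized decay kernel is dominated by the maximal function. -/
theorem exists_lintegral_decayKernel_le {δ : ℝ} (hδ0 : 0 < δ) (hδ1 : δ < 1) :
    ∃ C : ℝ≥0, ∀ (n : ℕ) (g : ℝ → ℝ≥0∞), Measurable g → ∀ x ∈ Set.Icc (0 : ℝ) 1,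
      2 ^ n * ∫⁻ y, decayKernel δ n y x * g y ∂unitMeasure ≤ C * maxFun g x := by
  have hC := tsum_two_rpow_ne_top hδ0
  refine ⟨4 * (∑' l : ℕ, (2 : ℝ≥0∞) ^ (-(δ * l))).toNNReal, fun n g hg x hx => ?_⟩
  rw [ENNReal.coe_mul, ENNReal.coe_toNNReal hC]
  calc 2 ^ n * ∫⁻ y, decayKernel δ n y x * g y ∂unitMeasure
      ≤ 2 ^ n * ∫⁻ y, ∑ l ∈ Finset.range (n + 1), 4 * (2 : ℝ≥0∞) ^ (-((1 + δ) * l)) *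
          (Metric.closedBall x (1 / 2 ^ (n - l))).indicator g y ∂unitMeasure := by
        gcongr 2 ^ n * ?_
        refine setLIntegral_mono' measurableSet_Icc fun y hy => ?_
        refine (mul_le_mul' (decayKernel_le_sum hδ0 hδ1 n hx hy) le_rfl).trans (le_of_eq ?_)
        rw [Finset.sum_mul]
        refine Finset.sum_congr rfl fun l _ => ?_
        rw [mul_assoc]
        congr 1
        by_cases h : y ∈ Metric.closedBall x (1 / 2 ^ (n - l))
        · rw [Set.indicator_of_mem h, Set.indicator_of_mem h, Pi.one_apply, one_mul]
        · rw [Set.indicator_of_notMem h, Set.indicator_of_notMem h, zero_mul]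
    _ = 2 ^ n * ∑ l ∈ Finset.range (n + 1), 4 * (2 : ℝ≥0∞) ^ (-((1 + δ) * l)) *
          ∫⁻ y in Metric.closedBall x (1 / 2 ^ (n - l)), g y ∂unitMeasure := by
        congr 1
        rw [lintegral_finsetSum _ fun l _ =>
          (hg.indicator Metric.isClosed_closedBall.measurableSet).const_mul _]
        refine Finset.sum_congr rfl fun l _ => ?_
        rw [lintegral_const_mul _ (hg.indicator Metric.isClosed_closedBall.measurableSet),
          lintegral_indicator Metric.isClosed_closedBall.measurableSet]
    _ = ∑ l ∈ Finset.range (n + 1), 4 * (2 : ℝ≥0∞) ^ (-(δ * l)) * ballAvg (n - l) g x := by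
        rw [Finset.mul_sum]
        refine Finset.sum_congr rfl fun l hl => ?_
        have hln : l ≤ n := Nat.lt_succ_iff.1 (Finset.mem_range.1 hl)
        unfold ballAvg
        have e : (2 : ℝ≥0∞) ^ n = 2 ^ (n - l) * (2 : ℝ≥0∞) ^ (l : ℝ) := by
          rw [ENNReal.rpow_natCast, ← pow_add, Nat.sub_add_cancel hln]
        have e2 : (2 : ℝ≥0∞) ^ (-(δ * l)) = 2 ^ (-((1 + δ) * l)) * (2 : ℝ≥0∞) ^ (l : ℝ) := by
          rw [← two_rpow_add]; congr 1; ring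
        rw [e, e2]
        ring
    _ ≤ ∑ l ∈ Finset.range (n + 1), 4 * (2 : ℝ≥0∞) ^ (-(δ * l)) * maxFun g x := by
        refine Finset.sum_le_sum fun l _ => mul_le_mul' le_rfl (ballAvg_le_maxFun _ _ _)
    _ = 4 * (∑ l ∈ Finset.range (n + 1), (2 : ℝ≥0∞) ^ (-(δ * l))) * maxFun g x := by
        rw [← Finset.sum_mul, ← Finset.mul_sum]
    _ ≤ _ := by
        gcongr
        · norm_num
        · exact ENNReal.sum_le_tsum _

/-! ### Weighted Hölder inequalities -/

theorem lintegral_mul_le_weighted {ι : Type*} [MeasurableSpace ι] {ν : Measure ι} {q : ℝ}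
    (hq : 1 < q) {c f : ι → ℝ≥0∞} (hc : Measurable c) (hf : Measurable f) :
    ∫⁻ x, c x * f x ∂ν ≤ (∫⁻ x, c x ∂ν) ^ (1 - 1 / q) * (∫⁻ x, c x * f x ^ q ∂ν) ^ (1 / q) := by
  have hconj : q.HolderConjugate (q / (q - 1)) := Real.HolderConjugate.conjExponent hq
  have hq0 : 0 < q := by linarith
  have hq1 : 0 < 1 - 1 / q := by
    rw [sub_pos, div_lt_one hq0]; exact hq
  have e1 : 1 / (q / (q - 1)) = 1 - 1 / q := by field_simp
  have e2 : (1 - 1 / q) * (q / (q - 1)) = 1 := by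
    rw [← e1, one_div_mul_cancel hconj.symm.ne_zero]
  have h := ENNReal.lintegral_mul_le_Lp_mul_Lq ν hconj.symm
    (f := fun x => c x ^ (1 - 1 / q)) (g := fun x => c x ^ (1 / q) * f x)
    (hc.pow_const _).aemeasurable ((hc.pow_const _).mul hf).aemeasurable
  have e3 : ∀ x, ((fun x => c x ^ (1 - 1 / q)) * fun x => c x ^ (1 / q) * f x) x = c x * f x := by
    intro x
    simp only [Pi.mul_apply]
    rw [← mul_assoc, ← ENNReal.rpow_add_of_nonneg _ _ hq1.le (by positivity), sub_add_cancel,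
      ENNReal.rpow_one]
  have e4 : ∀ x, (c x ^ (1 - 1 / q)) ^ (q / (q - 1)) = c x := by
    intro x
    rw [← ENNReal.rpow_mul, e2, ENNReal.rpow_one]
  have e5 : ∀ x, (c x ^ (1 / q) * f x) ^ q = c x * f x ^ q := by
    intro x
    rw [ENNReal.mul_rpow_of_nonneg _ _ hq0.le, ← ENNReal.rpow_mul, one_div_mul_cancel hq0.ne',
      ENNReal.rpow_one]
  simp only [e3, e4, e5, e1] at h
  exact h

theorem tsum_mul_le_weighted {ι : Type*} {q : ℝ} (hq : 1 < q) (c f : ι → ℝ≥0∞) :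
    ∑' i, c i * f i ≤ (∑' i, c i) ^ (1 - 1 / q) * (∑' i, c i * f i ^ q) ^ (1 / q) := by
  let _ : MeasurableSpace ι := ⊤
  have h := lintegral_mul_le_weighted (ν := Measure.count) hq (c := c) (f := f)
    measurable_from_top measurable_from_top
  simpa only [lintegral_count] using h

theorem tsum_mul_sq_le (c f : ℕ+ → ℝ≥0∞) :
    (∑' i, c i * f i) ^ 2 ≤ (∑' i, c i) * ∑' i, c i * f i ^ 2 := by
  have h := tsum_mul_le_weighted (q := 2) (by norm_num) c f
  have h2 := ENNReal.rpow_le_rpow h (by norm_num : (0 : ℝ) ≤ 2)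
  rw [ENNReal.mul_rpow_of_nonneg _ _ (by norm_num), ← ENNReal.rpow_mul, ← ENNReal.rpow_mul] at h2
  norm_num at h2
  exact h2

/-! ### Haar averages and square functions of nonnegative sequences -/

/-- The average of `g` over the support of `hₖ`. -/
def haarAvg (k : ℕ+) (g : ℝ → ℝ≥0∞) : ℝ≥0∞ := ∫⁻ x, haarWeight k x * g x ∂unitMeasure

theorem haarAvg_rpow_le {q : ℝ} (hq : 1 < q) (k : ℕ+) {g : ℝ → ℝ≥0∞} (hg : Measurable g) :
    haarAvg k g ^ q ≤ haarAvg k fun x => g x ^ q := by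
  have h := lintegral_mul_le_weighted (ν := unitMeasure) hq (measurable_haarWeight k) hg
  rw [lintegral_haarWeight, ENNReal.one_rpow, one_mul] at h
  have h2 := ENNReal.rpow_le_rpow h (by linarith : (0 : ℝ) ≤ q)
  rwa [← ENNReal.rpow_mul, one_div_mul_cancel (by linarith), ENNReal.rpow_one] at h2

theorem haarAvg_sq_le (k : ℕ+) {g : ℝ → ℝ≥0∞} (hg : Measurable g) :
    haarAvg k g ^ 2 ≤ haarAvg k fun x => g x ^ 2 := by
  have h := haarAvg_rpow_le (q := 2) (by norm_num) k hg
  simpa using h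

theorem haarAvg_const (k : ℕ+) (a : ℝ≥0∞) : haarAvg k (fun _ => a) = a := by
  unfold haarAvg
  rw [lintegral_mul_const _ (measurable_haarWeight k), lintegral_haarWeight, one_mul]

theorem dist_le_of_haarWeight_ne_zero {k : ℕ+} {x y : ℝ} (hx : x ∈ Set.Icc (0 : ℝ) 1)
    (hy : y ∈ Set.Icc (0 : ℝ) 1) (hkx : haarWeight k x ≠ 0) (hky : haarWeight k y ≠ 0) :
    |x - y| ≤ 1 / 2 ^ level k := by
  have h1 := abs_sub_center_le hx hkx
  have h2 := abs_sub_center_le hy hky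
  rw [abs_sub_comm] at h2
  have h3 := abs_sub_le x (center k) y
  linarith

theorem haarAvg_le_maxFun {k : ℕ+} {x : ℝ} (hx : x ∈ Set.Icc (0 : ℝ) 1)
    (hkx : haarWeight k x ≠ 0) (g : ℝ → ℝ≥0∞) : haarAvg k g ≤ maxFun g x := by
  refine le_trans ?_ (ballAvg_le_maxFun (level k) g x)
  unfold haarAvg ballAvg
  rw [← lintegral_const_mul' _ _ (by simp), ← lintegral_indicator
    Metric.isClosed_closedBall.measurableSet]
  refine setLIntegral_mono' measurableSet_Icc fun y hy => ?_
  by_cases hky : haarWeight k y = 0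
  · rw [hky, zero_mul]; exact zero_le
  · rw [Set.indicator_of_mem (by
      rw [Metric.mem_closedBall, Real.dist_eq]
      exact dist_le_of_haarWeight_ne_zero hy hx hky hkx)]
    exact mul_le_mul' (haarWeight_le k y) le_rfl

theorem haarAvg_le_maxFunPow {q : ℝ} (hq : 1 < q) {k : ℕ+} {x : ℝ} (hx : x ∈ Set.Icc (0 : ℝ) 1)
    (hkx : haarWeight k x ≠ 0) {g : ℝ → ℝ≥0∞} (hg : Measurable g) :
    haarAvg k g ≤ maxFunPow q g x := by
  have h := (haarAvg_rpow_le hq k hg).trans (haarAvg_le_maxFun hx hkx _)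
  have h2 := ENNReal.rpow_le_rpow h (by positivity : (0 : ℝ) ≤ 1 / q)
  rwa [← ENNReal.rpow_mul, mul_one_div_cancel (by linarith), ENNReal.rpow_one] at h2

/-- The square `∑ₖ bₖ² hₖ²` of the square function of a sequence `b` with values in `[0, ∞]`. -/
def seqSquare (b : ℕ+ → ℝ≥0∞) (x : ℝ) : ℝ≥0∞ := ∑' k, b k ^ 2 * haarWeight k x

theorem measurable_seqSquare (b : ℕ+ → ℝ≥0∞) : Measurable (seqSquare b) :=
  Measurable.tsum fun k => (measurable_haarWeight k).const_mul _

theorem lintegral_seqSquare_mul (b : ℕ+ → ℝ≥0∞) {g : ℝ → ℝ≥0∞} (hg : Measurable g) :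
    ∫⁻ x, seqSquare b x * g x ∂unitMeasure = ∑' k, b k ^ 2 * haarAvg k g := by
  unfold seqSquare haarAvg
  simp_rw [← ENNReal.tsum_mul_right]
  rw [lintegral_tsum fun k => (((measurable_haarWeight k).const_mul _).fun_mul hg).aemeasurable]
  refine tsum_congr fun k => ?_
  rw [← lintegral_const_mul _ ((measurable_haarWeight k).fun_mul hg)]
  refine lintegral_congr fun x => ?_
  rw [mul_assoc]

/-- Weighted estimates for `∑ₖ bₖ² sₖ` when `sₖ` is dominated by `G` on the support of `hₖ`. -/
theorem tsum_sq_mul_le_lintegral (b s : ℕ+ → ℝ≥0∞) {G : ℝ → ℝ≥0∞} (hG : Measurable G)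
    (h : ∀ k, ∀ x ∈ Set.Icc (0 : ℝ) 1, haarWeight k x ≠ 0 → s k ≤ G x) :
    ∑' k, b k ^ 2 * s k ≤ ∫⁻ x, seqSquare b x * G x ∂unitMeasure := by
  rw [lintegral_seqSquare_mul b hG]
  refine ENNReal.tsum_le_tsum fun k => mul_le_mul' le_rfl ?_
  rw [← haarAvg_const k (s k)]
  refine setLIntegral_mono' measurableSet_Icc fun x hx => ?_
  by_cases hkx : haarWeight k x = 0
  · rw [hkx, zero_mul, zero_mul]
  · exact mul_le_mul' le_rfl (h k x hx hkx)

/-- Cauchy-Schwarz and Hölder for the pairing of two sequences. -/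
theorem tsum_mul_le_seqSquare {p p' : ℝ} (h : p.HolderConjugate p') (b d : ℕ+ → ℝ≥0∞) :
    ∑' k, b k * d k ≤ (∫⁻ x, seqSquare b x ^ (p / 2) ∂unitMeasure) ^ (1 / p) *
      (∫⁻ x, seqSquare d x ^ (p' / 2) ∂unitMeasure) ^ (1 / p') := by
  have hpt : ∀ x, ∑' k, b k * d k * haarWeight k x ≤
      seqSquare b x ^ (1 / 2 : ℝ) * seqSquare d x ^ (1 / 2 : ℝ) := by
    intro x
    let _ : MeasurableSpace ℕ+ := ⊤
    have hcs := ENNReal.lintegral_mul_le_Lp_mul_Lq (Measure.count : Measure ℕ+)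
      (p := 2) (q := 2) Real.HolderConjugate.two_two
      (f := fun k => b k * haarWeight k x ^ (1 / 2 : ℝ))
      (g := fun k => d k * haarWeight k x ^ (1 / 2 : ℝ))
      measurable_from_top.aemeasurable measurable_from_top.aemeasurable
    simp only [lintegral_count, Pi.mul_apply] at hcs
    have e1 : ∀ a c : ℝ≥0∞, (a * c ^ (1 / 2 : ℝ)) ^ (2 : ℝ) = a ^ 2 * c := by
      intro a c
      rw [ENNReal.mul_rpow_of_nonneg _ _ (by norm_num), ← ENNReal.rpow_mul]
      norm_num
    have e2 : ∀ a a' c : ℝ≥0∞, (a * c ^ (1 / 2 : ℝ)) * (a' * c ^ (1 / 2 : ℝ)) = a * a' * c := by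
      intro a a' c
      have : c ^ (1 / 2 : ℝ) * c ^ (1 / 2 : ℝ) = c := by
        rw [← ENNReal.rpow_add_of_nonneg _ _ (by norm_num) (by norm_num)]
        norm_num
      calc _ = a * a' * (c ^ (1 / 2 : ℝ) * c ^ (1 / 2 : ℝ)) := by ring
        _ = _ := by rw [this]
    simp only [e1, e2] at hcs
    exact hcs
  have hsq : ∀ (r : ℝ) (c : ℕ+ → ℝ≥0∞) (x : ℝ), (seqSquare c x ^ (1 / 2 : ℝ)) ^ r =
      seqSquare c x ^ (r / 2) := by
    intro r c x
    rw [← ENNReal.rpow_mul]; congr 1; ring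
  calc ∑' k, b k * d k = ∑' k, ∫⁻ x, b k * d k * haarWeight k x ∂unitMeasure := by
        refine tsum_congr fun k => ?_
        rw [lintegral_const_mul _ (measurable_haarWeight k), lintegral_haarWeight, mul_one]
    _ = ∫⁻ x, ∑' k, b k * d k * haarWeight k x ∂unitMeasure :=
        (lintegral_tsum fun k => ((measurable_haarWeight k).const_mul _).aemeasurable).symm
    _ ≤ ∫⁻ x, seqSquare b x ^ (1 / 2 : ℝ) * seqSquare d x ^ (1 / 2 : ℝ) ∂unitMeasure :=
        lintegral_mono hpt
    _ ≤ _ := by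
        have hH := ENNReal.lintegral_mul_le_Lp_mul_Lq unitMeasure h
          ((measurable_seqSquare b).pow_const (1 / 2 : ℝ)).aemeasurable
          ((measurable_seqSquare d).pow_const (1 / 2 : ℝ)).aemeasurable
        simp only [Pi.mul_apply, hsq] at hH
        exact hH

/-! ### Almost diagonal matrices -/

/-- Nonnegative matrices indexed by the Haar system which decay away from the diagonal. The entries
carry the natural factor `2 ^ (-|n - m| / 2)`, with `n`, `m` the levels, and spatial decay at the
coarser of the two scales. Summability over the levels comes from a gain `2 ^ (-ε |n - m|)` in the
sums over the finer index only; no such gain is asked of the single entries. The conditions are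
invariant under transposition. -/
structure AlmostDiag (δ ε : ℝ) (D : ℝ≥0) (A : ℕ+ → ℕ+ → ℝ≥0∞) : Prop where
  entry_le : ∀ j k, A j k ≤ D * 2 ^ (-(|(level j : ℝ) - level k| / 2)) *
    decayKernel δ (min (level j) (level k)) (center j) (center k)
  row_le : ∀ j m, level j ≤ m → ∑' k, (if level k = m then A j k else 0) ≤
    D * 2 ^ ((1 / 2 - ε) * ((m : ℝ) - level j))
  col_le : ∀ k n, level k ≤ n → ∑' j, (if level j = n then A j k else 0) ≤
    D * 2 ^ ((1 / 2 - ε) * ((n : ℝ) - level k))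

theorem AlmostDiag.transpose {δ ε : ℝ} {D : ℝ≥0} {A : ℕ+ → ℕ+ → ℝ≥0∞} (h : AlmostDiag δ ε D A) :
    AlmostDiag δ ε D fun j k => A k j where
  entry_le j k := by
    rw [decayKernel_comm, min_comm, abs_sub_comm]
    exact h.entry_le k j
  row_le := h.col_le
  col_le := h.row_le

/-- The action of a nonnegative matrix on a sequence. -/
def matMul (A : ℕ+ → ℕ+ → ℝ≥0∞) (b : ℕ+ → ℝ≥0∞) (j : ℕ+) : ℝ≥0∞ := ∑' k, A j k * b k

/-- The sum over one level of a column, against averages of a weight `g`: only the decay of the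
single entries is used, and there is no gain in the levels. -/
theorem exists_level_sum_haarAvg_le {δ : ℝ} (hδ0 : 0 < δ) (hδ1 : δ < 1) :
    ∃ C : ℝ≥0, ∀ (ε : ℝ) (D : ℝ≥0) (A : ℕ+ → ℕ+ → ℝ≥0∞), AlmostDiag δ ε D A →
      ∀ g : ℝ → ℝ≥0∞, Measurable g → ∀ (k : ℕ+) (n : ℕ), ∀ x ∈ Set.Icc (0 : ℝ) 1,
      haarWeight k x ≠ 0 → ∑' j, (if level j = n then A j k else 0) * haarAvg j g ≤
        C * D * 2 ^ (((n : ℝ) - level k) / 2) * maxFun g x := by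
  obtain ⟨C, hC⟩ := exists_lintegral_decayKernel_le hδ0 hδ1
  refine ⟨32 * C, fun ε D A hA g hg k n x hx hkx => ?_⟩
  set l := min n (level k) with hl
  -- on the supports of `hⱼ` and `hₖ` the centers in the kernel may be replaced by any other points,
  -- at the cost of a factor `4` each
  have hker : ∀ j : ℕ+, level j = n → A j k * haarAvg j g ≤
      16 * D * 2 ^ (-(|(n : ℝ) - level k| / 2)) *
        ∫⁻ y, haarWeight j y * (decayKernel δ l y x * g y) ∂unitMeasure := by
    intro j hj
    have hm : Measurable fun y => decayKernel δ l y x * g y :=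
      (measurable_decayKernel δ l x).mul hg
    unfold haarAvg
    rw [← lintegral_const_mul _ ((measurable_haarWeight j).fun_mul hg),
      ← lintegral_const_mul _ ((measurable_haarWeight j).fun_mul hm)]
    refine setLIntegral_mono' measurableSet_Icc fun y hy => ?_
    by_cases hjy : haarWeight j y = 0
    · simp [hjy]
    have h1 : decayKernel δ l (center j) (center k) ≤ 4 * decayKernel δ l y (center k) := by
      refine decayKernel_le_of_abs_sub_le hδ0 hδ1 _ ?_
      rw [abs_sub_comm]
      refine (abs_sub_center_le hy hjy).trans ?_
      have e : (1 : ℝ) / 2 ^ level j ≤ 1 / 2 ^ l :=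
        one_div_le_one_div_of_le (by positivity)
          (pow_le_pow_right₀ (by norm_num) (by rw [hj]; exact min_le_left _ _))
      have e2 : (0 : ℝ) < 1 / 2 ^ level j := by positivity
      linarith
    have h2 : decayKernel δ l y (center k) ≤ 4 * decayKernel δ l y x := by
      rw [decayKernel_comm, decayKernel_comm δ l y x]
      refine decayKernel_le_of_abs_sub_le hδ0 hδ1 _ ?_
      rw [abs_sub_comm]
      refine (abs_sub_center_le hx hkx).trans ?_
      have e : (1 : ℝ) / 2 ^ level k ≤ 1 / 2 ^ l :=
        one_div_le_one_div_of_le (by positivity)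
          (pow_le_pow_right₀ (by norm_num) (min_le_right _ _))
      have e2 : (0 : ℝ) < 1 / 2 ^ level k := by positivity
      linarith
    have h3 := hA.entry_le j k
    rw [hj, ← hl] at h3
    calc A j k * (haarWeight j y * g y)
        ≤ (D * 2 ^ (-(|(n : ℝ) - level k| / 2)) * (4 * (4 * decayKernel δ l y x))) *
          (haarWeight j y * g y) := by
          refine mul_le_mul' (h3.trans (mul_le_mul' le_rfl (h1.trans (mul_le_mul' le_rfl h2))))
            le_rfl
      _ = 4 * 4 * D * 2 ^ (-(|(n : ℝ) - level k| / 2)) *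
          (haarWeight j y * (decayKernel δ l y x * g y)) := by ring
      _ = _ := by norm_num
  have hm : Measurable fun y => decayKernel δ l y x * g y :=
    (measurable_decayKernel δ l x).mul hg
  have hite : ∀ j : ℕ+, Measurable fun y => (if level j = n then haarWeight j y else 0) := by
    intro j
    split_ifs
    · exact measurable_haarWeight j
    · exact measurable_const
  calc ∑' j, (if level j = n then A j k else 0) * haarAvg j g
      ≤ ∑' j, 16 * D * 2 ^ (-(|(n : ℝ) - level k| / 2)) * ∫⁻ y,
          (if level j = n then haarWeight j y else 0) * (decayKernel δ l y x * g y)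
            ∂unitMeasure := by
        refine ENNReal.tsum_le_tsum fun j => ?_
        split_ifs with h
        · exact hker j h
        · simp
    _ = 16 * D * 2 ^ (-(|(n : ℝ) - level k| / 2)) * ∫⁻ y,
          (∑' j, if level j = n then haarWeight j y else 0) * (decayKernel δ l y x * g y)
            ∂unitMeasure := by
        rw [ENNReal.tsum_mul_left, ← lintegral_tsum fun j => ((hite j).fun_mul hm).aemeasurable]
        simp_rw [ENNReal.tsum_mul_right]
    _ ≤ 16 * D * 2 ^ (-(|(n : ℝ) - level k| / 2)) * ∫⁻ y,
          2 * 2 ^ n * (decayKernel δ l y x * g y) ∂unitMeasure := by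
        refine mul_le_mul' le_rfl (lintegral_mono fun y => ?_)
        exact mul_le_mul' (tsum_level_haarWeight_le n y) le_rfl
    _ = 32 * D * 2 ^ (((n : ℝ) - level k) / 2) *
          (2 ^ l * ∫⁻ y, decayKernel δ l y x * g y ∂unitMeasure) := by
        rw [lintegral_const_mul _ hm]
        have e : (2 : ℝ≥0∞) ^ (-(|(n : ℝ) - level k| / 2)) * 2 ^ n =
            2 ^ (((n : ℝ) - level k) / 2) * 2 ^ l := by
          rw [← ENNReal.rpow_natCast, ← ENNReal.rpow_natCast, ← two_rpow_add, ← two_rpow_add]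
          congr 1
          rcases le_total n (level k) with h | h
          · have h' : (n : ℝ) ≤ level k := by exact_mod_cast h
            rw [hl, min_eq_left h, abs_of_nonpos (by linarith)]
            ring
          · have h' : (level k : ℝ) ≤ n := by exact_mod_cast h
            rw [hl, min_eq_right h, abs_of_nonneg (by linarith)]
            ring
        calc _ = 16 * 2 * D * ((2 : ℝ≥0∞) ^ (-(|(n : ℝ) - level k| / 2)) * 2 ^ n) *
              ∫⁻ y, decayKernel δ l y x * g y ∂unitMeasure := by ring
          _ = _ := by rw [e]; norm_num; ring
    _ ≤ 32 * D * 2 ^ (((n : ℝ) - level k) / 2) * (C * maxFun g x) :=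
        mul_le_mul' le_rfl (hC l g hg x hx)
    _ = _ := by push_cast; ring

theorem exists_haarWeight_ne_zero (k : ℕ+) :
    ∃ x ∈ Set.Icc (0 : ℝ) 1, haarWeight k x ≠ 0 := by
  by_contra h
  push Not at h
  have h1 := lintegral_haarWeight k
  rw [setLIntegral_congr_fun (g := fun _ => 0) measurableSet_Icc fun x hx => h x hx] at h1
  simp at h1

/-- The sum over the indices of one level of a column of an almost diagonal matrix. The gain `ε` is
present for the levels finer than that of the column only. -/
theorem exists_level_sum_le {δ : ℝ} (hδ0 : 0 < δ) (hδ1 : δ < 1) :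
    ∃ C : ℝ≥0, ∀ (ε : ℝ) (D : ℝ≥0) (A : ℕ+ → ℕ+ → ℝ≥0∞), AlmostDiag δ ε D A →
      ∀ (k : ℕ+) (n : ℕ), ∑' j, (if level j = n then A j k else 0) ≤
        C * D * 2 ^ (((n : ℝ) - level k) / 2 - ε * max ((n : ℝ) - level k) 0) := by
  obtain ⟨C, hC⟩ := exists_level_sum_haarAvg_le hδ0 hδ1
  refine ⟨2 * C + 1, fun ε D A hA k n => ?_⟩
  rcases le_total (level k) n with h | h
  · have h' : (level k : ℝ) ≤ n := by exact_mod_cast h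
    refine (hA.col_le k n h).trans ?_
    rw [max_eq_left (by linarith),
      show ((n : ℝ) - level k) / 2 - ε * ((n : ℝ) - level k) =
        (1 / 2 - ε) * ((n : ℝ) - level k) by ring]
    refine mul_le_mul' ?_ le_rfl
    push_cast
    refine le_mul_of_one_le_left' ?_
    exact le_add_self
  · have h' : (n : ℝ) ≤ level k := by exact_mod_cast h
    obtain ⟨x, hx, hkx⟩ := exists_haarWeight_ne_zero k
    have h1 := hC ε D A hA (fun _ => 1) measurable_const k n x hx hkx
    simp only [haarAvg_const, mul_one] at h1
    refine h1.trans ?_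
    rw [max_eq_right (by linarith), mul_zero, sub_zero]
    calc C * D * 2 ^ (((n : ℝ) - level k) / 2) * maxFun (fun _ => 1) x
        ≤ C * D * 2 ^ (((n : ℝ) - level k) / 2) * (2 * 1) :=
          mul_le_mul' le_rfl (maxFun_const_le 1 x)
      _ = (2 * C) * D * 2 ^ (((n : ℝ) - level k) / 2) := by ring
      _ ≤ _ := by
          push_cast
          gcongr
          exact le_self_add

/-- The level sums against averages of a weight, with a fraction of the gain `ε` retained. -/
theorem exists_level_sum_haarAvg_le_maxFunPow {δ : ℝ} (hδ0 : 0 < δ) (hδ1 : δ < 1) {q : ℝ}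
    (hq : 1 < q) : ∃ C : ℝ≥0, ∀ (ε : ℝ) (D : ℝ≥0) (A : ℕ+ → ℕ+ → ℝ≥0∞), AlmostDiag δ ε D A →
      ∀ g : ℝ → ℝ≥0∞, Measurable g → ∀ (k : ℕ+) (n : ℕ), ∀ x ∈ Set.Icc (0 : ℝ) 1,
      haarWeight k x ≠ 0 → ∑' j, (if level j = n then A j k else 0) * haarAvg j g ≤
        C * D * 2 ^ (((n : ℝ) - level k) / 2 - ε * (1 - 1 / q) * max ((n : ℝ) - level k) 0) *
          maxFunPow q g x := by
  obtain ⟨C1, hC1⟩ := exists_level_sum_haarAvg_le hδ0 hδ1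
  obtain ⟨C2, hC2⟩ := exists_level_sum_le hδ0 hδ1
  have hq0 : 0 < q := by linarith
  have hq1 : 0 ≤ 1 - 1 / q := by
    rw [sub_nonneg, div_le_one hq0]; exact hq.le
  refine ⟨C2 ^ (1 - 1 / q) * C1 ^ (1 / q), fun ε D A hA g hg k n x hx hkx => ?_⟩
  -- Hölder with the matrix entries as weights: the factor with exponent `1 - 1 / q` is a plain
  -- level sum and keeps the gain, the other one is controlled by the maximal function of `g ^ q`
  refine (tsum_mul_le_weighted hq _ _).trans ?_
  have h1 : ∑' j, (if level j = n then A j k else 0) * haarAvg j g ^ q ≤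
      C1 * D * 2 ^ (((n : ℝ) - level k) / 2) * maxFun (fun x => g x ^ q) x := by
    refine le_trans (ENNReal.tsum_le_tsum fun j => ?_)
      (hC1 ε D A hA (fun x => g x ^ q) (hg.pow_const q) k n x hx hkx)
    exact mul_le_mul' le_rfl (haarAvg_rpow_le hq j hg)
  refine (mul_le_mul' (ENNReal.rpow_le_rpow (hC2 ε D A hA k n) hq1)
    (ENNReal.rpow_le_rpow h1 (by positivity))).trans (le_of_eq ?_)
  have hq2 : (0 : ℝ) ≤ 1 / q := by positivity
  rw [ENNReal.mul_rpow_of_nonneg _ _ hq1, ENNReal.mul_rpow_of_nonneg _ _ hq1,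
    ENNReal.mul_rpow_of_nonneg _ _ hq2, ENNReal.mul_rpow_of_nonneg _ _ hq2,
    ENNReal.mul_rpow_of_nonneg _ _ hq2, ← ENNReal.rpow_mul, ← ENNReal.rpow_mul]
  have eD : (D : ℝ≥0∞) = (D : ℝ≥0∞) ^ (1 - 1 / q) * (D : ℝ≥0∞) ^ (1 / q) := by
    rw [← ENNReal.rpow_add_of_nonneg _ _ hq1 hq2, sub_add_cancel, ENNReal.rpow_one]
  have e2 : (2 : ℝ≥0∞) ^ (((n : ℝ) - level k) / 2 -
      ε * (1 - 1 / q) * max ((n : ℝ) - level k) 0) =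
      2 ^ ((((n : ℝ) - level k) / 2 - ε * max ((n : ℝ) - level k) 0) * (1 - 1 / q)) *
        2 ^ (((n : ℝ) - level k) / 2 * (1 / q)) := by
    rw [← two_rpow_add]; congr 1; ring
  rw [e2, ENNReal.coe_mul, ENNReal.coe_rpow_of_nonneg _ hq1, ENNReal.coe_rpow_of_nonneg _ hq2]
  conv_rhs => rw [eD]
  unfold maxFunPow
  ring

/-- A sum over all indices with level weights, from its level sums. -/
theorem tsum_le_of_level_sum_le {η : ℝ} (hη : 0 ≤ η) {B : ℝ≥0∞} (n : ℕ) (F : ℕ+ → ℝ≥0∞)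
    (h : ∀ m : ℕ, ∑' k, (if level k = m then F k else 0) ≤ B * 2 ^ (-(η * |(m : ℝ) - n|))) :
    ∑' k, F k ≤ B * (2 * ∑' l : ℕ, (2 : ℝ≥0∞) ^ (-(η * l))) := by
  rw [tsum_eq_tsum_level]
  refine (ENNReal.tsum_le_tsum h).trans ?_
  rw [ENNReal.tsum_mul_left]
  exact mul_le_mul' le_rfl (tsum_two_rpow_abs_le hη n)

/-- Schur's test for almost diagonal matrices, in a weighted form: the Schur weights
`2 ^ ((1 / 2 - η) (n - m))` balance the two triangles, and Hölder's inequality with an exponent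
`q > 1` is what turns the gain in the level sums into a gain for averages of the weight. -/
theorem exists_weighted_schur {δ ε q : ℝ} (hδ0 : 0 < δ) (hδ1 : δ < 1) (hε : 0 < ε) (hq : 1 < q) :
    ∃ C : ℝ≥0, ∀ (D : ℝ≥0) (A : ℕ+ → ℕ+ → ℝ≥0∞), AlmostDiag δ ε D A → ∀ b : ℕ+ → ℝ≥0∞,
      ∀ g : ℝ → ℝ≥0∞, Measurable g → ∫⁻ x, seqSquare (matMul A b) x * g x ∂unitMeasure ≤
        C * D ^ 2 * ∫⁻ x, seqSquare b x * maxFunPow q g x ∂unitMeasure := by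
  obtain ⟨C1, hC1⟩ := exists_level_sum_le hδ0 hδ1
  obtain ⟨C2, hC2⟩ := exists_level_sum_haarAvg_le_maxFunPow hδ0 hδ1 hq
  have hq0 : 0 < q := by linarith
  have hq1 : 0 < 1 - 1 / q := by
    rw [sub_pos, div_lt_one hq0]; exact hq
  have hq2 : 1 - 1 / q ≤ 1 := by
    have : 0 < 1 / q := by positivity
    linarith
  -- half of the gain `ε (1 - 1 / q)` of the weighted column sums; the Schur weights spend `η` on
  -- the triangle where there is a gain in order to have some decay on the other one
  set η := ε * (1 - 1 / q) / 2 with hη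
  have hη0 : 0 < η := by positivity
  have hηε : 2 * η ≤ ε := by rw [hη]; nlinarith
  have hS := tsum_two_rpow_ne_top hη0
  set S := (∑' l : ℕ, (2 : ℝ≥0∞) ^ (-(η * l))) with hSdef
  refine ⟨C1 * (2 * S.toNNReal) * (C2 * (2 * S.toNNReal)), fun D A hA b g hg => ?_⟩
  set V : ℕ+ → ℕ+ → ℝ≥0∞ := fun j k => 2 ^ ((1 / 2 - η) * ((level j : ℝ) - level k)) with hV
  have hVV : ∀ j k, V j k * V k j = 1 := by
    intro j k
    simp only [hV]
    rw [← two_rpow_add, show (1 / 2 - η) * ((level j : ℝ) - level k) +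
      (1 / 2 - η) * ((level k : ℝ) - level j) = 0 by ring, ENNReal.rpow_zero]
  -- Schur's condition for the rows needs no weight `g`
  have hrow : ∀ j, ∑' k, A j k * V j k ≤ C1 * D * (2 * S) := by
    intro j
    refine tsum_le_of_level_sum_le hη0.le (level j) _ fun m => ?_
    have e : ∀ k, (if level k = m then A j k * V j k else 0) =
        (if level k = m then A j k else 0) * 2 ^ ((1 / 2 - η) * ((level j : ℝ) - m)) := by
      intro k
      split_ifs with h
      · rw [← h]
      · rw [zero_mul]
    simp_rw [e]
    rw [ENNReal.tsum_mul_right]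
    refine (mul_le_mul' (hC1 ε D _ hA.transpose j m) le_rfl).trans ?_
    rw [mul_assoc, ← two_rpow_add]
    refine mul_le_mul' le_rfl (two_rpow_mono ?_)
    rcases le_total 0 ((m : ℝ) - level j) with h | h
    · rw [max_eq_left h, abs_of_nonneg h]; nlinarith
    · rw [max_eq_right h, abs_of_nonpos h]; nlinarith
  -- Schur's condition for the columns, against the averages of `g`, pointwise on the support of
  -- the function `hₖ`
  have hcol : ∀ k, ∀ x ∈ Set.Icc (0 : ℝ) 1, haarWeight k x ≠ 0 →
      ∑' j, A j k * V k j * haarAvg j g ≤ C2 * D * (2 * S) * maxFunPow q g x := by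
    intro k x hx hkx
    have := tsum_le_of_level_sum_le hη0.le (B := C2 * D * maxFunPow q g x) (level k)
      (fun j => A j k * V k j * haarAvg j g) fun n => ?_
    · refine this.trans (le_of_eq ?_)
      ring
    have e : ∀ j, (if level j = n then A j k * V k j * haarAvg j g else 0) =
        2 ^ ((1 / 2 - η) * ((level k : ℝ) - n)) *
          ((if level j = n then A j k else 0) * haarAvg j g) := by
      intro j
      split_ifs with h
      · rw [← h]; ring
      · rw [zero_mul, mul_zero]
    simp_rw [e]
    rw [ENNReal.tsum_mul_left]
    refine (mul_le_mul' le_rfl (hC2 ε D A hA g hg k n x hx hkx)).trans ?_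
    calc (2 : ℝ≥0∞) ^ ((1 / 2 - η) * ((level k : ℝ) - n)) *
          (C2 * D * 2 ^ (((n : ℝ) - level k) / 2 -
            ε * (1 - 1 / q) * max ((n : ℝ) - level k) 0) * maxFunPow q g x)
        = C2 * D * maxFunPow q g x * (2 ^ ((1 / 2 - η) * ((level k : ℝ) - n)) *
            2 ^ (((n : ℝ) - level k) / 2 - ε * (1 - 1 / q) * max ((n : ℝ) - level k) 0)) := by
          ring
      _ ≤ _ := by
          rw [← two_rpow_add]
          refine mul_le_mul' le_rfl (two_rpow_mono ?_)
          rw [show ε * (1 - 1 / q) = 2 * η by rw [hη]; ring]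
          rcases le_total 0 ((n : ℝ) - level k) with h | h
          · rw [max_eq_left h, abs_of_nonneg h]; nlinarith
          · rw [max_eq_right h, abs_of_nonpos h]; nlinarith
  have hCS : ∀ j, matMul A b j ^ 2 ≤ C1 * D * (2 * S) * ∑' k, A j k * V k j * b k ^ 2 := by
    intro j
    have h := tsum_mul_sq_le (fun k => A j k * V j k) (fun k => V k j * b k)
    have e1 : ∀ k, A j k * V j k * (V k j * b k) = A j k * b k := by
      intro k
      calc _ = A j k * (V j k * V k j) * b k := by ring
        _ = _ := by rw [hVV, mul_one]
    have e2 : ∀ k, A j k * V j k * (V k j * b k) ^ 2 = A j k * V k j * b k ^ 2 := by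
      intro k
      calc _ = A j k * (V j k * V k j) * V k j * b k ^ 2 := by ring
        _ = _ := by rw [hVV, mul_one]
    simp only [e1, e2] at h
    exact h.trans (mul_le_mul' (hrow j) le_rfl)
  have hM : Measurable fun x => C2 * D * (2 * S) * maxFunPow q g x :=
    (measurable_maxFunPow q hg).const_mul _
  calc ∫⁻ x, seqSquare (matMul A b) x * g x ∂unitMeasure
      = ∑' j, matMul A b j ^ 2 * haarAvg j g := lintegral_seqSquare_mul _ hg
    _ ≤ ∑' j, (C1 * D * (2 * S) * ∑' k, A j k * V k j * b k ^ 2) * haarAvg j g :=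
        ENNReal.tsum_le_tsum fun j => mul_le_mul' (hCS j) le_rfl
    _ = C1 * D * (2 * S) * ∑' k, b k ^ 2 * ∑' j, A j k * V k j * haarAvg j g := by
        simp_rw [mul_assoc (C1 * D * (2 * S) : ℝ≥0∞)]
        rw [ENNReal.tsum_mul_left]
        congr 1
        simp_rw [← ENNReal.tsum_mul_right, ← ENNReal.tsum_mul_left]
        rw [ENNReal.tsum_comm]
        refine tsum_congr fun k => tsum_congr fun j => ?_
        ring
    _ ≤ C1 * D * (2 * S) * ∫⁻ x, seqSquare b x * (C2 * D * (2 * S) * maxFunPow q g x)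
          ∂unitMeasure :=
        mul_le_mul' le_rfl (tsum_sq_mul_le_lintegral b _ hM hcol)
    _ = C1 * D * (2 * S) * (C2 * D * (2 * S) * ∫⁻ x, seqSquare b x * maxFunPow q g x
          ∂unitMeasure) := by
        rw [← lintegral_const_mul _ ((measurable_seqSquare b).fun_mul (measurable_maxFunPow q hg))]
        congr 1
        refine lintegral_congr fun x => ?_
        ring
    _ = _ := by
        push_cast
        rw [ENNReal.coe_toNNReal hS]
        ring

theorem exists_matMul_bound_of_one_le {δ ε s : ℝ} (hδ0 : 0 < δ) (hδ1 : δ < 1) (hε : 0 < ε)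
    (hs : 1 ≤ s) (D : ℝ≥0) : ∃ C : ℝ≥0, ∀ A : ℕ+ → ℕ+ → ℝ≥0∞, AlmostDiag δ ε D A →
      ∀ b : ℕ+ → ℝ≥0∞, ∫⁻ x, seqSquare (matMul A b) x ^ s ∂unitMeasure ≤
        C * ∫⁻ x, seqSquare b x ^ s ∂unitMeasure := by
  obtain ⟨q, hq, C1, hC1⟩ := exists_lintegral_rpow_le_of_weighted hs
  obtain ⟨C2, hC2⟩ := exists_weighted_schur hδ0 hδ1 hε hq
  have hs0 : 0 ≤ s := by linarith
  refine ⟨C1 * (C2 * D ^ 2) ^ s, fun A hA b => ?_⟩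
  refine (hC1 _ _ (measurable_seqSquare _) (measurable_seqSquare b) (C2 * D ^ 2)
    fun g hg => hC2 D A hA b g hg).trans (le_of_eq ?_)
  rw [ENNReal.coe_mul, ENNReal.coe_rpow_of_nonneg _ hs0]
  push_cast
  ring

/-! ### Truncation and duality -/

/-- The sequence `b` cut off to the indices `k ≤ N` and at height `N`. These bounded, finitely
supported sequences increase to `b`. -/
def truncSeq (b : ℕ+ → ℝ≥0∞) (N : ℕ) (k : ℕ+) : ℝ≥0∞ := if (k : ℕ) ≤ N then min (b k) N else 0

theorem truncSeq_le (b : ℕ+ → ℝ≥0∞) (N : ℕ) (k : ℕ+) : truncSeq b N k ≤ b k := by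
  unfold truncSeq
  split_ifs
  · exact min_le_left _ _
  · exact zero_le

theorem truncSeq_mono (b : ℕ+ → ℝ≥0∞) (k : ℕ+) : Monotone fun N => truncSeq b N k := by
  intro N M h
  simp only [truncSeq]
  split_ifs with h1 h2
  · exact min_le_min le_rfl (by exact_mod_cast h)
  · omega
  · exact zero_le
  · exact le_rfl

theorem tendsto_truncSeq (b : ℕ+ → ℝ≥0∞) (k : ℕ+) :
    Tendsto (fun N => truncSeq b N k) atTop (𝓝 (b k)) := by
  have h := (tendsto_const_nhds (x := b k)).min ENNReal.tendsto_nat_nhds_top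
  simp only [min_top_right] at h
  refine h.congr' ?_
  filter_upwards [eventually_ge_atTop (k : ℕ)] with N hN
  simp [truncSeq, hN]

theorem seqSquare_mono {b d : ℕ+ → ℝ≥0∞} (h : ∀ k, b k ≤ d k) (x : ℝ) :
    seqSquare b x ≤ seqSquare d x :=
  ENNReal.tsum_le_tsum fun k => mul_le_mul' (pow_le_pow_left' (h k) 2) le_rfl

theorem exists_seqSquare_truncSeq_le (b : ℕ+ → ℝ≥0∞) (N : ℕ) :
    ∃ B : ℝ≥0∞, B ≠ ⊤ ∧ ∀ x, seqSquare (truncSeq b N) x ≤ B := by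
  have hfin : Set.Finite {k : ℕ+ | (k : ℕ) ≤ N} :=
    Set.Finite.preimage (PNat.coe_injective.injOn) (Set.finite_Iic N)
  refine ⟨∑ k ∈ hfin.toFinset, (N : ℝ≥0∞) ^ 2 * 2 ^ level k, ?_, fun x => ?_⟩
  · refine (ENNReal.sum_lt_top.2 fun k _ => ?_).ne
    exact ENNReal.mul_lt_top (ENNReal.pow_lt_top (ENNReal.natCast_lt_top N))
      (ENNReal.pow_lt_top (by norm_num))
  · unfold seqSquare
    rw [tsum_eq_sum (s := hfin.toFinset)]
    · refine Finset.sum_le_sum fun k _ => mul_le_mul' (pow_le_pow_left' ?_ 2) (haarWeight_le k x)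
      unfold truncSeq
      split_ifs
      · exact min_le_right _ _
      · exact zero_le
    · intro k hk
      have : ¬ (k : ℕ) ≤ N := by simpa using hk
      simp [truncSeq, this]

theorem lintegral_seqSquare_rpow_le_of_truncSeq {s : ℝ} (hs : 0 ≤ s) (b : ℕ+ → ℝ≥0∞) {B : ℝ≥0∞}
    (h : ∀ N, ∫⁻ x, seqSquare (truncSeq b N) x ^ s ∂unitMeasure ≤ B) :
    ∫⁻ x, seqSquare b x ^ s ∂unitMeasure ≤ B := by
  have hlim : ∀ x, Tendsto (fun N => seqSquare (truncSeq b N) x) atTop (𝓝 (seqSquare b x)) := by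
    intro x
    let _ : MeasurableSpace ℕ+ := ⊤
    have h := lintegral_tendsto_of_tendsto_of_monotone (μ := (Measure.count : Measure ℕ+))
      (f := fun N k => truncSeq b N k ^ 2 * haarWeight k x)
      (F := fun k => b k ^ 2 * haarWeight k x)
      (fun N => measurable_from_top.aemeasurable)
      (Eventually.of_forall fun k N M hNM =>
        mul_le_mul' (pow_le_pow_left' (truncSeq_mono b k hNM) 2) le_rfl)
      (Eventually.of_forall fun k => ENNReal.Tendsto.mul_const
        (ENNReal.Tendsto.pow (tendsto_truncSeq b k)) (Or.inr ENNReal.ofReal_ne_top))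
    simp only [lintegral_count] at h
    exact h
  refine le_of_tendsto' (lintegral_tendsto_of_tendsto_of_monotone
    (f := fun N x => seqSquare (truncSeq b N) x ^ s)
    (fun N => ((measurable_seqSquare _).pow_const s).aemeasurable) ?_ ?_) h
  · refine Eventually.of_forall fun x N M hNM => ?_
    exact ENNReal.rpow_le_rpow (seqSquare_mono (fun k => truncSeq_mono b k hNM) x) hs
  · exact Eventually.of_forall fun x => (ENNReal.continuous_rpow_const.tendsto _).comp (hlim x)

theorem tsum_mul_matMul (A : ℕ+ → ℕ+ → ℝ≥0∞) (b d : ℕ+ → ℝ≥0∞) :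
    ∑' j, matMul A b j * d j = ∑' k, b k * matMul (fun j k => A k j) d k := by
  unfold matMul
  simp_rw [← ENNReal.tsum_mul_right, ← ENNReal.tsum_mul_left]
  rw [ENNReal.tsum_comm]
  refine tsum_congr fun k => tsum_congr fun j => ?_
  ring

/-- A dual extremizer of the norm `‖(∑ₖ eₖ² hₖ²)^(1/2)‖_p`: with `u = ∑ₖ eₖ² hₖ²` it is the sequence
`dₖ = eₖ ⟨u ^ ((p - 2) / 2)⟩ₖ`. Its dual norm is controlled by the maximal function. -/
theorem exists_dual_seq {p p' : ℝ} (h : p.HolderConjugate p') (hp : p < 2) :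
    ∃ C : ℝ≥0, ∀ e : ℕ+ → ℝ≥0∞, (∀ x, seqSquare e x ≠ ⊤) → ∃ d : ℕ+ → ℝ≥0∞,
      ∫⁻ x, seqSquare e x ^ (p / 2) ∂unitMeasure ≤ ∑' j, e j * d j ∧
      ∫⁻ x, seqSquare d x ^ (p' / 2) ∂unitMeasure ≤
        C * ∫⁻ x, seqSquare e x ^ (p / 2) ∂unitMeasure := by
  have hp1 := h.lt
  have hp' : 2 ≤ p' := by
    have h1 := h.inv_add_inv_eq_one
    have h2 := h.symm.pos
    have h3 : (1 : ℝ) / 2 ≤ p⁻¹ := by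
      rw [← one_div]
      exact one_div_le_one_div_of_le h.pos hp.le
    have h4 : p'⁻¹ ≤ 2⁻¹ := by rw [← one_div 2]; linarith
    exact (inv_le_inv₀ h2 (by norm_num)).1 h4
  obtain ⟨q, hq, C, hC⟩ := exists_lintegral_rpow_le_of_weighted (s := p' / 2) (by linarith)
  refine ⟨C, fun e he => ?_⟩
  set u := seqSquare e with hu
  have hum : Measurable u := measurable_seqSquare e
  -- the exponent is negative, so `U = ∞` where `u = 0`; there `u U² = 0 * ∞ = 0` below
  set U : ℝ → ℝ≥0∞ := fun x => u x ^ ((p - 2) / 2) with hU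
  have hUm : Measurable U := hum.pow_const _
  refine ⟨fun j => e j * haarAvg j U, ?_, ?_⟩
  · have e1 : ∀ j, e j * (e j * haarAvg j U) = e j ^ 2 * haarAvg j U := fun j => by ring
    simp_rw [e1]
    rw [← lintegral_seqSquare_mul e hUm]
    refine lintegral_mono fun x => ?_
    rcases eq_or_ne (u x) 0 with h0 | h0
    · simp only [h0]
      rw [ENNReal.zero_rpow_of_pos (by linarith)]
      exact zero_le
    · simp only [hU, ← hu]
      rw [show p / 2 = 1 + (p - 2) / 2 by ring, ENNReal.rpow_add _ _ h0 (he x), ENNReal.rpow_one]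
  · set H : ℝ → ℝ≥0∞ := fun x => u x * U x ^ 2 with hH
    have hHm : Measurable H := hum.mul (hUm.pow_const 2)
    have hHs : ∀ x, H x ^ (p' / 2) ≤ u x ^ (p / 2) := by
      intro x
      rcases eq_or_ne (u x) 0 with h0 | h0
      · simp only [hH, h0, zero_mul]
        rw [ENNReal.zero_rpow_of_pos (by linarith)]
        exact zero_le
      · refine le_of_eq ?_
        simp only [hH, hU]
        rw [← ENNReal.rpow_natCast, ← ENNReal.rpow_mul]
        nth_rewrite 1 [← ENNReal.rpow_one (u x)]
        rw [← ENNReal.rpow_add _ _ h0 (he x), ← ENNReal.rpow_mul]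
        congr 1
        have h1 := h.sub_one_mul_conj
        push_cast
        linarith
    -- with `H = u U²` one has `H ^ (p' / 2) = u ^ (p / 2)`, and the dual sequence satisfies a
    -- weighted inequality with `H` on the right hand side, since `⟨U⟩ⱼ² ≤ ⟨U²⟩ⱼ`
    have hw : ∀ g : ℝ → ℝ≥0∞, Measurable g →
        ∫⁻ x, seqSquare (fun j => e j * haarAvg j U) x * g x ∂unitMeasure ≤
          1 * ∫⁻ x, H x * maxFunPow q g x ∂unitMeasure := by
      intro g hg
      rw [lintegral_seqSquare_mul _ hg, one_mul]
      calc ∑' j, (e j * haarAvg j U) ^ 2 * haarAvg j g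
          ≤ ∑' j, e j ^ 2 * haarAvg j fun x => U x ^ 2 * maxFunPow q g x := by
            refine ENNReal.tsum_le_tsum fun j => ?_
            rw [mul_pow, mul_assoc]
            refine mul_le_mul' le_rfl ((mul_le_mul' (haarAvg_sq_le j hUm) le_rfl).trans ?_)
            unfold haarAvg
            rw [← lintegral_mul_const _ ((measurable_haarWeight j).fun_mul (hUm.pow_const 2))]
            refine setLIntegral_mono' measurableSet_Icc fun x hx => ?_
            by_cases hjx : haarWeight j x = 0
            · simp [hjx]
            · rw [mul_assoc]
              exact mul_le_mul' le_rfl (mul_le_mul' le_rfl (haarAvg_le_maxFunPow hq hx hjx hg))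
        _ = ∫⁻ x, u x * (U x ^ 2 * maxFunPow q g x) ∂unitMeasure :=
            (lintegral_seqSquare_mul e
              ((hUm.pow_const 2).fun_mul (measurable_maxFunPow q hg))).symm
        _ = _ := by simp only [hH, mul_assoc]
    refine (hC _ H (measurable_seqSquare _) hHm 1 hw).trans ?_
    rw [ENNReal.one_rpow, mul_one]
    exact mul_le_mul' le_rfl (lintegral_mono hHs)

/-- Almost diagonal matrices are bounded on the sequence space with norm `‖(∑ₖ bₖ² hₖ²)^(1/2)‖_p`,
for all `1 < p < ∞`; exponents `p < 2` are reduced to `p > 2` by duality. -/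
theorem exists_matMul_bound {δ ε p : ℝ} (hδ0 : 0 < δ) (hδ1 : δ < 1) (hε : 0 < ε)
    (hp : 1 < p) (D : ℝ≥0) : ∃ C : ℝ≥0, ∀ A : ℕ+ → ℕ+ → ℝ≥0∞, AlmostDiag δ ε D A →
      ∀ b : ℕ+ → ℝ≥0∞, ∫⁻ x, seqSquare (matMul A b) x ^ (p / 2) ∂unitMeasure ≤
        C * ∫⁻ x, seqSquare b x ^ (p / 2) ∂unitMeasure := by
  rcases le_or_gt 2 p with h2 | h2
  · exact exists_matMul_bound_of_one_le hδ0 hδ1 hε (by linarith) D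
  have h : p.HolderConjugate (p / (p - 1)) := Real.HolderConjugate.conjExponent hp
  set p' := p / (p - 1) with hp'def
  have hp' : 2 ≤ p' := by
    rw [hp'def, le_div_iff₀ (by linarith)]; linarith
  obtain ⟨C1, hC1⟩ := exists_dual_seq h h2
  obtain ⟨C2, hC2⟩ := exists_matMul_bound_of_one_le hδ0 hδ1 hε (s := p' / 2) (by linarith) D
  have hp0 := h.pos
  have hp'0 := h.symm.pos
  refine ⟨(C2 * C1) ^ (p / p'), fun A hA b => ?_⟩
  -- the truncation makes the left hand side finite
  refine lintegral_seqSquare_rpow_le_of_truncSeq (by positivity) _ fun N => ?_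
  set e := truncSeq (matMul A b) N with he
  obtain ⟨B, hB, heB⟩ := exists_seqSquare_truncSeq_le (matMul A b) N
  have hefin : ∀ x, seqSquare e x ≠ ⊤ := fun x => ne_top_of_le_ne_top hB (heB x)
  obtain ⟨d, hd1, hd2⟩ := hC1 e hefin
  set X := ∫⁻ x, seqSquare e x ^ (p / 2) ∂unitMeasure with hX
  set Y := ∫⁻ x, seqSquare b x ^ (p / 2) ∂unitMeasure with hY
  have hXt : X ≠ ⊤ := by
    refine ne_top_of_le_ne_top (ENNReal.rpow_ne_top_of_nonneg (y := p / 2) (by positivity) hB) ?_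
    refine (lintegral_mono fun x => ENNReal.rpow_le_rpow (heB x) (by positivity)).trans ?_
    simp
  have h1 : X ≤ (Y ^ (1 / p) * (C2 * C1) ^ (1 / p')) * X ^ (1 / p') := by
    calc X ≤ ∑' j, e j * d j := hd1
      _ ≤ ∑' j, matMul A b j * d j :=
          ENNReal.tsum_le_tsum fun j => mul_le_mul' (truncSeq_le _ _ _) le_rfl
      _ = ∑' k, b k * matMul (fun j k => A k j) d k := tsum_mul_matMul A b d
      _ ≤ Y ^ (1 / p) * (∫⁻ x, seqSquare (matMul (fun j k => A k j) d) x ^ (p' / 2)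
            ∂unitMeasure) ^ (1 / p') := tsum_mul_le_seqSquare h b _
      _ ≤ Y ^ (1 / p) * (C2 * (C1 * X)) ^ (1 / p') := by
          refine mul_le_mul' le_rfl (ENNReal.rpow_le_rpow ?_ (by positivity))
          exact (hC2 _ hA.transpose d).trans (mul_le_mul' le_rfl hd2)
      _ = _ := by
          rw [← mul_assoc (C2 : ℝ≥0∞), ENNReal.mul_rpow_of_nonneg _ _ (by positivity), mul_assoc]
  refine (le_rpow_of_le_mul_rpow h hXt h1).trans (le_of_eq ?_)
  rw [ENNReal.mul_rpow_of_nonneg _ _ hp0.le, ← ENNReal.rpow_mul, ← ENNReal.rpow_mul,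
    one_div_mul_cancel hp0.ne', ENNReal.rpow_one, one_div_mul_eq_div, mul_comm,
    ENNReal.coe_rpow_of_nonneg _ (by positivity)]
  push_cast
  rfl

/-! ### The square function inequality for the Haar system -/

/-- The absolute values of the Haar coefficients. -/
def haarCoef (f : ℝ → ℝ) (k : ℕ+) : ℝ≥0∞ := ‖pairing f (haar k)‖ₑ

theorem haarCoef_congr {f f' : ℝ → ℝ} (h : f =ᵐ[unitMeasure] f') : haarCoef f = haarCoef f' := by
  funext k
  unfold haarCoef pairing
  congr 1
  refine integral_congr_ae ?_
  filter_upwards [h] with x hx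
  rw [hx]

theorem haarAvg_idx_eq {n i : ℕ} (hi : i < 2 ^ n) (g : ℝ → ℝ≥0∞) :
    haarAvg (idx n i) g = 2 ^ n * ∫⁻ x in dyad n i, g x := by
  unfold haarAvg
  rw [← lintegral_const_mul' _ _ (by simp), ← lintegral_indicator (measurableSet_dyad n i)]
  have : ∀ x, haarWeight (idx n i) x * g x = (dyad n i).indicator (fun x => 2 ^ n * g x) x := by
    intro x
    rw [haarWeight_idx hi]
    by_cases h : x ∈ dyad n i <;> simp [h]
  simp_rw [this]
  rw [lintegral_indicator (measurableSet_dyad n i), lintegral_indicator (measurableSet_dyad n i),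
    Measure.restrict_restrict (measurableSet_dyad n i), Set.inter_eq_left.2 (dyad_subset_Icc hi)]

theorem enorm_dyadAvg_le (f : ℝ → ℝ) {n i : ℕ} (hi : i < 2 ^ n) :
    ‖dyadAvg f n i‖ₑ ≤ haarAvg (idx n i) fun x => ‖f x‖ₑ := by
  rw [haarAvg_idx_eq hi]
  unfold dyadAvg
  rw [enorm_mul, Real.enorm_eq_ofReal (by positivity), ofReal_two_pow]
  exact mul_le_mul' le_rfl (enorm_integral_le_lintegral_enorm _)

theorem sum_haarAvg_le (n : ℕ) {g : ℝ → ℝ≥0∞} (hg : Measurable g) :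
    ∑ i ∈ Finset.range (2 ^ n), haarAvg (idx n i) g / 2 ^ n ≤ ∫⁻ x, g x ∂unitMeasure := by
  have h2 : (2 : ℝ≥0∞) ^ n ≠ 0 := by simp
  have h2' : (2 : ℝ≥0∞) ^ n ≠ ⊤ := by simp
  simp_rw [div_eq_mul_inv]
  rw [← Finset.sum_mul, ← div_eq_mul_inv]
  refine ENNReal.div_le_of_le_mul ?_
  unfold haarAvg
  rw [← lintegral_finsetSum _ fun i _ => (measurable_haarWeight _).fun_mul hg,
    mul_comm, ← lintegral_const_mul _ hg]
  refine lintegral_mono fun x => ?_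
  simp only
  rw [← Finset.sum_mul]
  exact mul_le_mul' (sum_haarWeight_idx_le n x) le_rfl

/-- Bessel's inequality for the Haar system. -/
theorem tsum_haarCoef_sq_le {f : ℝ → ℝ} (hf : Measurable f) (hfi : Integrable f unitMeasure) :
    ∑' k, haarCoef f k ^ 2 ≤ ∫⁻ x, ‖f x‖ₑ ^ 2 ∂unitMeasure := by
  refine tsum_le_of_forall_sum_idx_le fun N => ?_
  have hsq : ∀ a : ℝ, ‖a‖ₑ ^ 2 = ENNReal.ofReal (a * a) := by
    intro a
    rw [← enorm_pow, Real.enorm_eq_ofReal (by positivity), sq]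
  have h := sum_dyadAvg_mul_dyadAvg hfi hfi N
  have h1 : haarCoef f 1 ^ 2 + ∑ n ∈ Finset.range N, ∑ i ∈ Finset.range (2 ^ n),
      haarCoef f (idx n i) ^ 2 =
      ENNReal.ofReal (∑ i ∈ Finset.range (2 ^ N), dyadAvg f N i * dyadAvg f N i / 2 ^ N) := by
    unfold haarCoef
    simp_rw [hsq]
    rw [h, ENNReal.ofReal_add (mul_self_nonneg _) (Finset.sum_nonneg fun n _ =>
      Finset.sum_nonneg fun i _ => mul_self_nonneg _), ENNReal.ofReal_sum_of_nonneg fun n _ =>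
      Finset.sum_nonneg fun i _ => mul_self_nonneg _]
    congr 1
    refine Finset.sum_congr rfl fun n _ => ?_
    rw [ENNReal.ofReal_sum_of_nonneg fun i _ => mul_self_nonneg _]
  rw [h1, ENNReal.ofReal_sum_of_nonneg fun i _ => div_nonneg (mul_self_nonneg _) (by positivity)]
  refine le_trans (Finset.sum_le_sum fun i hi => ?_) (sum_haarAvg_le N (hf.enorm.pow_const 2))
  rw [ENNReal.ofReal_div_of_pos (by positivity), ofReal_two_pow, ← hsq]
  refine ENNReal.div_le_div_right ?_ _
  exact (pow_le_pow_left' (enorm_dyadAvg_le f (Finset.mem_range.1 hi)) 2).trans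
    (haarAvg_sq_le _ hf.enorm)

/-- A weighted `L²` inequality for the Haar square function. The averages of the weight are written
as integrals over their superlevel sets; for a fixed height only the part of `f` on a superlevel set
of the maximal function is seen by the Haar functions involved, and Bessel's inequality applies. -/
theorem lintegral_haarSquare_mul_le {q : ℝ} (hq : 1 < q) {f : ℝ → ℝ} (hf : Measurable f)
    (hfi : Integrable f unitMeasure) {g : ℝ → ℝ≥0∞} (hg : Measurable g) :
    ∫⁻ x, seqSquare (haarCoef f) x * g x ∂unitMeasure ≤
      ∫⁻ x, ‖f x‖ₑ ^ 2 * maxFunPow q g x ∂unitMeasure := by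
  classical
  have hlc : ∀ a : ℝ≥0∞, ∫⁻ t in Set.Ioi (0 : ℝ), (if ENNReal.ofReal t < a then 1 else 0) = a := by
    intro a
    have h := lintegral_indicator_lt_eq_rpow a (r := 1) one_pos
    simpa using h
  have hM := measurable_maxFunPow q hg
  have hlevel : ∀ t : ℝ,
      ∑' k, haarCoef f k ^ 2 * (if ENNReal.ofReal t < haarAvg k g then 1 else 0) ≤
      ∫⁻ x, ‖f x‖ₑ ^ 2 * (if ENNReal.ofReal t < maxFunPow q g x then 1 else 0) ∂unitMeasure := by
    intro t
    -- if the average of `g` over the support of `hₖ` exceeds `t`, then this support lies in `Ω`,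
    -- and `f` and `1_Ω f` have the same coefficient
    set Ω := {x | ENNReal.ofReal t < maxFunPow q g x} with hΩ
    have hΩm : MeasurableSet Ω := measurableSet_lt measurable_const hM
    have h := tsum_haarCoef_sq_le (hf.indicator hΩm) (hfi.indicator hΩm)
    refine le_trans (ENNReal.tsum_le_tsum fun k => ?_) (h.trans (le_of_eq ?_))
    · split_ifs with hk
      · rw [mul_one]
        refine le_of_eq ?_
        unfold haarCoef pairing
        congr 2
        refine setIntegral_congr_fun measurableSet_Icc fun x hx => ?_
        by_cases h0 : haar k x = 0
        · simp [h0]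
        · have hw : haarWeight k x ≠ 0 := by
            unfold haarWeight
            rw [Ne, ENNReal.ofReal_eq_zero, not_le]
            positivity
          have hxΩ : x ∈ Ω := hk.trans_le (haarAvg_le_maxFunPow hq hx hw hg)
          simp [hxΩ]
      · rw [mul_zero]; exact zero_le
    · refine lintegral_congr fun x => ?_
      by_cases hx : x ∈ Ω
      · have hx' : ENNReal.ofReal t < maxFunPow q g x := hx
        simp [hx, hx']
      · have hx' : ¬ ENNReal.ofReal t < maxFunPow q g x := hx
        simp [hx, hx']
  rw [lintegral_seqSquare_mul _ hg]
  calc ∑' k, haarCoef f k ^ 2 * haarAvg k g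
      = ∑' k, ∫⁻ t in Set.Ioi (0 : ℝ),
          haarCoef f k ^ 2 * (if ENNReal.ofReal t < haarAvg k g then 1 else 0) := by
        refine tsum_congr fun k => ?_
        rw [lintegral_const_mul _ (Measurable.ite (measurableSet_lt (by fun_prop)
          measurable_const) measurable_const measurable_const), hlc]
    _ = ∫⁻ t in Set.Ioi (0 : ℝ), ∑' k,
          haarCoef f k ^ 2 * (if ENNReal.ofReal t < haarAvg k g then 1 else 0) :=
        (lintegral_tsum fun k => ((Measurable.ite (measurableSet_lt (by fun_prop)
          measurable_const) measurable_const measurable_const).const_mul _).aemeasurable).symm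
    _ ≤ ∫⁻ t in Set.Ioi (0 : ℝ), ∫⁻ x, ‖f x‖ₑ ^ 2 *
          (if ENNReal.ofReal t < maxFunPow q g x then 1 else 0) ∂unitMeasure :=
        lintegral_mono hlevel
    _ = ∫⁻ x, (∫⁻ t in Set.Ioi (0 : ℝ), ‖f x‖ₑ ^ 2 *
          (if ENNReal.ofReal t < maxFunPow q g x then 1 else 0)) ∂unitMeasure := by
        refine lintegral_lintegral_swap (Measurable.aemeasurable ?_)
        refine Measurable.mul ((hf.comp measurable_snd).enorm.pow_const 2) ?_
        exact Measurable.ite (measurableSet_lt (by fun_prop) (hM.comp measurable_snd))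
          measurable_const measurable_const
    _ = _ := by
        refine lintegral_congr fun x => ?_
        rw [lintegral_const_mul _ (Measurable.ite (measurableSet_lt (by fun_prop)
          measurable_const) measurable_const measurable_const), hlc]

/-! ### The Paley inequality for `p < 2` -/

/-- Uniform convexity of `x ^ p` for `1 < p < 2`. On `[0, 2]` the second derivative of `x ^ p` is at
least `p (p - 1) 2 ^ (p - 2) ≥ p (p - 1) / 2`, so subtracting `p (p - 1) / 4 * x ^ 2` leaves a
convex function. -/
theorem rpow_add_rpow_ge {p : ℝ} (hp1 : 1 < p) (hp2 : p < 2) {t : ℝ} (ht : |t| ≤ 1) :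
    2 + 2 * (p * (p - 1) / 4) * t ^ 2 ≤ (1 + t) ^ p + (1 - t) ^ p := by
  set κ := p * (p - 1) / 4 with hκ
  have hconv : ConvexOn ℝ (Set.Icc 0 2) fun x : ℝ => x ^ p - κ * x ^ 2 := by
    refine convexOn_of_hasDerivWithinAt2_nonneg (convex_Icc 0 2)
      (f' := fun x => p * x ^ (p - 1) - κ * (2 * x))
      (f'' := fun x => p * ((p - 1) * x ^ (p - 1 - 1)) - κ * 2) ?_ ?_ ?_ ?_
    · refine ContinuousOn.sub ?_ (by fun_prop)
      exact fun x _ => (Real.continuousAt_rpow_const x p (Or.inr (by linarith))).continuousWithinAt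
    · intro x hx
      rw [interior_Icc] at hx
      refine HasDerivAt.hasDerivWithinAt ?_
      have h1 := Real.hasDerivAt_rpow_const (x := x) (p := p) (Or.inl hx.1.ne')
      have h2 := ((hasDerivAt_id x).pow 2).const_mul κ
      simpa using h1.fun_sub h2
    · intro x hx
      rw [interior_Icc] at hx
      refine HasDerivAt.hasDerivWithinAt ?_
      have h1 := (Real.hasDerivAt_rpow_const (x := x) (p := p - 1) (Or.inl hx.1.ne')).const_mul p
      have h2 := ((hasDerivAt_id x).const_mul 2).const_mul κ
      simpa using h1.fun_sub h2
    · intro x hx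
      rw [interior_Icc] at hx
      have h1 : (2 : ℝ) ^ (p - 1 - 1) ≤ x ^ (p - 1 - 1) :=
        Real.rpow_le_rpow_of_nonpos hx.1 hx.2.le (by linarith)
      have h2 : (2 : ℝ) ^ (-1 : ℝ) ≤ 2 ^ (p - 1 - 1) :=
        Real.rpow_le_rpow_of_exponent_le (by norm_num) (by linarith)
      rw [Real.rpow_neg_one] at h2
      have h3 : 0 < p * (p - 1) := mul_pos (by linarith) (by linarith)
      rw [hκ]
      nlinarith
  rw [abs_le] at ht
  have h := hconv.2 (show 1 + t ∈ Set.Icc (0 : ℝ) 2 from ⟨by linarith, by linarith⟩)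
    (show 1 - t ∈ Set.Icc (0 : ℝ) 2 from ⟨by linarith, by linarith⟩)
    (show (0 : ℝ) ≤ 1 / 2 by norm_num) (show (0 : ℝ) ≤ 1 / 2 by norm_num) (by norm_num)
  simp only [smul_eq_mul] at h
  rw [show 1 / 2 * (1 + t) + 1 / 2 * (1 - t) = (1 : ℝ) by ring, Real.one_rpow] at h
  nlinarith

theorem rpow_children_ge {p : ℝ} (hp1 : 1 < p) (hp2 : p < 2) {E a : ℝ} (h1 : 0 ≤ E + a)
    (h2 : 0 ≤ E - a) : 2 * E ^ p + 2 * (p * (p - 1) / 4) * (a ^ 2 * E ^ (p - 2)) ≤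
      (E + a) ^ p + (E - a) ^ p := by
  have hE : 0 ≤ E := by linarith
  rcases hE.eq_or_lt with rfl | hE
  · have ha : a = 0 := by linarith
    subst ha
    simp [Real.zero_rpow (by linarith : p ≠ 0)]
  · have ht : |a / E| ≤ 1 := by
      rw [abs_div, abs_of_pos hE, div_le_one hE, abs_le]
      constructor <;> linarith
    have h := rpow_add_rpow_ge hp1 hp2 ht
    have hEp : 0 < E ^ p := Real.rpow_pos_of_pos hE p
    have ht2 := abs_le.1 ht
    have e1 : (E + a) ^ p = E ^ p * (1 + a / E) ^ p := by
      rw [← Real.mul_rpow hE.le (by linarith)]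
      congr 1; field_simp
    have e2 : (E - a) ^ p = E ^ p * (1 - a / E) ^ p := by
      rw [← Real.mul_rpow hE.le (by linarith)]
      congr 1; field_simp
    have e3 : a ^ 2 * E ^ (p - 2) = E ^ p * (a / E) ^ 2 := by
      rw [Real.rpow_sub hE]
      norm_num
      field_simp
    rw [e1, e2, e3]
    have := mul_le_mul_of_nonneg_left h hEp.le
    linarith

theorem dyadAvg_nonneg {f : ℝ → ℝ} (hf : ∀ x, 0 ≤ f x) (n i : ℕ) : 0 ≤ dyadAvg f n i :=
  mul_nonneg (by positivity) (integral_nonneg hf)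

/-- The increments of the `L^p` norms of the dyadic averages control the Haar coefficients. Where an
average vanishes, so does the coefficient, and the value of the negative power is immaterial. -/
theorem sum_sq_mul_rpow_le {p : ℝ} (hp1 : 1 < p) (hp2 : p < 2) {f : ℝ → ℝ}
    (hfi : Integrable f unitMeasure) (hf0 : ∀ x, 0 ≤ f x) (N : ℕ) :
    dyadAvg f 0 0 ^ p + ∑ n ∈ Finset.range N, ∑ i ∈ Finset.range (2 ^ n), p * (p - 1) / 4 *
      (pairing f (haar (idx n i)) ^ 2 * dyadAvg f n i ^ (p - 2)) ≤
      ∑ i ∈ Finset.range (2 ^ N), dyadAvg f N i ^ p / 2 ^ N := by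
  induction N with
  | zero => simp
  | succ N ih =>
    rw [Finset.sum_range_succ, ← add_assoc]
    refine (add_le_add ih le_rfl).trans ?_
    rw [pow_succ' 2 N, sum_range_two_mul, ← Finset.sum_add_distrib]
    refine Finset.sum_le_sum fun i hi => ?_
    have hi := Finset.mem_range.1 hi
    have hl := dyadAvg_left hfi hi
    have hr := dyadAvg_right hfi hi
    have h1 := dyadAvg_nonneg hf0 (N + 1) (2 * i)
    have h2 := dyadAvg_nonneg hf0 (N + 1) (2 * i + 1)
    rw [hl] at h1
    rw [hr] at h2
    have h := rpow_children_ge hp1 hp2 h1 h2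
    rw [mul_pow, two_rpow_half_sq] at h
    have h3 : (0 : ℝ) < 2 ^ N := by positivity
    rw [hl, hr, ← add_div, le_div_iff₀ (by positivity), pow_succ (2 : ℝ) N,
      ← mul_assoc _ ((2 : ℝ) ^ N) 2, add_mul,
      div_mul_cancel₀ _ h3.ne']
    linarith

theorem haarAvg_enorm_idx {f : ℝ → ℝ} (hfi : Integrable f unitMeasure) (hf0 : ∀ x, 0 ≤ f x)
    {n i : ℕ} (hi : i < 2 ^ n) :
    haarAvg (idx n i) (fun x => ‖f x‖ₑ) = ENNReal.ofReal (dyadAvg f n i) := by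
  rw [haarAvg_idx_eq hi]
  unfold dyadAvg
  rw [ENNReal.ofReal_mul (by positivity), ofReal_two_pow,
    ofReal_integral_eq_lintegral_ofReal (IntegrableOn.dyad hfi hi) (Eventually.of_forall hf0)]
  congr 1
  refine lintegral_congr fun x => ?_
  rw [Real.enorm_eq_ofReal (hf0 x)]

theorem haarAvg_enorm_one {f : ℝ → ℝ} (hfi : Integrable f unitMeasure) (hf0 : ∀ x, 0 ≤ f x) :
    haarAvg 1 (fun x => ‖f x‖ₑ) = ENNReal.ofReal (dyadAvg f 0 0) := by
  rw [← haarAvg_enorm_idx hfi hf0 (by norm_num : (0 : ℕ) < 2 ^ 0)]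
  unfold haarAvg
  refine lintegral_congr_ae ?_
  have h : ∀ᵐ x ∂unitMeasure, x ≠ 1 :=
    ae_restrict_of_ae (Measure.ae_ne volume 1)
  filter_upwards [h, ae_restrict_mem measurableSet_Icc] with x hx1 hx
  rw [haarWeight_one, haarWeight_idx (by norm_num), Set.indicator_of_mem]
  · simp
  · refine ⟨by simpa using hx.1, ?_⟩
    simpa using lt_of_le_of_ne hx.2 hx1

theorem pairing_haar_idx_eq_zero {f : ℝ → ℝ} (hfi : Integrable f unitMeasure) (hf0 : ∀ x, 0 ≤ f x)
    {n i : ℕ} (hi : i < 2 ^ n) (h : dyadAvg f n i = 0) : pairing f (haar (idx n i)) = 0 := by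
  have h1 := dyadAvg_nonneg hf0 (n + 1) (2 * i)
  have h2 := dyadAvg_nonneg hf0 (n + 1) (2 * i + 1)
  rw [dyadAvg_left hfi hi, h] at h1
  rw [dyadAvg_right hfi hi, h] at h2
  have h3 : (0 : ℝ) < 2 ^ ((n : ℝ) / 2) := by positivity
  have h4 : (2 : ℝ) ^ ((n : ℝ) / 2) * pairing f (haar (idx n i)) = 0 := by linarith
  rcases mul_eq_zero.1 h4 with h5 | h5
  · exact absurd h5 h3.ne'
  · exact h5

/-- Transfer from `ℝ` to `[0, ∞]` of a product with a possibly negative power of `E`. The two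
conventions for such a power of `0` differ, and `c = 0` makes up for it. -/
theorem enorm_sq_mul_rpow_eq {c E r : ℝ} (hE : 0 ≤ E) (h : E = 0 → c = 0) :
    ‖c‖ₑ ^ 2 * ENNReal.ofReal E ^ r = ENNReal.ofReal (c ^ 2 * E ^ r) := by
  rcases hE.eq_or_lt with rfl | hE
  · simp [h rfl]
  · rw [ENNReal.ofReal_mul (by positivity), ← enorm_pow, Real.enorm_eq_ofReal (by positivity),
      ENNReal.ofReal_rpow_of_pos hE]

/-- The limit of `sum_sq_mul_rpow_le` as the level tends to infinity. -/
theorem tsum_haarCoef_sq_mul_rpow_le {p : ℝ} (hp1 : 1 < p) (hp2 : p < 2) {f : ℝ → ℝ}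
    (hf : Measurable f) (hfi : Integrable f unitMeasure) (hf0 : ∀ x, 0 ≤ f x) :
    ∑' k, haarCoef f k ^ 2 * haarAvg k (fun x => ‖f x‖ₑ) ^ (p - 2) ≤
      ENNReal.ofReal (4 / (p * (p - 1))) * ∫⁻ x, ‖f x‖ₑ ^ p ∂unitMeasure := by
  have hpp : 0 < p * (p - 1) := mul_pos (by linarith) (by linarith)
  refine tsum_le_of_forall_sum_idx_le fun N => ?_
  set K := 4 / (p * (p - 1)) with hK
  have hK0 : 0 < K := by positivity
  have hK1 : 1 ≤ K := by
    rw [hK, one_le_div hpp]; nlinarith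
  have hpos : ∀ n i, 0 ≤ p * (p - 1) / 4 * (pairing f (haar (idx n i)) ^ 2 *
      dyadAvg f n i ^ (p - 2)) := by
    intro n i
    have := Real.rpow_nonneg (dyadAvg_nonneg hf0 n i) (p - 2)
    positivity
  have h1 : haarCoef f 1 ^ 2 * haarAvg 1 (fun x => ‖f x‖ₑ) ^ (p - 2) ≤
      ENNReal.ofReal K * ENNReal.ofReal (dyadAvg f 0 0 ^ p) := by
    rw [haarAvg_enorm_one hfi hf0]
    unfold haarCoef
    rw [← dyadAvg_zero, enorm_sq_mul_rpow_eq (dyadAvg_nonneg hf0 0 0) fun h => h,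
      ← ENNReal.ofReal_mul hK0.le]
    refine ENNReal.ofReal_le_ofReal ?_
    have h0 := dyadAvg_nonneg hf0 0 0
    rcases h0.eq_or_lt with h0 | h0
    · rw [← h0]; simp [Real.zero_rpow (by linarith : p ≠ 0)]
    · have e : dyadAvg f 0 0 ^ 2 * dyadAvg f 0 0 ^ (p - 2) = dyadAvg f 0 0 ^ p := by
        rw [← Real.rpow_natCast, ← Real.rpow_add h0]
        congr 1; push_cast; ring
      rw [e]
      exact le_mul_of_one_le_left (by positivity) hK1
  have h2 : ∀ n, ∀ i ∈ Finset.range (2 ^ n), haarCoef f (idx n i) ^ 2 *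
      haarAvg (idx n i) (fun x => ‖f x‖ₑ) ^ (p - 2) = ENNReal.ofReal K *
      ENNReal.ofReal (p * (p - 1) / 4 * (pairing f (haar (idx n i)) ^ 2 *
        dyadAvg f n i ^ (p - 2))) := by
    intro n i hi
    have hi := Finset.mem_range.1 hi
    rw [haarAvg_enorm_idx hfi hf0 hi]
    unfold haarCoef
    rw [enorm_sq_mul_rpow_eq (dyadAvg_nonneg hf0 n i) (pairing_haar_idx_eq_zero hfi hf0 hi),
      ← ENNReal.ofReal_mul hK0.le, ← mul_assoc,
      show K * (p * (p - 1) / 4) = 1 by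
        rw [hK, div_mul_div_cancel₀ hpp.ne', div_self (by norm_num)], one_mul]
  calc haarCoef f 1 ^ 2 * haarAvg 1 (fun x => ‖f x‖ₑ) ^ (p - 2) +
      ∑ n ∈ Finset.range N, ∑ i ∈ Finset.range (2 ^ n), haarCoef f (idx n i) ^ 2 *
        haarAvg (idx n i) (fun x => ‖f x‖ₑ) ^ (p - 2)
      ≤ ENNReal.ofReal K * ENNReal.ofReal (dyadAvg f 0 0 ^ p) +
        ∑ n ∈ Finset.range N, ∑ i ∈ Finset.range (2 ^ n), ENNReal.ofReal K *
          ENNReal.ofReal (p * (p - 1) / 4 * (pairing f (haar (idx n i)) ^ 2 *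
            dyadAvg f n i ^ (p - 2))) := by
        refine add_le_add h1 (Finset.sum_le_sum fun n _ => Finset.sum_le_sum fun i hi => ?_)
        exact (h2 n i hi).le
    _ = ENNReal.ofReal K * ENNReal.ofReal (dyadAvg f 0 0 ^ p + ∑ n ∈ Finset.range N,
          ∑ i ∈ Finset.range (2 ^ n), p * (p - 1) / 4 * (pairing f (haar (idx n i)) ^ 2 *
            dyadAvg f n i ^ (p - 2))) := by
        rw [ENNReal.ofReal_add (Real.rpow_nonneg (dyadAvg_nonneg hf0 0 0) p)
          (Finset.sum_nonneg fun n _ => Finset.sum_nonneg fun i _ => hpos n i),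
          ENNReal.ofReal_sum_of_nonneg fun n _ => Finset.sum_nonneg fun i _ => hpos n i, mul_add,
          Finset.mul_sum]
        congr 1
        refine Finset.sum_congr rfl fun n _ => ?_
        rw [ENNReal.ofReal_sum_of_nonneg fun i _ => hpos n i, Finset.mul_sum]
    _ ≤ ENNReal.ofReal K * ENNReal.ofReal (∑ i ∈ Finset.range (2 ^ N),
          dyadAvg f N i ^ p / 2 ^ N) :=
        mul_le_mul' le_rfl (ENNReal.ofReal_le_ofReal (sum_sq_mul_rpow_le hp1 hp2 hfi hf0 N))
    _ ≤ _ := by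
        refine mul_le_mul' le_rfl ?_
        rw [ENNReal.ofReal_sum_of_nonneg fun i _ => div_nonneg
          (Real.rpow_nonneg (dyadAvg_nonneg hf0 N i) p) (by positivity)]
        refine le_trans (Finset.sum_le_sum fun i hi => ?_) (sum_haarAvg_le N (hf.enorm.pow_const p))
        rw [ENNReal.ofReal_div_of_pos (by positivity), ofReal_two_pow,
          ← ENNReal.ofReal_rpow_of_nonneg (dyadAvg_nonneg hf0 N i) (by linarith),
          ← haarAvg_enorm_idx hfi hf0 (Finset.mem_range.1 hi)]
        exact ENNReal.div_le_div_right (haarAvg_rpow_le hp1 _ hf.enorm) _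

/-- The square function of a nonnegative `f` is dominated by a product of a power of the maximal
function and a function whose integral is at most a multiple of `∫ f ^ p`. -/
theorem seqSquare_haarCoef_le {p : ℝ} (hp2 : p < 2) {f : ℝ → ℝ} (hfi : Integrable f unitMeasure)
    (hf0 : ∀ x, 0 ≤ f x) {x : ℝ} (hx : x ∈ Set.Icc (0 : ℝ) 1) :
    seqSquare (haarCoef f) x ≤ maxFun (fun y => ‖f y‖ₑ) x ^ (2 - p) *
      ∑' k, haarCoef f k ^ 2 * haarAvg k (fun x => ‖f x‖ₑ) ^ (p - 2) * haarWeight k x := by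
  unfold seqSquare
  rw [← ENNReal.tsum_mul_left]
  refine ENNReal.tsum_le_tsum fun k => ?_
  by_cases hkx : haarWeight k x = 0
  · simp [hkx]
  by_cases hc : haarCoef f k = 0
  · simp [hc]
  set E := haarAvg k (fun x => ‖f x‖ₑ) with hE
  have hE0 : E ≠ 0 := by
    intro h0
    apply hc
    unfold haarCoef
    rw [enorm_eq_zero]
    by_cases hk : k = 1
    · subst hk
      rw [hE, haarAvg_enorm_one hfi hf0, ENNReal.ofReal_eq_zero] at h0
      rw [← dyadAvg_zero]
      exact le_antisymm h0 (dyadAvg_nonneg hf0 0 0)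
    · obtain ⟨i, hi, h⟩ := exists_eq_idx hk
      rw [hE, h, haarAvg_enorm_idx hfi hf0 hi, ENNReal.ofReal_eq_zero] at h0
      rw [h]
      exact pairing_haar_idx_eq_zero hfi hf0 hi (le_antisymm h0 (dyadAvg_nonneg hf0 _ i))
  have hEt : E ≠ ⊤ := by
    by_cases hk : k = 1
    · subst hk
      rw [hE, haarAvg_enorm_one hfi hf0]
      exact ENNReal.ofReal_ne_top
    · obtain ⟨i, hi, h⟩ := exists_eq_idx hk
      rw [hE, h, haarAvg_enorm_idx hfi hf0 hi]
      exact ENNReal.ofReal_ne_top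
  have h1 : 1 ≤ maxFun (fun y => ‖f y‖ₑ) x ^ (2 - p) * E ^ (p - 2) := by
    calc (1 : ℝ≥0∞) = E ^ (2 - p) * E ^ (p - 2) := by
          rw [← ENNReal.rpow_add _ _ hE0 hEt]; simp
      _ ≤ _ := mul_le_mul' (ENNReal.rpow_le_rpow (haarAvg_le_maxFun hx hkx _) (by linarith)) le_rfl
  calc haarCoef f k ^ 2 * haarWeight k x
      ≤ (maxFun (fun y => ‖f y‖ₑ) x ^ (2 - p) * E ^ (p - 2)) *
        (haarCoef f k ^ 2 * haarWeight k x) := le_mul_of_one_le_left' h1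
    _ = _ := by ring

theorem exists_lintegral_haarSquare_le_of_nonneg {p : ℝ} (hp1 : 1 < p) (hp2 : p < 2) :
    ∃ C : ℝ≥0, ∀ f : ℝ → ℝ, Measurable f → Integrable f unitMeasure → (∀ x, 0 ≤ f x) →
      ∫⁻ x, seqSquare (haarCoef f) x ^ (p / 2) ∂unitMeasure ≤
        C * ∫⁻ x, ‖f x‖ₑ ^ p ∂unitMeasure := by
  obtain ⟨C, hC⟩ := exists_lintegral_maxFun_rpow_le hp1
  set K : ℝ≥0 := Real.toNNReal (4 / (p * (p - 1))) with hK
  refine ⟨C ^ (1 - p / 2) * K ^ (p / 2), fun f hf hfi hf0 => ?_⟩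
  set Q : ℝ → ℝ≥0∞ := fun x => ∑' k, haarCoef f k ^ 2 *
    haarAvg k (fun x => ‖f x‖ₑ) ^ (p - 2) * haarWeight k x with hQ
  have hQm : Measurable Q := Measurable.tsum fun k => (measurable_haarWeight k).const_mul _
  have hQi : ∫⁻ x, Q x ∂unitMeasure ≤ K * ∫⁻ x, ‖f x‖ₑ ^ p ∂unitMeasure := by
    refine le_trans (le_of_eq ?_) (tsum_haarCoef_sq_mul_rpow_le hp1 hp2 hf hfi hf0)
    rw [hQ, lintegral_tsum fun k => ((measurable_haarWeight k).const_mul _).aemeasurable]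
    refine tsum_congr fun k => ?_
    rw [lintegral_const_mul _ (measurable_haarWeight k), lintegral_haarWeight, mul_one]
  set M := maxFun fun y => ‖f y‖ₑ with hM
  have hMm : Measurable M := measurable_maxFun hf.enorm
  set I := ∫⁻ x, ‖f x‖ₑ ^ p ∂unitMeasure with hI
  have hp0 : 0 < p / 2 := by linarith
  have hp3 : 0 < 1 - p / 2 := by linarith
  have hH := ENNReal.lintegral_mul_norm_pow_le (μ := unitMeasure) (f := fun x => M x ^ p) (g := Q)
    (hMm.pow_const p).aemeasurable hQm.aemeasurable hp3.le hp0.le (by ring)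
  calc ∫⁻ x, seqSquare (haarCoef f) x ^ (p / 2) ∂unitMeasure
      ≤ ∫⁻ x, (M x ^ p) ^ (1 - p / 2) * Q x ^ (p / 2) ∂unitMeasure := by
        refine setLIntegral_mono' measurableSet_Icc fun x hx => ?_
        refine (ENNReal.rpow_le_rpow (seqSquare_haarCoef_le hp2 hfi hf0 hx) hp0.le).trans
          (le_of_eq ?_)
        rw [ENNReal.mul_rpow_of_nonneg _ _ hp0.le, ← ENNReal.rpow_mul, ← ENNReal.rpow_mul]
        congr 2
        ring
    _ ≤ (∫⁻ x, M x ^ p ∂unitMeasure) ^ (1 - p / 2) * (∫⁻ x, Q x ∂unitMeasure) ^ (p / 2) := hH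
    _ ≤ (C * I) ^ (1 - p / 2) * (K * I) ^ (p / 2) :=
        mul_le_mul' (ENNReal.rpow_le_rpow (hC _ hf.enorm) hp3.le) (ENNReal.rpow_le_rpow hQi hp0.le)
    _ = _ := by
        have e : I ^ (1 - p / 2) * I ^ (p / 2) = I := by
          rw [← ENNReal.rpow_add_of_nonneg _ _ hp3.le hp0.le, sub_add_cancel, ENNReal.rpow_one]
        rw [ENNReal.mul_rpow_of_nonneg _ _ hp0.le, ENNReal.mul_rpow_of_nonneg _ _ hp3.le,
          ENNReal.coe_mul, ENNReal.coe_rpow_of_nonneg _ hp0.le,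
          ENNReal.coe_rpow_of_nonneg _ hp3.le]
        nth_rewrite 3 [← e]
        ring

theorem seqSquare_le_two_mul_add {b c d : ℕ+ → ℝ≥0∞} (h : ∀ k, b k ≤ c k + d k) (x : ℝ) :
    seqSquare b x ≤ 2 * (seqSquare c x + seqSquare d x) := by
  unfold seqSquare
  rw [← ENNReal.tsum_add, ← ENNReal.tsum_mul_left]
  refine ENNReal.tsum_le_tsum fun k => ?_
  rw [← add_mul, ← mul_assoc]
  refine mul_le_mul' ((pow_le_pow_left' (h k) 2).trans ?_) le_rfl
  have h2 := ENNReal.rpow_add_le_mul_rpow_add_rpow (c k) (d k) (p := 2) (by norm_num)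
  norm_num at h2
  exact h2

theorem abs_haar_le (k : ℕ+) (x : ℝ) : |haar k x| ≤ 2 ^ level k := by
  have h := haarWeight_le k x
  unfold haarWeight at h
  rw [← ofReal_two_pow, ENNReal.ofReal_le_ofReal_iff (by positivity)] at h
  have h1 : (1 : ℝ) ≤ 2 ^ level k := one_le_pow₀ (by norm_num)
  refine abs_le_of_sq_le_sq (h.trans ?_) (by positivity)
  nlinarith

theorem integrable_mul_haar {f : ℝ → ℝ} (hf : Integrable f unitMeasure) (k : ℕ+) :
    Integrable (fun x => f x * haar k x) unitMeasure :=
  hf.mul_bdd (c := 2 ^ level k) (measurable_haar k).aestronglyMeasurable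
    (Eventually.of_forall fun x => abs_haar_le k x)

/-- The Paley inequality: the Haar square function is bounded on `L^p(0,1)`, `1 < p < ∞`. -/
theorem exists_lintegral_haarSquare_le {p : ℝ} (hp : 1 < p) :
    ∃ C : ℝ≥0, ∀ f : ℝ → ℝ, Integrable f unitMeasure →
      ∫⁻ x, seqSquare (haarCoef f) x ^ (p / 2) ∂unitMeasure ≤
        C * ∫⁻ x, ‖f x‖ₑ ^ p ∂unitMeasure := by
  suffices h : ∃ C : ℝ≥0, ∀ f : ℝ → ℝ, Measurable f → Integrable f unitMeasure →
      ∫⁻ x, seqSquare (haarCoef f) x ^ (p / 2) ∂unitMeasure ≤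
        C * ∫⁻ x, ‖f x‖ₑ ^ p ∂unitMeasure by
    obtain ⟨C, hC⟩ := h
    refine ⟨C, fun f hf => ?_⟩
    have hae := hf.aestronglyMeasurable.ae_eq_mk
    rw [haarCoef_congr hae]
    refine (hC _ hf.aestronglyMeasurable.stronglyMeasurable_mk.measurable (hf.congr hae)).trans
      (le_of_eq ?_)
    congr 1
    refine lintegral_congr_ae ?_
    filter_upwards [hae] with x hx
    rw [hx]
  rcases le_or_gt 2 p with h2 | h2
  · obtain ⟨q, hq, C, hC⟩ := exists_lintegral_rpow_le_of_weighted (s := p / 2) (by linarith)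
    refine ⟨C, fun f hf hfi => ?_⟩
    refine (hC _ (fun x => ‖f x‖ₑ ^ 2) (measurable_seqSquare _) (hf.enorm.pow_const 2) 1
      fun g hg => ?_).trans (le_of_eq ?_)
    · rw [one_mul]
      exact lintegral_haarSquare_mul_le hq hf hfi hg
    · rw [ENNReal.one_rpow, mul_one]
      congr 1
      refine lintegral_congr fun x => ?_
      rw [← ENNReal.rpow_natCast, ← ENNReal.rpow_mul]
      congr 1
      push_cast; ring
  · obtain ⟨C, hC⟩ := exists_lintegral_haarSquare_le_of_nonneg hp h2
    refine ⟨4 * C, fun f hf hfi => ?_⟩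
    -- the positive and the negative part are treated separately
    have hpm : Measurable fun x => max (f x) 0 := hf.max measurable_const
    have hnm : Measurable fun x => max (-f x) 0 := hf.neg.max measurable_const
    have hpi : Integrable (fun x => max (f x) 0) unitMeasure := hfi.pos_part
    have hni : Integrable (fun x => max (-f x) 0) unitMeasure := hfi.neg_part
    have hp0 : 0 < p / 2 := by linarith
    have h1 := hC _ hpm hpi fun x => le_max_right _ _
    have h2' := hC _ hnm hni fun x => le_max_right _ _
    have hcoef : ∀ k, haarCoef f k ≤ haarCoef (fun x => max (f x) 0) k +
        haarCoef (fun x => max (-f x) 0) k := by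
      intro k
      have e : pairing f (haar k) = pairing (fun x => max (f x) 0) (haar k) -
          pairing (fun x => max (-f x) 0) (haar k) := by
        unfold pairing
        rw [← integral_sub (integrable_mul_haar hpi k) (integrable_mul_haar hni k)]
        refine integral_congr_ae (Eventually.of_forall fun x => ?_)
        simp only
        rw [← sub_mul, ← max_zero_sub_max_neg_zero_eq_self (f x)]
        simp
      unfold haarCoef
      rw [e]
      exact enorm_sub_le
    have hpt : ∀ x, seqSquare (haarCoef f) x ^ (p / 2) ≤
        2 * (seqSquare (haarCoef fun x => max (f x) 0) x ^ (p / 2) +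
          seqSquare (haarCoef fun x => max (-f x) 0) x ^ (p / 2)) := by
      intro x
      refine (ENNReal.rpow_le_rpow (seqSquare_le_two_mul_add hcoef x) hp0.le).trans ?_
      rw [ENNReal.mul_rpow_of_nonneg _ _ hp0.le]
      refine mul_le_mul' ?_ (ENNReal.rpow_add_le_add_rpow _ _ hp0.le (by linarith))
      calc (2 : ℝ≥0∞) ^ (p / 2) ≤ 2 ^ (1 : ℝ) := two_rpow_mono (by linarith)
        _ = 2 := by norm_num
    have hle : ∀ g : ℝ → ℝ, (∀ x, |g x| ≤ |f x|) →
        ∫⁻ x, ‖g x‖ₑ ^ p ∂unitMeasure ≤ ∫⁻ x, ‖f x‖ₑ ^ p ∂unitMeasure := by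
      intro g hg
      refine lintegral_mono fun x => ENNReal.rpow_le_rpow ?_ (by linarith)
      rw [Real.enorm_eq_ofReal_abs, Real.enorm_eq_ofReal_abs]
      exact ENNReal.ofReal_le_ofReal (hg x)
    have h3 := h1.trans (mul_le_mul' le_rfl (hle _ fun x => by
      rw [abs_of_nonneg (le_max_right _ _)]; exact max_le (le_abs_self _) (abs_nonneg _)))
    have h4 := h2'.trans (mul_le_mul' le_rfl (hle _ fun x => by
      rw [abs_of_nonneg (le_max_right _ _)]; exact max_le (neg_le_abs _) (abs_nonneg _)))
    refine (lintegral_mono hpt).trans ?_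
    rw [lintegral_const_mul _ (((measurable_seqSquare _).pow_const _).fun_add
      ((measurable_seqSquare _).pow_const _)),
      lintegral_add_left ((measurable_seqSquare _).pow_const _)]
    refine (mul_le_mul' le_rfl (add_le_add h3 h4)).trans (le_of_eq ?_)
    push_cast
    ring

/-! ### Wavelet type systems against the Haar system -/

section Wavelet

variable {δ α c : ℝ} {φ : ℕ+ → ℝ → ℝ}

theorem const_nonneg (hφ : IsWaveletType δ α c φ) : 0 ≤ c := by
  have h := (abs_nonneg _).trans (hφ.decay 1 (1 / 2) ⟨by norm_num, by norm_num⟩)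
  have h1 : 0 < (2 : ℝ) ^ ((level 1 : ℝ) / 2) := by positivity
  have h2 : 0 < xi δ (2 ^ level 1 * (1 / 2 - center 1)) := by unfold xi; positivity
  by_contra hc
  push Not at hc
  have : c * 2 ^ ((level 1 : ℝ) / 2) * xi δ (2 ^ level 1 * (1 / 2 - center 1)) < 0 :=
    mul_neg_of_neg_of_pos (mul_neg_of_neg_of_pos hc h1) h2
  linarith

theorem continuousOn_wavelet (hα : 0 < α) (hφ : IsWaveletType δ α c φ) (k : ℕ+) :
    ContinuousOn (φ k) (Set.Icc 0 1) := by
  intro t ht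
  have hlim : Tendsto (fun t' => c * (2 : ℝ) ^ ((level k : ℝ) / 2) *
      (2 ^ level k * |t - t'|) ^ α * xi δ (2 ^ level k * (t - center k)))
      (𝓝[Set.Icc 0 1] t) (𝓝 0) := by
    have h1 : ContinuousAt (fun t' : ℝ => c * (2 : ℝ) ^ ((level k : ℝ) / 2) *
        (2 ^ level k * |t - t'|) ^ α * xi δ (2 ^ level k * (t - center k))) t := by
      refine ContinuousAt.mul (ContinuousAt.mul continuousAt_const ?_) continuousAt_const
      refine ContinuousAt.rpow_const ?_ (Or.inr hα.le)
      fun_prop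
    have h2 := h1.tendsto
    simp only [sub_self, abs_zero, mul_zero, Real.zero_rpow hα.ne', zero_mul] at h2
    exact h2.mono_left nhdsWithin_le_nhds
  refine tendsto_iff_norm_sub_tendsto_zero.2 (squeeze_zero' (Eventually.of_forall fun _ =>
    norm_nonneg _) ?_ hlim)
  have hball : Metric.closedBall t (1 / 2 ^ level k) ∈ 𝓝[Set.Icc 0 1] t :=
    mem_nhdsWithin_of_mem_nhds (Metric.closedBall_mem_nhds t (by positivity))
  filter_upwards [self_mem_nhdsWithin, hball] with t' ht' hb
  rw [Real.norm_eq_abs, abs_sub_comm]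
  refine hφ.holder k t ht t' ht' ?_
  rwa [Metric.mem_closedBall, dist_comm, Real.dist_eq] at hb

theorem integrable_wavelet (hα : 0 < α) (hφ : IsWaveletType δ α c φ) (k : ℕ+) :
    Integrable (φ k) unitMeasure :=
  (continuousOn_wavelet hα hφ k).integrableOn_compact isCompact_Icc

theorem enorm_wavelet_le (hφ : IsWaveletType δ α c φ) (k : ℕ+) {x : ℝ}
    (hx : x ∈ Set.Icc (0 : ℝ) 1) : ‖φ k x‖ₑ ≤
      ENNReal.ofReal c * 2 ^ ((level k : ℝ) / 2) * decayKernel δ (level k) x (center k) := by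
  have hc := const_nonneg hφ
  rw [Real.enorm_eq_ofReal_abs, ← ofReal_two_rpow, decayKernel, ← ENNReal.ofReal_mul hc,
    ← ENNReal.ofReal_mul (by positivity)]
  exact ENNReal.ofReal_le_ofReal (hφ.decay k x hx)

theorem enorm_wavelet_sub_le (hφ : IsWaveletType δ α c φ) (k : ℕ+) {t t' : ℝ}
    (ht : t ∈ Set.Icc (0 : ℝ) 1) (ht' : t' ∈ Set.Icc (0 : ℝ) 1) (h : |t - t'| ≤ 1 / 2 ^ level k) :
    ‖φ k t - φ k t'‖ₑ ≤ ENNReal.ofReal c * 2 ^ ((level k : ℝ) / 2) *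
      ENNReal.ofReal ((2 ^ level k * |t - t'|) ^ α) * decayKernel δ (level k) t (center k) := by
  have hc := const_nonneg hφ
  rw [Real.enorm_eq_ofReal_abs, ← ofReal_two_rpow, decayKernel, ← ENNReal.ofReal_mul hc,
    ← ENNReal.ofReal_mul (by positivity), ← ENNReal.ofReal_mul (by positivity)]
  exact ENNReal.ofReal_le_ofReal (hφ.holder k t ht t' ht' h)

theorem enorm_haar (j : ℕ+) (x : ℝ) :
    ‖haar j x‖ₑ = 2 ^ (-((level j : ℝ) / 2)) * haarWeight j x := by
  by_cases h : haarWeight j x = 0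
  · have h0 : haar j x = 0 := by
      unfold haarWeight at h
      rw [ENNReal.ofReal_eq_zero] at h
      exact pow_eq_zero_iff (n := 2) (by norm_num) |>.1 (le_antisymm h (sq_nonneg _))
    rw [h, h0]; simp
  · have h1 := haarWeight_eq_of_ne_zero h
    have h2 : haar j x ^ 2 = 2 ^ level j := by
      unfold haarWeight at h1
      rw [← ofReal_two_pow] at h1
      exact (ENNReal.ofReal_eq_ofReal_iff (by positivity) (by positivity)).1 h1
    have h3 : |haar j x| = 2 ^ ((level j : ℝ) / 2) := by
      have h4 : |haar j x| ^ 2 = ((2 : ℝ) ^ ((level j : ℝ) / 2)) ^ 2 := by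
        rw [sq_abs, h2, two_rpow_half_sq]
      exact (sq_eq_sq₀ (abs_nonneg _) (by positivity)).1 h4
    rw [h1, Real.enorm_eq_ofReal_abs, h3, ofReal_two_rpow, ← ENNReal.rpow_natCast, ← two_rpow_add]
    congr 1; ring

theorem enorm_pairing_haar_le (f : ℝ → ℝ) (j : ℕ+) :
    ‖pairing f (haar j)‖ₑ ≤ 2 ^ (-((level j : ℝ) / 2)) * haarAvg j fun x => ‖f x‖ₑ := by
  unfold pairing haarAvg
  refine (enorm_integral_le_lintegral_enorm _).trans ?_
  rw [← lintegral_const_mul' _ _ (two_rpow_ne_top _)]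
  refine lintegral_mono fun x => ?_
  rw [enorm_mul, enorm_haar]
  exact le_of_eq (by ring)

theorem integral_haar_eq_zero {j : ℕ+} (hj : j ≠ 1) : ∫ x in Set.Icc (0 : ℝ) 1, haar j x = 0 := by
  obtain ⟨i, hi, h⟩ := exists_eq_idx hj
  generalize level j = n at hi h
  have h1 := pairing_haar_idx (f := fun _ => 1) (integrable_const 1) hi
  unfold pairing at h1
  simp only [one_mul, integral_const, smul_eq_mul, mul_one] at h1
  rw [h, h1]
  simp [Measure.real, volume_dyad]

theorem haarAvg_le_of_forall {j : ℕ+} {g : ℝ → ℝ≥0∞} {B : ℝ≥0∞}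
    (h : ∀ x ∈ Set.Icc (0 : ℝ) 1, haarWeight j x ≠ 0 → g x ≤ B) : haarAvg j g ≤ B := by
  rw [← haarAvg_const j B]
  refine setLIntegral_mono' measurableSet_Icc fun x hx => ?_
  by_cases hjx : haarWeight j x = 0
  · simp [hjx]
  · exact mul_le_mul' le_rfl (h x hx hjx)

/-- The coefficients of a wavelet against Haar functions of finer scale: the Hölder condition
against the mean zero condition of the Haar function. -/
theorem enorm_pairing_le_of_level_le (hδ : 0 < δ) (hα : 0 < α) (hφ : IsWaveletType δ α c φ)
    (j k : ℕ+) (hjk : level k ≤ level j) : ‖pairing (φ k) (haar j)‖ₑ ≤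
      ENNReal.ofReal c * 2 ^ (-((1 / 2 + α) * ((level j : ℝ) - level k))) *
        decayKernel δ (level k) (center j) (center k) := by
  have hc := const_nonneg hφ
  by_cases hj : j = 1
  · subst hj
    have hk0 : level k = 0 := by rw [level_one] at hjk; omega
    by_cases hk : k = 1
    · subst hk
      have h1 := enorm_pairing_haar_le (φ 1) 1
      refine h1.trans ?_
      have h2 : haarAvg 1 (fun x => ‖φ 1 x‖ₑ) ≤ ENNReal.ofReal c := by
        refine haarAvg_le_of_forall fun x hx _ => (enorm_wavelet_le hφ 1 hx).trans ?_
        rw [level_one]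
        simp only [Nat.cast_zero, zero_div, ENNReal.rpow_zero, mul_one]
        refine (mul_le_mul' le_rfl ?_).trans (le_of_eq (mul_one _))
        unfold decayKernel
        exact ENNReal.ofReal_le_one.2 (xi_le_one hδ _)
      rw [level_one]
      simpa [decayKernel, xi] using h2
    · have hz : pairing (φ k) (haar 1) = 0 := by
        unfold pairing
        simp only [haar_one, mul_one]
        refine hφ.mean_zero k ?_
        have h1 : (1 : ℕ+) ≤ k := one_le (a := k)
        have h2 : (1 : ℕ+) < k := lt_of_le_of_ne h1 (Ne.symm hk)
        exact h2
      rw [hz]; simp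
  · have e : pairing (φ k) (haar j) = pairing (fun x => φ k x - φ k (center j)) (haar j) := by
      unfold pairing
      simp_rw [sub_mul]
      rw [integral_sub (integrable_mul_haar (integrable_wavelet hα hφ k) j)
        (integrable_mul_haar (integrable_const _) j), integral_const_mul, integral_haar_eq_zero hj,
        mul_zero, sub_zero]
    rw [e]
    refine (enorm_pairing_haar_le _ j).trans ?_
    have h2 : haarAvg j (fun x => ‖φ k x - φ k (center j)‖ₑ) ≤ ENNReal.ofReal c *
        2 ^ ((level k : ℝ) / 2) * 2 ^ (-(α * ((level j : ℝ) - level k))) *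
          decayKernel δ (level k) (center j) (center k) := by
      refine haarAvg_le_of_forall fun x hx hjx => ?_
      have hxt := abs_sub_center_le hx hjx
      rw [abs_sub_comm] at hxt
      have h3 : (1 : ℝ) / 2 ^ level j ≤ 1 / 2 ^ level k :=
        one_div_le_one_div_of_le (by positivity) (pow_le_pow_right₀ (by norm_num) hjk)
      have h4 : (0 : ℝ) < 1 / 2 ^ level j := by positivity
      have h5 : |center j - x| ≤ 1 / 2 ^ level j := by linarith
      rw [← edist_eq_enorm_sub, edist_comm, edist_eq_enorm_sub]
      refine (enorm_wavelet_sub_le hφ k (center_mem j) hx (h5.trans h3)).trans ?_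
      refine mul_le_mul' (mul_le_mul' le_rfl ?_) le_rfl
      rw [← ofReal_two_rpow]
      refine ENNReal.ofReal_le_ofReal ?_
      calc (2 ^ level k * |center j - x|) ^ α ≤ (2 ^ level k * (1 / 2 ^ level j)) ^ α := by
            gcongr
        _ = 2 ^ (-(α * ((level j : ℝ) - level k))) := by
            rw [mul_one_div, ← Real.rpow_natCast, ← Real.rpow_natCast,
              ← Real.rpow_sub (by norm_num), ← Real.rpow_mul (by norm_num)]
            congr 1; ring
    refine (mul_le_mul' le_rfl h2).trans (le_of_eq ?_)
    have e2 : (2 : ℝ≥0∞) ^ (-((1 / 2 + α) * ((level j : ℝ) - level k))) =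
        2 ^ (-((level j : ℝ) / 2)) * (2 ^ ((level k : ℝ) / 2) *
          2 ^ (-(α * ((level j : ℝ) - level k)))) := by
      rw [← two_rpow_add, ← two_rpow_add]; congr 1; ring
    rw [e2]
    ring

end Wavelet

/-- The sum of the decay kernel of level `m` over the centers of a finer level. -/
theorem exists_sum_level_decayKernel_le {δ : ℝ} (hδ0 : 0 < δ) (hδ1 : δ < 1) :
    ∃ C : ℝ≥0, ∀ m n : ℕ, m ≤ n → ∀ t ∈ Set.Icc (0 : ℝ) 1,
      ∑' j, (if level j = n then decayKernel δ m (center j) t else 0) ≤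
        C * 2 ^ ((n : ℝ) - m) := by
  obtain ⟨C, hC⟩ := exists_lintegral_decayKernel_le hδ0 hδ1
  refine ⟨16 * C, fun m n hmn t ht => ?_⟩
  have hk := measurable_decayKernel δ m t
  have hite : ∀ j : ℕ+, Measurable fun y => (if level j = n then haarWeight j y else 0) := by
    intro j
    split_ifs
    · exact measurable_haarWeight j
    · exact measurable_const
  have h1 : ∀ j, level j = n → decayKernel δ m (center j) t ≤
      4 * haarAvg j fun y => decayKernel δ m y t := by
    intro j hj
    rw [← haarAvg_const j (decayKernel δ m (center j) t)]
    unfold haarAvg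
    rw [← lintegral_const_mul _ ((measurable_haarWeight j).fun_mul hk)]
    refine setLIntegral_mono' measurableSet_Icc fun y hy => ?_
    by_cases hjy : haarWeight j y = 0
    · simp [hjy]
    · have h2 : decayKernel δ m (center j) t ≤ 4 * decayKernel δ m y t := by
        refine decayKernel_le_of_abs_sub_le hδ0 hδ1 _ ?_
        rw [abs_sub_comm]
        refine (abs_sub_center_le hy hjy).trans ?_
        have e : (1 : ℝ) / 2 ^ level j ≤ 1 / 2 ^ m :=
          one_div_le_one_div_of_le (by positivity) (pow_le_pow_right₀ (by norm_num) (by omega))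
        have e2 : (0 : ℝ) < 1 / 2 ^ level j := by positivity
        linarith
      exact (mul_le_mul' le_rfl h2).trans (le_of_eq (by ring))
  have hM : 2 ^ m * ∫⁻ y, decayKernel δ m y t ∂unitMeasure ≤ C * 2 := by
    have h2 := hC m (fun _ => 1) measurable_const t ht
    simp only [mul_one] at h2
    refine h2.trans (mul_le_mul' le_rfl ((maxFun_const_le 1 t).trans (by simp)))
  have e3 : (2 : ℝ≥0∞) ^ n = 2 ^ ((n : ℝ) - m) * 2 ^ m := by
    rw [← ENNReal.rpow_natCast, ← ENNReal.rpow_natCast, ← two_rpow_add]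
    congr 1; ring
  calc ∑' j, (if level j = n then decayKernel δ m (center j) t else 0)
      ≤ ∑' j, 4 * ∫⁻ y, (if level j = n then haarWeight j y else 0) * decayKernel δ m y t
          ∂unitMeasure := by
        refine ENNReal.tsum_le_tsum fun j => ?_
        split_ifs with h
        · exact h1 j h
        · exact zero_le
    _ = 4 * ∫⁻ y, (∑' j, if level j = n then haarWeight j y else 0) * decayKernel δ m y t
          ∂unitMeasure := by
        rw [ENNReal.tsum_mul_left, ← lintegral_tsum fun j => ((hite j).fun_mul hk).aemeasurable]
        simp_rw [ENNReal.tsum_mul_right]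
    _ ≤ 4 * ∫⁻ y, 2 * 2 ^ n * decayKernel δ m y t ∂unitMeasure :=
        mul_le_mul' le_rfl (lintegral_mono fun y =>
          mul_le_mul' (tsum_level_haarWeight_le n y) le_rfl)
    _ = 8 * 2 ^ ((n : ℝ) - m) * (2 ^ m * ∫⁻ y, decayKernel δ m y t ∂unitMeasure) := by
        rw [lintegral_const_mul _ hk, e3, show (8 : ℝ≥0∞) = 4 * 2 by norm_num]
        ring
    _ ≤ 8 * 2 ^ ((n : ℝ) - m) * (C * 2) := mul_le_mul' le_rfl hM
    _ = _ := by
        push_cast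
        rw [show (16 : ℝ≥0∞) = 8 * 2 by norm_num]
        ring

/-- A kernel of scale `2 ^ (-m)` evaluated at a distance beyond the coarser scale `2 ^ (-n)` from
its center `t`, compared with the kernel of that coarser scale. -/
theorem decayKernel_le_of_far {δ : ℝ} (hδ0 : 0 < δ) (hδ1 : δ < 1) {m n : ℕ} (hnm : n ≤ m)
    {x s t : ℝ} (hx : |x - s| ≤ 1 / 2 ^ n / 2) (hst : 1 / 2 ^ n ≤ |s - t|) :
    decayKernel δ m x t ≤
      16 * 2 ^ (-((1 + δ) * ((m : ℝ) - n))) * decayKernel δ n s t := by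
  unfold decayKernel
  rw [show (16 : ℝ≥0∞) = ENNReal.ofReal 16 by norm_num, ← ofReal_two_rpow,
    ← ENNReal.ofReal_mul (by norm_num), ← ENNReal.ofReal_mul (by positivity)]
  refine ENNReal.ofReal_le_ofReal ?_
  have hn : (0 : ℝ) < 2 ^ n := by positivity
  have hm : (0 : ℝ) < 2 ^ m := by positivity
  have h1 : |s - t| ≤ 2 * |x - t| := by
    have := abs_sub_le s x t
    rw [abs_sub_comm s x] at this
    linarith
  have e1 : (2 : ℝ) ^ (-((1 + δ) * ((m : ℝ) - n))) = ((2 ^ (m - n)) ^ (1 + δ))⁻¹ := by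
    rw [← Real.rpow_natCast, ← Real.rpow_mul (by norm_num), ← Real.rpow_neg (by norm_num),
      Nat.cast_sub hnm]
    congr 1; ring
  have e2 : (2 : ℝ) ^ m = 2 ^ (m - n) * 2 ^ n := by rw [← pow_add, Nat.sub_add_cancel hnm]
  have h2 : (2 : ℝ) ^ (m - n) * (1 + 2 ^ n * |s - t|) ≤ 4 * (1 + 2 ^ m * |x - t|) := by
    have h3 : 1 ≤ 2 ^ n * |s - t| := by
      rw [div_le_iff₀ hn] at hst; linarith
    have h4 : (2 : ℝ) ^ (m - n) * (1 + 2 ^ n * |s - t|) ≤ 2 * (2 ^ m * |s - t|) := by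
      rw [e2]
      have : (0 : ℝ) < 2 ^ (m - n) := by positivity
      nlinarith
    have h5 : 2 ^ m * |s - t| ≤ 2 ^ m * (2 * |x - t|) := by gcongr
    linarith
  have h3 : (2 ^ (m - n)) ^ (1 + δ) * (1 + 2 ^ n * |s - t|) ^ (1 + δ) ≤
      16 * (1 + 2 ^ m * |x - t|) ^ (1 + δ) := by
    rw [← Real.mul_rpow (by positivity) (by positivity)]
    calc (2 ^ (m - n) * (1 + 2 ^ n * |s - t|)) ^ (1 + δ)
        ≤ (4 * (1 + 2 ^ m * |x - t|)) ^ (1 + δ) :=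
          Real.rpow_le_rpow (by positivity) h2 (by linarith)
      _ = 4 ^ (1 + δ) * (1 + 2 ^ m * |x - t|) ^ (1 + δ) :=
          Real.mul_rpow (by norm_num) (by positivity)
      _ ≤ 16 * (1 + 2 ^ m * |x - t|) ^ (1 + δ) := by
          gcongr
          calc (4 : ℝ) ^ (1 + δ) ≤ 4 ^ (2 : ℝ) :=
                Real.rpow_le_rpow_of_exponent_le (by norm_num) (by linarith)
            _ = 16 := by norm_num
  unfold xi
  rw [abs_mul, abs_mul, abs_of_pos hn, abs_of_pos hm, e1, mul_one_div, ← div_eq_mul_inv, div_div,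
    div_le_div_iff₀ (by positivity) (by positivity), one_mul]
  exact h3

theorem one_le_decayKernel_of_near {δ : ℝ} (hδ0 : 0 < δ) (hδ1 : δ < 1) {n : ℕ} {s t : ℝ}
    (hst : |s - t| ≤ 1 / 2 ^ n) : 1 ≤ 4 * decayKernel δ n s t := by
  have h := decayKernel_le_of_abs_sub_le hδ0 hδ1 (x := t) (x' := s) t (by rwa [abs_sub_comm])
  refine le_trans (le_of_eq ?_) h
  simp [decayKernel, xi]

theorem exists_lintegral_decayKernel_le_const {δ : ℝ} (hδ0 : 0 < δ) (hδ1 : δ < 1) :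
    ∃ C : ℝ≥0, ∀ m : ℕ, ∀ t ∈ Set.Icc (0 : ℝ) 1,
      ∫⁻ y, decayKernel δ m y t ∂unitMeasure ≤ C * 2 ^ (-(m : ℝ)) := by
  obtain ⟨C, hC⟩ := exists_lintegral_decayKernel_le hδ0 hδ1
  refine ⟨C * 2, fun m t ht => ?_⟩
  have h2 := hC m (fun _ => 1) measurable_const t ht
  simp only [mul_one] at h2
  have h3 := h2.trans (mul_le_mul' le_rfl ((maxFun_const_le 1 t).trans_eq (mul_one 2)))
  calc ∫⁻ y, decayKernel δ m y t ∂unitMeasure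
      = 2 ^ (-(m : ℝ)) * (2 ^ m * ∫⁻ y, decayKernel δ m y t ∂unitMeasure) := by
        rw [← mul_assoc, ← ENNReal.rpow_natCast, ← two_rpow_add, neg_add_cancel,
          ENNReal.rpow_zero, one_mul]
    _ ≤ 2 ^ (-(m : ℝ)) * (C * 2) := mul_le_mul' le_rfl h3
    _ = _ := by push_cast; ring

/-- Averages of the decay kernel over intervals of coarser scale. -/
theorem exists_haarAvg_decayKernel_le {δ : ℝ} (hδ0 : 0 < δ) (hδ1 : δ < 1) :
    ∃ C : ℝ≥0, ∀ (j : ℕ+) (m : ℕ), level j ≤ m → ∀ t ∈ Set.Icc (0 : ℝ) 1,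
      haarAvg j (fun y => decayKernel δ m y t) ≤
        C * 2 ^ (-((m : ℝ) - level j)) * decayKernel δ (level j) (center j) t := by
  obtain ⟨C, hC⟩ := exists_lintegral_decayKernel_le_const hδ0 hδ1
  refine ⟨4 * C + 16, fun j m hjm t ht => ?_⟩
  have hjm' : (level j : ℝ) ≤ m := by exact_mod_cast hjm
  push_cast
  rw [add_mul, add_mul]
  rcases le_total |center j - t| (1 / 2 ^ level j) with h | h
  · refine le_trans ?_ le_self_add
    have h1 : haarAvg j (fun y => decayKernel δ m y t) ≤ 2 ^ level j * (C * 2 ^ (-(m : ℝ))) := by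
      refine le_trans ?_ (mul_le_mul' le_rfl (hC m t ht))
      rw [← lintegral_const_mul _ (measurable_decayKernel δ m t)]
      exact lintegral_mono fun y => mul_le_mul' (haarWeight_le j y) le_rfl
    refine h1.trans ?_
    calc (2 : ℝ≥0∞) ^ level j * (C * 2 ^ (-(m : ℝ))) = C * 2 ^ (-((m : ℝ) - level j)) * 1 := by
          rw [← ENNReal.rpow_natCast, mul_left_comm, ← two_rpow_add, mul_one]
          congr 2; ring
      _ ≤ C * 2 ^ (-((m : ℝ) - level j)) * (4 * decayKernel δ (level j) (center j) t) :=
          mul_le_mul' le_rfl (one_le_decayKernel_of_near hδ0 hδ1 h)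
      _ = _ := by ring
  · refine le_trans ?_ le_add_self
    refine haarAvg_le_of_forall fun x hx hjx => ?_
    refine (decayKernel_le_of_far hδ0 hδ1 hjm (abs_sub_center_le hx hjx) h).trans ?_
    refine mul_le_mul' (mul_le_mul' le_rfl (two_rpow_mono ?_)) le_rfl
    nlinarith

/-! ### Primitives of wavelets and row sums -/

/-- The factor gained by integrating the decay kernel at distance `|y - t|` from its center. -/
def tailFactor (δ : ℝ) (m : ℕ) (y t : ℝ) : ℝ≥0∞ :=
  ENNReal.ofReal ((1 + 2 ^ m * |y - t|) ^ (-(δ / 2)))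

/-- Half of the exponent `δ` is split off as a tail factor; the remaining kernel is integrable. -/
theorem decayKernel_le_tailFactor_mul {δ : ℝ} (hδ0 : 0 < δ) (m : ℕ) {x y t : ℝ}
    (h : |y - t| ≤ |x - t|) :
    decayKernel δ m x t ≤ tailFactor δ m y t * decayKernel (δ / 2) m x t := by
  unfold decayKernel tailFactor
  rw [← ENNReal.ofReal_mul (by positivity)]
  refine ENNReal.ofReal_le_ofReal ?_
  have hm : (0 : ℝ) < 2 ^ m := by positivity
  unfold xi
  rw [abs_mul, abs_of_pos hm, one_div, one_div, ← Real.rpow_neg (by positivity),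
    ← Real.rpow_neg (by positivity)]
  calc (1 + 2 ^ m * |x - t|) ^ (-(1 + δ))
      = (1 + 2 ^ m * |x - t|) ^ (-(δ / 2)) * (1 + 2 ^ m * |x - t|) ^ (-(1 + δ / 2)) := by
        rw [← Real.rpow_add (by positivity)]
        congr 1; ring
    _ ≤ _ := by
        refine mul_le_mul_of_nonneg_right ?_ (by positivity)
        refine Real.rpow_le_rpow_of_nonpos (by positivity) (by gcongr) (by linarith)

/-- Up to distances of the coarser scale `2 ^ (-n)` the tail factor is dominated by a decay kernel
with a smaller exponent, which is summable over the centers `t` of level `m`. -/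
theorem tailFactor_le_of_near {δ : ℝ} (hδ0 : 0 < δ) (hδ1 : δ < 1) {m n : ℕ} (hnm : n ≤ m)
    {y t : ℝ} (h : |y - t| ≤ 2 / 2 ^ n) : tailFactor δ m y t ≤
      3 * 2 ^ ((1 - δ / 4) * ((m : ℝ) - n)) * decayKernel (δ / 4) m t y := by
  unfold decayKernel tailFactor
  rw [show (3 : ℝ≥0∞) = ENNReal.ofReal 3 by norm_num, ← ofReal_two_rpow,
    ← ENNReal.ofReal_mul (by norm_num), ← ENNReal.ofReal_mul (by positivity)]
  refine ENNReal.ofReal_le_ofReal ?_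
  have hn : (0 : ℝ) < 2 ^ n := by positivity
  have hm : (0 : ℝ) < 2 ^ m := by positivity
  have e2 : (2 : ℝ) ^ m = 2 ^ (m - n) * 2 ^ n := by rw [← pow_add, Nat.sub_add_cancel hnm]
  have h1 : 1 + 2 ^ m * |y - t| ≤ 3 * 2 ^ (m - n) := by
    have h2 : (1 : ℝ) ≤ 2 ^ (m - n) := one_le_pow₀ (by norm_num)
    rw [le_div_iff₀ hn] at h
    rw [e2]
    nlinarith
  unfold xi
  rw [abs_mul, abs_of_pos hm, abs_sub_comm t y, one_div, ← Real.rpow_neg (by positivity)]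
  calc (1 + 2 ^ m * |y - t|) ^ (-(δ / 2))
      = (1 + 2 ^ m * |y - t|) ^ (1 - δ / 4) * (1 + 2 ^ m * |y - t|) ^ (-(1 + δ / 4)) := by
        rw [← Real.rpow_add (by positivity)]
        congr 1; ring
    _ ≤ _ := by
        refine mul_le_mul_of_nonneg_right ?_ (by positivity)
        calc (1 + 2 ^ m * |y - t|) ^ (1 - δ / 4) ≤ (3 * 2 ^ (m - n)) ^ (1 - δ / 4) :=
              Real.rpow_le_rpow (by positivity) h1 (by linarith)
          _ = 3 ^ (1 - δ / 4) * (2 ^ (m - n)) ^ (1 - δ / 4) :=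
              Real.mul_rpow (by norm_num) (by positivity)
          _ ≤ 3 ^ (1 : ℝ) * (2 ^ (m - n)) ^ (1 - δ / 4) := by
              gcongr
              · norm_num
              · linarith
          _ = 3 * 2 ^ ((1 - δ / 4) * ((m : ℝ) - n)) := by
              rw [Real.rpow_one, ← Real.rpow_natCast, ← Real.rpow_mul (by norm_num),
                Nat.cast_sub hnm]
              congr 2; ring

/-- The integral of a wavelet over a set which is no closer to its center than the point `y`. -/
theorem exists_enorm_setIntegral_wavelet_le {δ : ℝ} (hδ0 : 0 < δ) (hδ1 : δ < 1) :
    ∃ C : ℝ≥0, ∀ (α c : ℝ) (φ : ℕ+ → ℝ → ℝ), IsWaveletType δ α c φ → ∀ (k : ℕ+) (y : ℝ) (S : Set ℝ),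
      MeasurableSet S → S ⊆ Set.Icc 0 1 → (∀ x ∈ S, |y - center k| ≤ |x - center k|) →
      ‖∫ x in S, φ k x‖ₑ ≤
        C * ENNReal.ofReal c * 2 ^ (-((level k : ℝ) / 2)) *
          tailFactor δ (level k) y (center k) := by
  obtain ⟨C, hC⟩ := exists_lintegral_decayKernel_le_const (δ := δ / 2) (by linarith) (by linarith)
  refine ⟨C, fun α c φ hφ k y S hS hS1 hSy => ?_⟩
  refine (enorm_integral_le_lintegral_enorm _).trans ?_
  have hk := measurable_decayKernel (δ / 2) (level k) (center k)
  calc ∫⁻ x in S, ‖φ k x‖ₑ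
      ≤ ∫⁻ x in S, ENNReal.ofReal c * 2 ^ ((level k : ℝ) / 2) *
          tailFactor δ (level k) y (center k) * decayKernel (δ / 2) (level k) x (center k) := by
        refine setLIntegral_mono' hS fun x hx => ?_
        refine (enorm_wavelet_le hφ k (hS1 hx)).trans ?_
        refine (mul_le_mul' le_rfl (decayKernel_le_tailFactor_mul hδ0 _ (hSy x hx))).trans
          (le_of_eq ?_)
        ring
    _ = ENNReal.ofReal c * 2 ^ ((level k : ℝ) / 2) * tailFactor δ (level k) y (center k) *
          ∫⁻ x in S, decayKernel (δ / 2) (level k) x (center k) := lintegral_const_mul _ hk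
    _ ≤ ENNReal.ofReal c * 2 ^ ((level k : ℝ) / 2) * tailFactor δ (level k) y (center k) *
          (C * 2 ^ (-(level k : ℝ))) := by
        refine mul_le_mul' le_rfl ((lintegral_mono_set hS1).trans ?_)
        exact hC (level k) (center k) (center_mem k)
    _ = _ := by
        have e : (2 : ℝ≥0∞) ^ (-((level k : ℝ) / 2)) =
            2 ^ ((level k : ℝ) / 2) * 2 ^ (-(level k : ℝ)) := by
          rw [← two_rpow_add]; congr 1; ring
        rw [e]
        ring

/-- The primitive of a wavelet decays away from the center on both sides, since the wavelet has
mean zero. -/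
theorem exists_enorm_primitive_le {δ : ℝ} (hδ0 : 0 < δ) (hδ1 : δ < 1) :
    ∃ C : ℝ≥0, ∀ (α c : ℝ) (φ : ℕ+ → ℝ → ℝ), 0 < α → IsWaveletType δ α c φ → ∀ k : ℕ+, 2 ≤ k →
      ∀ y ∈ Set.Icc (0 : ℝ) 1, ‖∫ x in Set.Ico 0 y, φ k x‖ₑ ≤
        C * ENNReal.ofReal c * 2 ^ (-((level k : ℝ) / 2)) *
          tailFactor δ (level k) y (center k) := by
  obtain ⟨C, hC⟩ := exists_enorm_setIntegral_wavelet_le hδ0 hδ1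
  refine ⟨C, fun α c φ hα hφ k hk y hy => ?_⟩
  have hint : IntegrableOn (φ k) (Set.Icc 0 1) volume := integrable_wavelet hα hφ k
  rcases le_total y (center k) with h | h
  · refine hC α c φ hφ k y _ measurableSet_Ico
      (fun x hx => ⟨hx.1, hx.2.le.trans hy.2⟩) fun x hx => ?_
    rw [abs_of_nonpos (by linarith), abs_of_nonpos (by linarith [hx.2])]
    linarith [hx.2]
  · have e : ∫ x in Set.Ico 0 y, φ k x = -∫ x in Set.Ico y 1, φ k x := by
      have h1 := hφ.mean_zero k hk
      rw [integral_Icc_eq_integral_Ico, ← Set.Ico_union_Ico_eq_Ico hy.1 hy.2,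
        setIntegral_union (Set.Ico_disjoint_Ico_same) measurableSet_Ico
          (hint.mono_set fun x hx => ⟨hx.1, hx.2.le.trans hy.2⟩)
          (hint.mono_set fun x hx => ⟨hy.1.trans hx.1, hx.2.le⟩)] at h1
      linarith
    rw [e, enorm_neg]
    refine hC α c φ hφ k y _ measurableSet_Ico
      (fun x hx => ⟨hy.1.trans hx.1, hx.2.le⟩) fun x hx => ?_
    rw [abs_of_nonneg (by linarith), abs_of_nonneg (by linarith [hx.1])]
    linarith [hx.1]

/-- The coefficients of a fine wavelet located near a coarse Haar function: only the distances to
the three jumps `a`, `b`, `z` of the Haar function matter. -/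
theorem exists_enorm_pairing_le_of_near {δ : ℝ} (hδ0 : 0 < δ) (hδ1 : δ < 1) :
    ∃ C : ℝ≥0, ∀ (n i : ℕ), i < 2 ^ n → ∃ a ∈ Set.Icc (0 : ℝ) 1, ∃ b ∈ Set.Icc (0 : ℝ) 1,
      ∃ z ∈ Set.Icc (0 : ℝ) 1, ∀ (α c : ℝ) (φ : ℕ+ → ℝ → ℝ), 0 < α → IsWaveletType δ α c φ →
      ∀ k : ℕ+, 2 ≤ k → n ≤ level k → |center (idx n i) - center k| ≤ 1 / 2 ^ n →
      ‖pairing (φ k) (haar (idx n i))‖ₑ ≤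
        C * ENNReal.ofReal c * 2 ^ ((1 / 2 - δ / 4) * ((level k : ℝ) - n)) *
          (decayKernel (δ / 4) (level k) (center k) a +
            decayKernel (δ / 4) (level k) (center k) b +
            decayKernel (δ / 4) (level k) (center k) z) := by
  obtain ⟨C, hC⟩ := exists_enorm_primitive_le hδ0 hδ1
  refine ⟨6 * C, fun n i hi => ?_⟩
  have hn : (0 : ℝ) < 2 ^ n := by positivity
  have hlm := left_lt_mid n i
  have hmr := mid_lt_right n i
  have ha0 : 0 ≤ (i : ℝ) / 2 ^ n := by positivity
  have hb1 : ((i : ℝ) + 1) / 2 ^ n ≤ 1 := by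
    rw [div_le_one hn]
    exact_mod_cast hi
  have hlen : ((i : ℝ) + 1) / 2 ^ n = (i : ℝ) / 2 ^ n + 1 / 2 ^ n := by ring
  set a := (i : ℝ) / 2 ^ n with ha
  set b := ((i : ℝ) + 1) / 2 ^ n with hb
  set z := (2 * (i : ℝ) + 1) / 2 ^ (n + 1) with hz
  have hia : a ∈ Set.Icc (0 : ℝ) 1 := ⟨ha0, by linarith⟩
  have hib : b ∈ Set.Icc (0 : ℝ) 1 := ⟨by linarith, hb1⟩
  have hiz : z ∈ Set.Icc (0 : ℝ) 1 := ⟨by linarith, by linarith⟩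
  refine ⟨a, hia, b, hib, z, hiz, fun α c φ hα hφ k hk hnk hnear => ?_⟩
  have hint : IntegrableOn (φ k) (Set.Icc 0 1) volume := integrable_wavelet hα hφ k
  have hF : ∀ s t : ℝ, 0 ≤ s → s ≤ t → t ≤ 1 → ∫ x in Set.Ico s t, φ k x =
      (∫ x in Set.Ico 0 t, φ k x) - ∫ x in Set.Ico 0 s, φ k x := by
    intro s t h0 hst h1
    rw [← Set.Ico_union_Ico_eq_Ico h0 hst, setIntegral_union Set.Ico_disjoint_Ico_same
      measurableSet_Ico (hint.mono_set fun x hx => ⟨hx.1, hx.2.le.trans (hst.trans h1)⟩)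
      (hint.mono_set fun x hx => ⟨h0.trans hx.1, hx.2.le.trans h1⟩)]
    ring
  rw [center_idx hi, ← hz] at hnear
  -- the coefficient is a combination of the values at `a`, `z`, `b` of the primitive of the wavelet
  have hy : ∀ y ∈ Set.Icc (0 : ℝ) 1, |y - z| ≤ 1 / 2 ^ n → ‖∫ x in Set.Ico 0 y, φ k x‖ₑ ≤
      C * ENNReal.ofReal c * 2 ^ (-((level k : ℝ) / 2)) *
        (3 * 2 ^ ((1 - δ / 4) * ((level k : ℝ) - n)) *
          decayKernel (δ / 4) (level k) (center k) y) := by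
    intro y hy hyz
    refine (hC α c φ hα hφ k hk y hy).trans (mul_le_mul' le_rfl ?_)
    refine tailFactor_le_of_near hδ0 hδ1 hnk ?_
    have h1 := abs_sub_le y z (center k)
    have h2 : (2 : ℝ) / 2 ^ n = 1 / 2 ^ n + 1 / 2 ^ n := by ring
    linarith
  have h1 := hy a hia (by rw [abs_le]; constructor <;> linarith)
  have h2 := hy b hib (by rw [abs_le]; constructor <;> linarith)
  have h3 := hy z hiz (by rw [sub_self, abs_zero]; positivity)
  have e : pairing (φ k) (haar (idx n i)) = 2 ^ ((n : ℝ) / 2) *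
      (((∫ x in Set.Ico 0 z, φ k x) - (∫ x in Set.Ico 0 a, φ k x)) -
        ((∫ x in Set.Ico 0 b, φ k x) - ∫ x in Set.Ico 0 z, φ k x)) := by
    rw [pairing_haar_idx (integrable_wavelet hα hφ k) hi, dyad_left, dyad_right, ← ha, ← hb, ← hz,
      hF a z hia.1 hlm.le hiz.2, hF z b hiz.1 hmr.le hib.2]
    ring
  rw [e, enorm_mul, Real.enorm_eq_ofReal (by positivity), ofReal_two_rpow]
  set P := fun y => decayKernel (δ / 4) (level k) (center k) y with hP
  set B := C * ENNReal.ofReal c * 2 ^ (-((level k : ℝ) / 2)) *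
        (3 * 2 ^ ((1 - δ / 4) * ((level k : ℝ) - n))) with hB
  simp only [← mul_assoc] at h1 h2 h3 hB
  rw [← hB] at h1 h2 h3
  calc _ ≤ 2 ^ ((n : ℝ) / 2) * ((B * P z + B * P a) + (B * P b + B * P z)) := by
        refine mul_le_mul' le_rfl (enorm_sub_le.trans (add_le_add (enorm_sub_le.trans ?_)
          (enorm_sub_le.trans ?_)))
        · exact add_le_add h3 h1
        · exact add_le_add h2 h3
    _ ≤ 2 ^ ((n : ℝ) / 2) * (2 * B * (P a + P b + P z)) := by
        refine mul_le_mul' le_rfl ?_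
        calc _ = B * (P a + P b + P z + P z) := by ring
          _ ≤ B * (P a + P b + P z + (P a + P b + P z)) := by
              gcongr
              exact le_add_self
          _ = _ := by ring
    _ = _ := by
        have e2 : (2 : ℝ≥0∞) ^ ((1 / 2 - δ / 4) * ((level k : ℝ) - n)) =
            2 ^ ((n : ℝ) / 2) * 2 ^ (-((level k : ℝ) / 2)) *
              2 ^ ((1 - δ / 4) * ((level k : ℝ) - n)) := by
          rw [← two_rpow_add, ← two_rpow_add]; congr 1; ring
        rw [e2, hB]
        push_cast
        rw [show (6 : ℝ≥0∞) = 2 * 3 by norm_num]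
        ring

theorem two_le_of_ne_one {k : ℕ+} (hk : k ≠ 1) : 2 ≤ k :=
  lt_of_le_of_ne (one_le (a := k)) (Ne.symm hk)

/-- The row sums over finer levels. Wavelets at a distance at most `2 ^ (-n)` from the center of the
Haar function are concentrated at its three jumps, with a bounded number of them at each; the others
are controlled by their pointwise decay. -/
theorem exists_row_le_of_level_lt {δ : ℝ} (hδ0 : 0 < δ) (hδ1 : δ < 1) :
    ∃ C : ℝ≥0, ∀ (α c : ℝ) (φ : ℕ+ → ℝ → ℝ), 0 < α → IsWaveletType δ α c φ →
      ∀ (j : ℕ+) (m : ℕ), level j < m →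
      ∑' k, (if level k = m then ‖pairing (φ k) (haar j)‖ₑ else 0) ≤
        C * ENNReal.ofReal c * 2 ^ ((1 / 2 - δ / 4) * ((m : ℝ) - level j)) := by
  obtain ⟨C1, hC1⟩ := exists_sum_level_decayKernel_le hδ0 hδ1
  obtain ⟨C2, hC2⟩ := exists_sum_level_decayKernel_le (δ := δ / 4) (by linarith) (by linarith)
  obtain ⟨C3, hC3⟩ := exists_enorm_pairing_le_of_near hδ0 hδ1
  refine ⟨16 * C1 + C3 * (C2 + C2 + C2), fun α c φ hα hφ j m hjm => ?_⟩
  have hk1 : ∀ k : ℕ+, level k = m → k ≠ 1 := by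
    rintro k hk rfl
    rw [level_one] at hk
    omega
  by_cases hj : j = 1
  · have hz : ∀ k, (if level k = m then ‖pairing (φ k) (haar j)‖ₑ else 0) = 0 := by
      intro k
      split_ifs with h
      · have hz : pairing (φ k) (haar j) = 0 := by
          rw [hj]
          unfold pairing
          simp only [haar_one, mul_one]
          exact hφ.mean_zero k (two_le_of_ne_one (hk1 k h))
        rw [hz, enorm_zero]
      · rfl
    simp_rw [hz]
    simp
  · obtain ⟨i, hi, hji⟩ := exists_eq_idx hj
    set n := level j with hn
    obtain ⟨a, ha, b, hb, z, hz, hnear⟩ := hC3 n i hi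
    have hjm' : (n : ℝ) ≤ m := by exact_mod_cast hjm.le
    set X := ENNReal.ofReal c * 16 * 2 ^ (-((1 / 2 + δ) * ((m : ℝ) - n))) with hX
    set Y := C3 * ENNReal.ofReal c * 2 ^ ((1 / 2 - δ / 4) * ((m : ℝ) - n)) with hY
    set P := fun (y : ℝ) (k : ℕ+) => if level k = m then decayKernel (δ / 4) m (center k) y else 0
      with hP
    set Q := fun k : ℕ+ => if level k = m then decayKernel δ n (center k) (center j) else 0 with hQ
    have hPsum : ∀ y ∈ Set.Icc (0 : ℝ) 1, ∑' k, P y k ≤ C2 := by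
      intro y hy
      have h := hC2 m m le_rfl y hy
      rwa [sub_self, ENNReal.rpow_zero, mul_one] at h
    have hQsum : ∑' k, Q k ≤ C1 * 2 ^ ((m : ℝ) - n) := hC1 n m hjm.le _ (center_mem j)
    have hterm : ∀ k, (if level k = m then ‖pairing (φ k) (haar j)‖ₑ else 0) ≤
        X * Q k + Y * (P a k + P b k + P z k) := by
      intro k
      by_cases h : level k = m
      · simp only [hP, hQ, h, if_true]
        rcases le_total |center j - center k| (1 / 2 ^ n) with hd | hd
        · refine le_trans ?_ le_add_self
          have h1 := hnear α c φ hα hφ k (two_le_of_ne_one (hk1 k h)) (by omega)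
            (by rwa [← hji])
          rwa [← hji, h] at h1
        · refine le_trans ?_ le_self_add
          refine (enorm_pairing_haar_le _ j).trans ?_
          have h2 : haarAvg j (fun x => ‖φ k x‖ₑ) ≤ ENNReal.ofReal c * 2 ^ ((m : ℝ) / 2) *
              (16 * 2 ^ (-((1 + δ) * ((m : ℝ) - n))) * decayKernel δ n (center j) (center k)) := by
            refine haarAvg_le_of_forall fun x hx hjx => ?_
            refine (enorm_wavelet_le hφ k hx).trans ?_
            rw [h]
            exact mul_le_mul' le_rfl (decayKernel_le_of_far hδ0 hδ1 hjm.le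
              (abs_sub_center_le hx hjx) hd)
          refine (mul_le_mul' le_rfl h2).trans (le_of_eq ?_)
          have e : (2 : ℝ≥0∞) ^ (-((1 / 2 + δ) * ((m : ℝ) - n))) =
              2 ^ (-((n : ℝ) / 2)) * 2 ^ ((m : ℝ) / 2) * 2 ^ (-((1 + δ) * ((m : ℝ) - n))) := by
            rw [← two_rpow_add, ← two_rpow_add]; congr 1; ring
          rw [hX, e, decayKernel_comm δ n (center k)]
          ring
      · rw [if_neg h]
        exact zero_le
    refine (ENNReal.tsum_le_tsum hterm).trans ?_
    rw [ENNReal.tsum_add, ENNReal.tsum_mul_left, ENNReal.tsum_mul_left, ENNReal.tsum_add,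
      ENNReal.tsum_add]
    refine (add_le_add (mul_le_mul' le_rfl hQsum) (mul_le_mul' le_rfl (add_le_add (add_le_add
      (hPsum a ha) (hPsum b hb)) (hPsum z hz)))).trans ?_
    have h1 : X * (C1 * 2 ^ ((m : ℝ) - n)) ≤
        16 * C1 * ENNReal.ofReal c * 2 ^ ((1 / 2 - δ / 4) * ((m : ℝ) - n)) := by
      calc X * (C1 * 2 ^ ((m : ℝ) - n)) = 16 * C1 * ENNReal.ofReal c *
            (2 ^ (-((1 / 2 + δ) * ((m : ℝ) - n))) * 2 ^ ((m : ℝ) - n)) := by rw [hX]; ring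
        _ ≤ _ := by
            rw [← two_rpow_add]
            refine mul_le_mul' le_rfl (two_rpow_mono ?_)
            nlinarith
    refine (add_le_add h1 le_rfl).trans (le_of_eq ?_)
    rw [hY]
    push_cast
    ring

/-- The matrix of a wavelet type system with respect to the Haar system is almost diagonal. -/
theorem exists_almostDiag_pairing {δ α : ℝ} (hδ0 : 0 < δ) (hδ1 : δ < 1) (hα0 : 0 < α) (c : ℝ) :
    ∃ D : ℝ≥0, ∀ φ : ℕ+ → ℝ → ℝ, IsWaveletType δ α c φ →
      AlmostDiag δ (min α (δ / 4)) D fun j k => ‖pairing (φ k) (haar j)‖ₑ := by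
  obtain ⟨C1, hC1⟩ := exists_sum_level_decayKernel_le hδ0 hδ1
  obtain ⟨C2, hC2⟩ := exists_haarAvg_decayKernel_le hδ0 hδ1
  obtain ⟨C3, hC3⟩ := exists_row_le_of_level_lt hδ0 hδ1
  -- a common bound for the constants of the several cases
  set D := (1 + C1 + C2 + C3) * c.toNNReal with hD
  have hDC : ∀ C : ℝ≥0, C ≤ 1 + C1 + C2 + C3 → (C : ℝ≥0∞) * ENNReal.ofReal c ≤ D := by
    intro C hC
    rw [hD, ENNReal.coe_mul]
    exact mul_le_mul' (ENNReal.coe_le_coe.2 hC) le_rfl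
  have hD1 : ENNReal.ofReal c ≤ D := by
    have h := hDC 1 (by rw [add_assoc, add_assoc]; exact le_self_add)
    rwa [ENNReal.coe_one, one_mul] at h
  have hDC1 := hDC C1 (by
    rw [add_assoc, add_assoc, add_left_comm]; exact le_self_add)
  have hDC2 := hDC C2 (by
    rw [add_assoc]; exact le_add_left le_self_add)
  have hDC3 := hDC C3 le_add_self
  refine ⟨D, fun φ hφ => ⟨fun j k => ?_, fun j m hjm => ?_, fun k n hkn => ?_⟩⟩
  · rcases le_total (level k) (level j) with h | h
    · have h' : (level k : ℝ) ≤ level j := by exact_mod_cast h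
      refine (enorm_pairing_le_of_level_le hδ0 hα0 hφ j k h).trans ?_
      rw [min_eq_right h, abs_of_nonneg (by linarith)]
      refine mul_le_mul' (mul_le_mul' hD1 (two_rpow_mono ?_)) le_rfl
      nlinarith
    · have h' : (level j : ℝ) ≤ level k := by exact_mod_cast h
      rw [min_eq_left h, abs_of_nonpos (by linarith)]
      refine (enorm_pairing_haar_le _ j).trans ?_
      have h2 : haarAvg j (fun x => ‖φ k x‖ₑ) ≤ ENNReal.ofReal c * 2 ^ ((level k : ℝ) / 2) *
          (C2 * 2 ^ (-((level k : ℝ) - level j)) *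
            decayKernel δ (level j) (center j) (center k)) := by
        refine le_trans ?_ (mul_le_mul' le_rfl (hC2 j (level k) h _ (center_mem k)))
        unfold haarAvg
        rw [← lintegral_const_mul _ ((measurable_haarWeight j).fun_mul
          (measurable_decayKernel δ _ _))]
        refine setLIntegral_mono' measurableSet_Icc fun x hx => ?_
        refine (mul_le_mul' le_rfl (enorm_wavelet_le hφ k hx)).trans (le_of_eq ?_)
        ring
      refine (mul_le_mul' le_rfl h2).trans ?_
      have e : (2 : ℝ≥0∞) ^ (-(-((level j : ℝ) - level k) / 2)) =
          2 ^ (-((level j : ℝ) / 2)) * (2 ^ ((level k : ℝ) / 2) *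
            2 ^ (-((level k : ℝ) - level j))) := by
        rw [← two_rpow_add, ← two_rpow_add]; congr 1; ring
      rw [e]
      calc _ = C2 * ENNReal.ofReal c * (2 ^ (-((level j : ℝ) / 2)) * (2 ^ ((level k : ℝ) / 2) *
            2 ^ (-((level k : ℝ) - level j)))) * decayKernel δ (level j) (center j) (center k) := by
            ring
        _ ≤ _ := mul_le_mul' (mul_le_mul' hDC2 le_rfl) le_rfl
  · rcases hjm.eq_or_lt with h | h
    · have hterm : ∀ k, (if level k = m then ‖pairing (φ k) (haar j)‖ₑ else 0) ≤
          ENNReal.ofReal c *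
            (if level k = m then decayKernel δ m (center k) (center j) else 0) := by
        intro k
        split_ifs with hk
        · have h1 := enorm_pairing_le_of_level_le hδ0 hα0 hφ j k (by omega)
          rw [h, hk, sub_self, mul_zero, neg_zero, ENNReal.rpow_zero, mul_one,
            decayKernel_comm] at h1
          exact h1
        · exact zero_le
      refine (ENNReal.tsum_le_tsum hterm).trans ?_
      rw [ENNReal.tsum_mul_left, h, sub_self, mul_zero, ENNReal.rpow_zero, mul_one]
      have h2 := hC1 m m le_rfl (center j) (center_mem j)
      rw [sub_self, ENNReal.rpow_zero, mul_one] at h2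
      refine (mul_le_mul' le_rfl h2).trans ?_
      rw [mul_comm]
      exact hDC1
    · refine (hC3 α c φ hα0 hφ j m h).trans (mul_le_mul' hDC3 (two_rpow_mono ?_))
      have h' : (level j : ℝ) ≤ m := by exact_mod_cast hjm
      have := min_le_right α (δ / 4)
      nlinarith
  · have h' : (level k : ℝ) ≤ n := by exact_mod_cast hkn
    have hterm : ∀ j, (if level j = n then ‖pairing (φ k) (haar j)‖ₑ else 0) ≤
        ENNReal.ofReal c * 2 ^ (-((1 / 2 + α) * ((n : ℝ) - level k))) *
          (if level j = n then decayKernel δ (level k) (center j) (center k) else 0) := by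
      intro j
      split_ifs with hj
      · have h1 := enorm_pairing_le_of_level_le hδ0 hα0 hφ j k (by omega)
        rwa [hj] at h1
      · exact zero_le
    refine (ENNReal.tsum_le_tsum hterm).trans ?_
    rw [ENNReal.tsum_mul_left]
    refine (mul_le_mul' le_rfl (hC1 (level k) n hkn (center k) (center_mem k))).trans ?_
    calc _ = C1 * ENNReal.ofReal c * (2 ^ (-((1 / 2 + α) * ((n : ℝ) - level k))) *
          2 ^ ((n : ℝ) - level k)) := by ring
      _ ≤ _ := by
          rw [← two_rpow_add]
          refine mul_le_mul' hDC1 (two_rpow_mono ?_)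
          have := min_le_left α (δ / 4)
          nlinarith

/-! ### Wavelet coefficients in terms of Haar coefficients -/

theorem tendsto_sum_dyadAvg_mul_dyadAvg {f g : ℝ → ℝ} (hf : Integrable f unitMeasure)
    (hg : ContinuousOn g (Set.Icc 0 1)) :
    Tendsto (fun N => ∑ i ∈ Finset.range (2 ^ N), dyadAvg f N i * dyadAvg g N i / 2 ^ N) atTop
      (𝓝 (pairing f g)) := by
  have hgi : Integrable g unitMeasure := hg.integrableOn_compact isCompact_Icc
  have hfg : Integrable (fun x => f x * g x) unitMeasure := by
    obtain ⟨B, hB⟩ := isCompact_Icc.exists_bound_of_continuousOn hg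
    refine hf.mul_bdd (c := B) hgi.aestronglyMeasurable ?_
    filter_upwards [ae_restrict_mem measurableSet_Icc] with x hx using hB x hx
  -- on short dyadic intervals `g` differs little from its averages, by uniform continuity
  rw [Metric.tendsto_atTop]
  intro ε hε
  set M := ∫ x in Set.Icc (0 : ℝ) 1, ‖f x‖ with hM
  have hM0 : 0 ≤ M := integral_nonneg fun x => norm_nonneg _
  obtain ⟨d, hd0, hd⟩ := Metric.uniformContinuousOn_iff.1
    (isCompact_Icc.uniformContinuousOn_of_continuous hg) (ε / (M + 1)) (by positivity)
  obtain ⟨N0, hN0⟩ := exists_pow_lt_of_lt_one hd0 (by norm_num : (1 / 2 : ℝ) < 1)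
  refine ⟨N0, fun N hN => ?_⟩
  have hsplit : ∀ h : ℝ → ℝ, Integrable h unitMeasure → ∫ x in Set.Icc (0 : ℝ) 1, h x =
      ∑ i ∈ Finset.range (2 ^ N), ∫ x in dyad N i, h x := by
    intro h hh
    rw [integral_Icc_eq_integral_Ico, ← iUnion_dyad N]
    refine integral_biUnion_finset _ (fun i _ => measurableSet_dyad N i)
      (fun i _ j _ hij => dyad_disjoint N hij) fun i hi => IntegrableOn.dyad hh
        (Finset.mem_range.1 hi)
  have hlen : (1 / 2 : ℝ) ^ N < d :=
    (pow_le_pow_of_le_one (by norm_num) (by norm_num) hN).trans_lt hN0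
  have hreal : ∀ i, volume.real (dyad N i) = 1 / 2 ^ N := fun i => by
    rw [Measure.real, volume_dyad, ENNReal.toReal_ofReal (by positivity)]
  have hosc : ∀ i < 2 ^ N, ∀ x ∈ dyad N i, |dyadAvg g N i - g x| ≤ ε / (M + 1) := by
    intro i hi x hx
    have e : dyadAvg g N i - g x = 2 ^ N * ∫ y in dyad N i, (g y - g x) := by
      have : IsFiniteMeasure (volume.restrict (dyad N i)) :=
        ⟨by rw [Measure.restrict_apply_univ, volume_dyad]; exact ENNReal.ofReal_lt_top⟩
      rw [integral_sub (IntegrableOn.dyad hgi hi) (integrable_const _), setIntegral_const,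
        hreal, mul_sub, dyadAvg, smul_eq_mul]
      field_simp
    have h1 : ‖∫ y in dyad N i, (g y - g x)‖ ≤ ε / (M + 1) * volume.real (dyad N i) := by
      refine norm_setIntegral_le_of_norm_le_const (by
        rw [volume_dyad]; exact ENNReal.ofReal_lt_top) fun y hy => ?_
      refine (hd y (dyad_subset_Icc hi hy) x (dyad_subset_Icc hi hx) ?_).le
      refine lt_of_le_of_lt ?_ hlen
      rw [Real.dist_eq, abs_le]
      have a1 := hx.1; have a2 := hx.2; have b1 := hy.1; have b2 := hy.2
      rw [add_div] at a2 b2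
      rw [one_div, inv_pow, ← one_div]
      constructor <;> linarith
    rw [e, abs_mul, abs_of_pos (by positivity), ← Real.norm_eq_abs]
    rw [hreal] at h1
    calc (2 : ℝ) ^ N * ‖∫ y in dyad N i, (g y - g x)‖
        ≤ 2 ^ N * (ε / (M + 1) * (1 / 2 ^ N)) := by gcongr
      _ = ε / (M + 1) := by field_simp
  rw [pairing, hsplit _ hfg, Real.dist_eq, ← Finset.sum_sub_distrib]
  have hterm : ∀ i ∈ Finset.range (2 ^ N), |dyadAvg f N i * dyadAvg g N i / 2 ^ N -
      ∫ x in dyad N i, f x * g x| ≤ ε / (M + 1) * ∫ x in dyad N i, ‖f x‖ := by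
    intro i hi
    have hi' := Finset.mem_range.1 hi
    have hfi := IntegrableOn.dyad hf hi'
    have e : dyadAvg f N i * dyadAvg g N i / 2 ^ N - ∫ x in dyad N i, f x * g x =
        ∫ x in dyad N i, f x * (dyadAvg g N i - g x) := by
      simp_rw [mul_sub]
      rw [integral_sub (hfi.mul_const _) (IntegrableOn.dyad hfg hi'), integral_mul_const]
      congr 1
      rw [show dyadAvg f N i = 2 ^ N * ∫ x in dyad N i, f x from rfl]
      field_simp
    rw [e, ← integral_const_mul, ← Real.norm_eq_abs]
    refine norm_integral_le_of_norm_le (hfi.norm.const_mul _) ?_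
    filter_upwards [ae_restrict_mem (measurableSet_dyad N i)] with x hx
    rw [norm_mul, mul_comm]
    exact mul_le_mul_of_nonneg_right (hosc i hi' x hx) (norm_nonneg _)
  calc _ ≤ ∑ i ∈ Finset.range (2 ^ N), ε / (M + 1) * ∫ x in dyad N i, ‖f x‖ :=
        (Finset.abs_sum_le_sum_abs _ _).trans (Finset.sum_le_sum hterm)
    _ = ε / (M + 1) * M := by rw [← Finset.mul_sum, hM, hsplit _ hf.norm]
    _ < ε := by
        rw [div_mul_eq_mul_div, div_lt_iff₀ (by positivity)]
        nlinarith

/-- Half of Parseval's identity for the Haar system: the inner product with a continuous function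
is dominated by the series of the products of the Haar coefficients. -/
theorem enorm_pairing_le_tsum {f g : ℝ → ℝ} (hf : Integrable f unitMeasure)
    (hg : ContinuousOn g (Set.Icc 0 1)) :
    ‖pairing f g‖ₑ ≤ ∑' j, ‖pairing g (haar j)‖ₑ * haarCoef f j := by
  have hgi : Integrable g unitMeasure := hg.integrableOn_compact isCompact_Icc
  refine le_of_tendsto (tendsto_sum_dyadAvg_mul_dyadAvg hf hg).enorm
    (Eventually.of_forall fun N => ?_)
  rw [sum_dyadAvg_mul_dyadAvg hf hgi N, tsum_eq_add_tsum_idx]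
  have e : ∀ j, ‖pairing f (haar j) * pairing g (haar j)‖ₑ =
      ‖pairing g (haar j)‖ₑ * haarCoef f j := fun j => by
    rw [enorm_mul, haarCoef, mul_comm]
  refine (enorm_add_le _ _).trans (add_le_add (e 1).le ?_)
  refine (enorm_sum_le _ _).trans (le_trans (Finset.sum_le_sum fun n _ => ?_)
    (ENNReal.sum_le_tsum (Finset.range N)))
  exact (enorm_sum_le _ _).trans (Finset.sum_le_sum fun i _ => (e _).le)

/-- The square function with Haar weights of the wavelet coefficients is bounded on `L^p`. -/
theorem exists_lintegral_coef_le {δ α p : ℝ} (hδ0 : 0 < δ) (hδ1 : δ < 1) (hα0 : 0 < α) (c : ℝ)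
    (hp : 1 < p) : ∃ C : ℝ≥0, ∀ φ : ℕ+ → ℝ → ℝ, IsWaveletType δ α c φ →
      ∀ f : ℝ → ℝ, Integrable f unitMeasure →
        ∫⁻ x, seqSquare (fun k => ‖pairing f (φ k)‖ₑ) x ^ (p / 2) ∂unitMeasure ≤
          C * ∫⁻ x, ‖f x‖ₑ ^ p ∂unitMeasure := by
  obtain ⟨D, hD⟩ := exists_almostDiag_pairing hδ0 hδ1 hα0 c
  have hε : 0 < min α (δ / 4) := lt_min hα0 (by linarith)
  obtain ⟨C1, hC1⟩ := exists_matMul_bound hδ0 hδ1 hε hp D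
  obtain ⟨C2, hC2⟩ := exists_lintegral_haarSquare_le hp
  refine ⟨C1 * C2, fun φ hφ f hf => ?_⟩
  calc ∫⁻ x, seqSquare (fun k => ‖pairing f (φ k)‖ₑ) x ^ (p / 2) ∂unitMeasure
      ≤ ∫⁻ x, seqSquare (matMul (fun k j => ‖pairing (φ k) (haar j)‖ₑ) (haarCoef f)) x ^ (p / 2)
          ∂unitMeasure := by
        refine lintegral_mono fun x => ENNReal.rpow_le_rpow (seqSquare_mono (fun k => ?_) x)
          (by linarith)
        exact enorm_pairing_le_tsum hf (continuousOn_wavelet hα0 hφ k)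
    _ ≤ C1 * ∫⁻ x, seqSquare (haarCoef f) x ^ (p / 2) ∂unitMeasure :=
        hC1 _ (hD φ hφ).transpose _
    _ ≤ C1 * (C2 * ∫⁻ x, ‖f x‖ₑ ^ p ∂unitMeasure) := mul_le_mul' le_rfl (hC2 f hf)
    _ = _ := by push_cast; ring

/-! ### Wavelet sums in `L^p` -/

theorem memLp_wavelet {δ α c : ℝ} {φ : ℕ+ → ℝ → ℝ} (hα : 0 < α) (hφ : IsWaveletType δ α c φ)
    (p : ℝ≥0∞) (k : ℕ+) : MemLp (φ k) p unitMeasure := by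
  obtain ⟨B, hB⟩ := isCompact_Icc.exists_bound_of_continuousOn (continuousOn_wavelet hα hφ k)
  refine MemLp.of_bound (integrable_wavelet hα hφ k).aestronglyMeasurable B ?_
  filter_upwards [ae_restrict_mem measurableSet_Icc] with x hx using hB x hx

/-- The reverse inequality for finite sums `F`, by duality: `∫ |F|^p` is the inner product of `F`
with `F |F|^(p - 2)`, whose wavelet coefficients are controlled in the dual exponent. -/
theorem exists_lintegral_sum_le {δ α p : ℝ} (hδ0 : 0 < δ) (hδ1 : δ < 1) (hα0 : 0 < α) (c : ℝ)
    (hp : 1 < p) : ∃ C : ℝ≥0, ∀ φ : ℕ+ → ℝ → ℝ, IsWaveletType δ α c φ →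
      ∀ (b : ℕ+ → ℝ) (s : Finset ℕ+), ∫⁻ x, ‖∑ k ∈ s, b k * φ k x‖ₑ ^ p ∂unitMeasure ≤
        C * ∫⁻ x, seqSquare (fun k => if k ∈ s then ‖b k‖ₑ else 0) x ^ (p / 2) ∂unitMeasure := by
  have h : p.HolderConjugate (p / (p - 1)) := Real.HolderConjugate.conjExponent hp
  set p' := p / (p - 1) with hp'
  obtain ⟨C, hC⟩ := exists_lintegral_coef_le hδ0 hδ1 hα0 c h.symm.lt
  refine ⟨C ^ (p / p'), fun φ hφ b s => ?_⟩
  set F : ℝ → ℝ := fun x => ∑ k ∈ s, b k * φ k x with hF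
  set g : ℝ → ℝ := fun x => F x * |F x| ^ (p - 2) with hg
  have hFc : ContinuousOn F (Set.Icc 0 1) := by
    refine continuousOn_finsetSum s fun k _ => ?_
    exact continuousOn_const.mul (continuousOn_wavelet hα0 hφ k)
  have hFm : AEMeasurable F unitMeasure := hFc.aemeasurable measurableSet_Icc
  obtain ⟨B, hB⟩ := isCompact_Icc.exists_bound_of_continuousOn hFc
  have hp0 : 0 < p := by linarith
  have habs : ∀ x, |g x| = |F x| ^ (p - 1) := by
    intro x
    rw [hg]
    simp only
    rw [abs_mul, abs_of_nonneg (Real.rpow_nonneg (abs_nonneg (F x)) _)]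
    rcases eq_or_ne (F x) 0 with h0 | h0
    · rw [h0, abs_zero, zero_mul, Real.zero_rpow (sub_pos.2 hp).ne']
    · nth_rewrite 1 [← Real.rpow_one |F x|]
      rw [← Real.rpow_add (abs_pos.2 h0)]
      congr 1; ring
  have hgF : ∀ x, g x * F x = |F x| ^ p := by
    intro x
    rcases eq_or_ne (F x) 0 with h0 | h0
    · rw [h0, mul_zero, abs_zero, Real.zero_rpow hp0.ne']
    · rw [hg]
      simp only
      rw [mul_right_comm, ← abs_mul_abs_self (F x), ← sq, ← Real.rpow_natCast,
        ← Real.rpow_add (abs_pos.2 h0)]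
      congr 1; push_cast; ring
  have hgm : AEMeasurable g unitMeasure := hFm.mul (hFm.abs.pow_const _)
  have hgi : Integrable g unitMeasure := by
    refine Integrable.of_bound hgm.aestronglyMeasurable (B ^ (p - 1)) ?_
    filter_upwards [ae_restrict_mem measurableSet_Icc] with x hx
    rw [Real.norm_eq_abs, habs]
    exact Real.rpow_le_rpow (abs_nonneg _) (hB x hx) (by linarith)
  have hFi : Integrable (fun x => |F x| ^ p) unitMeasure := by
    refine Integrable.of_bound (hFm.abs.pow_const _).aestronglyMeasurable (B ^ p) ?_
    filter_upwards [ae_restrict_mem measurableSet_Icc] with x hx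
    rw [Real.norm_of_nonneg (Real.rpow_nonneg (abs_nonneg _) _)]
    exact Real.rpow_le_rpow (abs_nonneg _) (hB x hx) hp0.le
  have hX : ∫⁻ x, ‖F x‖ₑ ^ p ∂unitMeasure = ENNReal.ofReal (∫ x, |F x| ^ p ∂unitMeasure) := by
    rw [ofReal_integral_eq_lintegral_ofReal hFi
      (Eventually.of_forall fun x => Real.rpow_nonneg (abs_nonneg _) _)]
    refine lintegral_congr fun x => ?_
    rw [Real.enorm_eq_ofReal_abs, ENNReal.ofReal_rpow_of_nonneg (abs_nonneg _) hp0.le]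
  have hpair : ∫ x, |F x| ^ p ∂unitMeasure = ∑ k ∈ s, b k * pairing g (φ k) := by
    simp_rw [← hgF]
    have hint : ∀ k ∈ s, Integrable (fun x => b k * (g x * φ k x)) unitMeasure := by
      intro k _
      obtain ⟨B', hB'⟩ :=
        isCompact_Icc.exists_bound_of_continuousOn (continuousOn_wavelet hα0 hφ k)
      refine Integrable.const_mul (hgi.mul_bdd (c := B')
        (integrable_wavelet hα0 hφ k).aestronglyMeasurable ?_) _
      filter_upwards [ae_restrict_mem measurableSet_Icc] with x hx using hB' x hx
    have e : ∀ x, g x * F x = ∑ k ∈ s, b k * (g x * φ k x) := by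
      intro x
      rw [hF]
      simp only
      rw [Finset.mul_sum]
      exact Finset.sum_congr rfl fun k _ => by ring
    simp_rw [e]
    rw [integral_finsetSum _ hint]
    exact Finset.sum_congr rfl fun k _ => integral_const_mul _ _
  have hgp : ∫⁻ x, ‖g x‖ₑ ^ p' ∂unitMeasure = ∫⁻ x, ‖F x‖ₑ ^ p ∂unitMeasure := by
    refine lintegral_congr fun x => ?_
    rw [Real.enorm_eq_ofReal_abs, Real.enorm_eq_ofReal_abs, habs,
      ENNReal.ofReal_rpow_of_nonneg (Real.rpow_nonneg (abs_nonneg _) _) h.symm.pos.le,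
      ENNReal.ofReal_rpow_of_nonneg (abs_nonneg _) hp0.le, ← Real.rpow_mul (abs_nonneg _)]
    congr 2
    rw [hp']
    have : p - 1 ≠ 0 := by linarith
    field_simp
  set I := ∫⁻ x, seqSquare (fun k => if k ∈ s then ‖b k‖ₑ else 0) x ^ (p / 2) ∂unitMeasure with hI
  have hmain : ∫⁻ x, ‖F x‖ₑ ^ p ∂unitMeasure ≤
      I ^ (1 / p) * C ^ (1 / p') * (∫⁻ x, ‖F x‖ₑ ^ p ∂unitMeasure) ^ (1 / p') := by
    calc ∫⁻ x, ‖F x‖ₑ ^ p ∂unitMeasure ≤ ‖∑ k ∈ s, b k * pairing g (φ k)‖ₑ := by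
          rw [hX, hpair, Real.enorm_eq_ofReal_abs]
          exact ENNReal.ofReal_le_ofReal (le_abs_self _)
      _ ≤ ∑ k ∈ s, ‖b k‖ₑ * ‖pairing g (φ k)‖ₑ := by
          refine (enorm_sum_le _ _).trans (Finset.sum_le_sum fun k _ => ?_)
          rw [enorm_mul]
      _ = ∑ k ∈ s, (if k ∈ s then ‖b k‖ₑ else 0) * ‖pairing g (φ k)‖ₑ :=
          Finset.sum_congr rfl fun k hk => by rw [if_pos hk]
      _ ≤ ∑' k, (if k ∈ s then ‖b k‖ₑ else 0) * ‖pairing g (φ k)‖ₑ := ENNReal.sum_le_tsum s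
      _ ≤ I ^ (1 / p) * (∫⁻ x, seqSquare (fun k => ‖pairing g (φ k)‖ₑ) x ^ (p' / 2)
            ∂unitMeasure) ^ (1 / p') := tsum_mul_le_seqSquare h _ _
      _ ≤ I ^ (1 / p) * (C * ∫⁻ x, ‖g x‖ₑ ^ p' ∂unitMeasure) ^ (1 / p') :=
          mul_le_mul' le_rfl (ENNReal.rpow_le_rpow (hC φ hφ g hgi) (one_div_nonneg.2 h.symm.pos.le))
      _ = _ := by
          rw [hgp, ENNReal.mul_rpow_of_nonneg _ _ (one_div_nonneg.2 h.symm.pos.le), mul_assoc]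
  have hfin : ∫⁻ x, ‖F x‖ₑ ^ p ∂unitMeasure ≠ ⊤ := by rw [hX]; exact ENNReal.ofReal_ne_top
  refine (le_rpow_of_le_mul_rpow h hfin hmain).trans (le_of_eq ?_)
  rw [ENNReal.mul_rpow_of_nonneg _ _ hp0.le, ← ENNReal.rpow_mul, ← ENNReal.rpow_mul,
    one_div_mul_cancel hp0.ne', ENNReal.rpow_one, mul_comm,
    ENNReal.coe_rpow_of_nonneg _ (div_nonneg hp0.le h.symm.pos.le)]
  congr 2
  ring

/-! ### Unconditional convergence -/

/-- Dominated convergence for the tails of a sequence of the sequence space. -/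
theorem tendsto_lintegral_seqSquare_compl {q : ℝ} (hq : 0 < q) {a : ℕ+ → ℝ≥0∞}
    (ha : ∫⁻ x, seqSquare a x ^ q ∂unitMeasure ≠ ⊤) :
    Tendsto (fun s : Finset ℕ+ => ∫⁻ x, seqSquare (fun k => if k ∈ s then 0 else a k) x ^ q
      ∂unitMeasure) atTop (𝓝 0) := by
  have hle : ∀ s : Finset ℕ+, ∀ k, (if k ∈ s then 0 else a k) ≤ a k := by
    intro s k
    split_ifs
    · exact zero_le
    · exact le_rfl
  have h := tendsto_lintegral_filter_of_dominated_convergence (μ := unitMeasure)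
    (l := (atTop : Filter (Finset ℕ+)))
    (F := fun s x => seqSquare (fun k => if k ∈ s then 0 else a k) x ^ q) (f := fun _ => 0)
    (fun x => seqSquare a x ^ q)
    (Eventually.of_forall fun s => (measurable_seqSquare _).pow_const q)
    (Eventually.of_forall fun s => Eventually.of_forall fun x =>
      ENNReal.rpow_le_rpow (seqSquare_mono (hle s) x) hq.le) ha ?_
  · simpa using h
  · filter_upwards [ae_lt_top ((measurable_seqSquare a).pow_const q) ha] with x hx
    have hx' : seqSquare a x ≠ ⊤ := by
      intro h
      rw [h, ENNReal.top_rpow_of_pos hq] at hx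
      exact lt_irrefl _ hx
    have h1 := ENNReal.tendsto_tsum_compl_atTop_zero hx'
    have h2 := (ENNReal.continuous_rpow_const (y := q)).tendsto 0 |>.comp h1
    rw [ENNReal.zero_rpow_of_pos hq] at h2
    refine h2.congr fun s => ?_
    simp only [Function.comp_apply, seqSquare]
    congr 1
    refine (tsum_subtype {k | k ∉ s} fun k => a k ^ 2 * haarWeight k x).trans ?_
    refine tsum_congr fun k => ?_
    by_cases hk : k ∈ s <;> simp [hk]

/-- A criterion for unconditional convergence in `L^p`, from the completeness of `L^p`. -/
theorem lpSummable_of_vanishing {p : ℝ≥0∞} (hp1 : 1 ≤ p) {u : ℕ+ → ℝ → ℝ}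
    (hu : ∀ k, MemLp (u k) p unitMeasure)
    (h : ∀ ε : ℝ≥0∞, 0 < ε → ∃ s : Finset ℕ+, ∀ t, Disjoint t s →
      eLpNorm (fun x => ∑ k ∈ t, u k x) p unitMeasure < ε) : LpSummable p u := by
  have : Fact (1 ≤ p) := ⟨hp1⟩
  set v : ℕ+ → Lp ℝ p unitMeasure := fun k => (hu k).toLp (u k) with hv
  have hsum : ∀ t : Finset ℕ+, (∑ k ∈ t, v k : Lp ℝ p unitMeasure) =ᵐ[unitMeasure]
      fun x => ∑ k ∈ t, u k x := by
    intro t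
    have h1 : ∀ᵐ x ∂unitMeasure, ∀ k, v k x = u k x :=
      ae_all_iff.2 fun k => (hu k).coeFn_toLp
    filter_upwards [Lp.coeFn_finsetSum t v, h1] with x hx hx1
    rw [hx, Finset.sum_apply]
    exact Finset.sum_congr rfl fun k _ => hx1 k
  have hs : Summable v := by
    rw [summable_iff_vanishing_norm]
    intro ε hε
    obtain ⟨s, hs⟩ := h (ENNReal.ofReal ε) (ENNReal.ofReal_pos.2 hε)
    refine ⟨s, fun t ht => ?_⟩
    rw [Lp.norm_def, eLpNorm_congr_ae (hsum t)]
    exact (ENNReal.toReal_lt_of_lt_ofReal (hs t ht))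
  obtain ⟨g, hg⟩ := hs
  refine ⟨g, hu, Lp.memLp g, ?_⟩
  have h1 := (Lp.tendsto_Lp_iff_tendsto_eLpNorm' _ g).1 hg
  refine h1.congr fun s => ?_
  rw [eLpNorm_sub_comm]
  refine eLpNorm_congr_ae ?_
  filter_upwards [hsum s] with x hx
  simp only [Pi.sub_apply, hx]

/-- A series of wavelets whose coefficients are dominated by a sequence of the sequence space
converges unconditionally, as the tails of the dominating sequence tend to zero in norm. -/
theorem lpSummable_of_seqSquare {δ α c : ℝ} {p : ℝ≥0∞} (hδ0 : 0 < δ) (hδ1 : δ < 1)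
    (hα0 : 0 < α) (hp1 : 1 < p) (hp : p < ∞) {φ : ℕ+ → ℝ → ℝ} (hφ : IsWaveletType δ α c φ)
    {a : ℕ+ → ℝ≥0∞} (ha : ∫⁻ x, seqSquare a x ^ (p.toReal / 2) ∂unitMeasure ≠ ⊤) {b : ℕ+ → ℝ}
    (hb : ∀ k, ‖b k‖ₑ ≤ a k) : LpSummable p fun k x => b k * φ k x := by
  have hr1 : 1 < p.toReal := by
    rw [← ENNReal.toReal_one]
    exact (ENNReal.toReal_lt_toReal ENNReal.one_ne_top hp.ne).2 hp1
  have hr0 : 0 < p.toReal := by linarith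
  obtain ⟨C, hC⟩ := exists_lintegral_sum_le hδ0 hδ1 hα0 c hr1
  refine lpSummable_of_vanishing hp1.le (fun k => (memLp_wavelet hα0 hφ p k).const_mul _)
    fun ε hε => ?_
  have hlim : Tendsto (fun s : Finset ℕ+ => (C * ∫⁻ x, seqSquare (fun k => if k ∈ s then 0 else a k)
      x ^ (p.toReal / 2) ∂unitMeasure) ^ (1 / p.toReal)) atTop (𝓝 0) := by
    have h1 := ENNReal.Tendsto.const_mul (a := (C : ℝ≥0∞))
      (tendsto_lintegral_seqSquare_compl (half_pos hr0) ha) (Or.inr ENNReal.coe_ne_top)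
    rw [mul_zero] at h1
    have h2 := (ENNReal.continuous_rpow_const (y := 1 / p.toReal)).tendsto 0 |>.comp h1
    rwa [ENNReal.zero_rpow_of_pos (by positivity)] at h2
  obtain ⟨s, hs⟩ := (hlim.eventually_lt_const hε).exists
  refine ⟨s, fun t ht => lt_of_le_of_lt ?_ hs⟩
  rw [eLpNorm_eq_lintegral_rpow_enorm_toReal (by positivity) hp.ne]
  refine ENNReal.rpow_le_rpow ((hC φ hφ b t).trans (mul_le_mul' le_rfl (lintegral_mono fun x =>
    ENNReal.rpow_le_rpow (seqSquare_mono (fun k => ?_) x) (by positivity)))) (by positivity)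
  by_cases hk : k ∈ t
  · rw [if_pos hk, if_neg (Finset.disjoint_left.1 ht hk)]
    exact hb k
  · rw [if_neg hk]
    exact zero_le

/-! ### The Haar square function of a multiplier series -/

theorem haarSquare_eq (f : ℝ → ℝ) (x : ℝ) :
    haarSquare f x = seqSquare (haarCoef f) x ^ (1 / 2 : ℝ) := by
  unfold haarSquare seqSquare
  congr 1
  refine tsum_congr fun k => ?_
  rw [ENNReal.ofReal_mul (sq_nonneg _), haarCoef, ← enorm_pow,
    Real.enorm_eq_ofReal (sq_nonneg _), haarWeight]

/-- A supremum of square functions over an arbitrary family is measurable: a partial sum of a square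
function depends on finitely many functions, each with at most two values. -/
theorem measurable_iSup_seqSquare {ι : Sort*} (b : ι → ℕ+ → ℝ≥0∞) :
    Measurable fun x => ⨆ i, seqSquare (b i) x := by
  have e : (fun x => ⨆ i, seqSquare (b i) x) =
      fun x => ⨆ s : Finset ℕ+, ⨆ i, ∑ k ∈ s, b i k ^ 2 * haarWeight k x := by
    funext x
    simp_rw [seqSquare, ENNReal.tsum_eq_iSup_sum]
    exact iSup_comm
  rw [e]
  refine Measurable.iSup fun s => ?_
  classical
  -- the partial sum is a function of the finite pattern of supports which contain `x`
  have hT : Measurable fun x => fun k : s => haarWeight k x ≠ 0 := by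
    refine measurable_pi_lambda _ fun k => ?_
    exact measurableSet_setOfPred.1 (measurable_haarWeight k (measurableSet_singleton 0)).compl
  have hΦ : Measurable fun P : s → Prop =>
      ⨆ i, ∑ k : s, b i k ^ 2 * (if P k then 2 ^ level k else 0) := Measurable.of_discrete
  have h := hΦ.comp hT
  refine (congrArg Measurable (funext fun x => iSup_congr fun i => ?_)).mpr h
  rw [← Finset.sum_coe_sort s]
  refine Finset.sum_congr rfl fun k _ => ?_
  by_cases hk : haarWeight k x = 0
  · simp [hk]
  · rw [if_pos hk, haarWeight_eq_of_ne_zero hk]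

theorem measurable_maximalHaarSquare (p : ℝ≥0∞) (φ : ℕ+ → ℝ → ℝ) (f : ℝ → ℝ) :
    Measurable (maximalHaarSquare p φ f) := by
  have e : maximalHaarSquare p φ f = fun x => (⨆ l : {l : ℕ+ → ℝ // ∀ k, |l k| ≤ 1},
      seqSquare (haarCoef (lpSum p (multiplierTerm φ f l))) x) ^ (1 / 2 : ℝ) := by
    funext x
    have h := (ENNReal.orderIsoRpow (1 / 2) (by norm_num)).map_iSup
      fun l : {l : ℕ+ → ℝ // ∀ k, |l k| ≤ 1} =>
        seqSquare (haarCoef (lpSum p (multiplierTerm φ f l))) x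
    simp only [ENNReal.orderIsoRpow_apply] at h
    rw [h, maximalHaarSquare, iSup_subtype']
    exact iSup_congr fun l => haarSquare_eq _ x
  rw [e]
  exact (measurable_iSup_seqSquare _).pow_const _

theorem HasLpSum.tendsto_sum_pairing_haar {p : ℝ≥0∞} (hp1 : 1 ≤ p) {u : ℕ+ → ℝ → ℝ} {g : ℝ → ℝ}
    (h : HasLpSum p u g) (j : ℕ+) : Tendsto (fun s => ∑ k ∈ s, pairing (u k) (haar j)) atTop
      (𝓝 (pairing g (haar j))) := by
  obtain ⟨hu, hg, hlim⟩ := h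
  have hui : ∀ k, Integrable (u k) unitMeasure := fun k => (hu k).integrable hp1
  have hgi := hg.integrable hp1
  have hlim1 : Tendsto (fun s : Finset ℕ+ => 2 ^ level j *
      eLpNorm (fun x => g x - ∑ k ∈ s, u k x) p unitMeasure) atTop (𝓝 0) := by
    have h1 := ENNReal.Tendsto.const_mul (a := (2 : ℝ≥0∞) ^ level j) hlim
      (Or.inr (by simp))
    rwa [mul_zero] at h1
  rw [tendsto_iff_edist_tendsto_0]
  refine tendsto_of_tendsto_of_tendsto_of_le_of_le tendsto_const_nhds hlim1
    (fun _ => zero_le) fun s => ?_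
  have hsi : Integrable (fun x => ∑ k ∈ s, u k x) unitMeasure :=
    integrable_finsetSum s fun k _ => hui k
  have e : pairing g (haar j) - ∑ k ∈ s, pairing (u k) (haar j) =
      pairing (fun x => g x - ∑ k ∈ s, u k x) (haar j) := by
    unfold pairing
    rw [← integral_finsetSum _ fun k _ => integrable_mul_haar (hui k) j,
      ← integral_sub (integrable_mul_haar hgi j)
        (integrable_finsetSum s fun k _ => integrable_mul_haar (hui k) j)]
    refine integral_congr_ae (Eventually.of_forall fun x => ?_)
    simp only
    rw [sub_mul, Finset.sum_mul]
  rw [edist_comm, edist_eq_enorm_sub, e]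
  calc ‖pairing (fun x => g x - ∑ k ∈ s, u k x) (haar j)‖ₑ
      ≤ ∫⁻ x, ‖(g x - ∑ k ∈ s, u k x) * haar j x‖ₑ ∂unitMeasure :=
        enorm_integral_le_lintegral_enorm _
    _ ≤ ∫⁻ x, 2 ^ level j * ‖g x - ∑ k ∈ s, u k x‖ₑ ∂unitMeasure := by
        refine lintegral_mono fun x => ?_
        rw [enorm_mul, mul_comm]
        refine mul_le_mul' ?_ le_rfl
        rw [Real.enorm_eq_ofReal_abs, ← ofReal_two_pow]
        exact ENNReal.ofReal_le_ofReal (abs_haar_le j x)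
    _ = 2 ^ level j * eLpNorm (fun x => g x - ∑ k ∈ s, u k x) 1 unitMeasure := by
        rw [lintegral_const_mul' _ _ (by simp), eLpNorm_one_eq_lintegral_enorm]
    _ ≤ _ := by
        refine mul_le_mul' le_rfl ?_
        have : IsProbabilityMeasure unitMeasure := ⟨by simp⟩
        exact eLpNorm_le_eLpNorm_of_exponent_le hp1 (hgi.sub hsi).aestronglyMeasurable

/-- The Haar coefficients of an `L^p` sum are dominated uniformly over all coefficient sequences `b`
with `|bₖ| ≤ aₖ`. -/
theorem haarCoef_le_matMul {p : ℝ≥0∞} (hp1 : 1 ≤ p) {φ : ℕ+ → ℝ → ℝ} {a : ℕ+ → ℝ≥0∞} {b : ℕ+ → ℝ}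
    (hb : ∀ k, ‖b k‖ₑ ≤ a k) {g : ℝ → ℝ} (h : HasLpSum p (fun k x => b k * φ k x) g) (j : ℕ+) :
    haarCoef g j ≤ matMul (fun j k => ‖pairing (φ k) (haar j)‖ₑ) a j := by
  refine le_of_tendsto (HasLpSum.tendsto_sum_pairing_haar hp1 h j).enorm
    (Eventually.of_forall fun s => ?_)
  refine (enorm_sum_le _ _).trans (le_trans (Finset.sum_le_sum fun k _ => ?_)
    (ENNReal.sum_le_tsum s))
  have e : pairing (fun x => b k * φ k x) (haar j) = b k * pairing (φ k) (haar j) := by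
    unfold pairing
    simp_rw [mul_assoc]
    exact integral_const_mul _ _
  rw [e, enorm_mul, mul_comm]
  exact mul_le_mul' le_rfl (hb k)

end HaarWavelet

open HaarWavelet in
theorem lemma3p4 (p : ℝ≥0∞) (hp1 : 1 < p) (hp : p < ∞)
    (δ α c : ℝ) (hδ0 : 0 < δ) (hδ1 : δ < 1) (hα0 : 0 < α) (hα1 : α ≤ 1) :
    ∃ C : ℝ≥0, ∀ φ : ℕ+ → ℝ → ℝ, IsWaveletType δ α c φ →
      ∀ f : ℝ → ℝ, MemLp f p unitMeasure →
        (∀ l : ℕ+ → ℝ, (∀ k, |l k| ≤ 1) → LpSummable p (multiplierTerm φ f l)) ∧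
        AEMeasurable (maximalHaarSquare p φ f) unitMeasure ∧
        eLpNorm (maximalHaarSquare p φ f) p unitMeasure ≤ C * eLpNorm f p unitMeasure := by
  have hr1 : 1 < p.toReal := by
    rw [← ENNReal.toReal_one]
    exact (ENNReal.toReal_lt_toReal ENNReal.one_ne_top hp.ne).2 hp1
  have hr0 : 0 < p.toReal := by linarith
  have hp0 : p ≠ 0 := (zero_lt_one.trans hp1).ne'
  obtain ⟨C1, hC1⟩ := exists_lintegral_coef_le hδ0 hδ1 hα0 c hr1
  obtain ⟨D, hD⟩ := exists_almostDiag_pairing hδ0 hδ1 hα0 c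
  obtain ⟨C2, hC2⟩ := exists_matMul_bound hδ0 hδ1 (lt_min hα0 (by linarith : 0 < δ / 4)) hr1 D
  refine ⟨(C2 * C1) ^ (1 / p.toReal), fun φ hφ f hf => ?_⟩
  have hfi : Integrable f unitMeasure := hf.integrable hp1.le
  set a : ℕ+ → ℝ≥0∞ := fun k => ‖pairing f (φ k)‖ₑ with ha
  have hfin : ∫⁻ x, ‖f x‖ₑ ^ p.toReal ∂unitMeasure ≠ ⊤ :=
    (lintegral_rpow_enorm_lt_top_of_eLpNorm_lt_top hp0 hp.ne hf.eLpNorm_lt_top).ne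
  have hafin : ∫⁻ x, seqSquare a x ^ (p.toReal / 2) ∂unitMeasure ≠ ⊤ :=
    ((hC1 φ hφ f hfi).trans_lt (ENNReal.mul_lt_top ENNReal.coe_lt_top hfin.lt_top)).ne
  have hb : ∀ l : ℕ+ → ℝ, (∀ k, |l k| ≤ 1) → ∀ k, ‖l k * pairing f (φ k)‖ₑ ≤ a k := by
    intro l hl k
    rw [enorm_mul]
    refine mul_le_of_le_one_left' ?_
    rw [Real.enorm_eq_ofReal_abs]
    exact ENNReal.ofReal_le_one.2 (hl k)
  have hsummable : ∀ l : ℕ+ → ℝ, (∀ k, |l k| ≤ 1) → LpSummable p (multiplierTerm φ f l) :=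
    fun l hl => lpSummable_of_seqSquare hδ0 hδ1 hα0 hp1 hp hφ hafin (hb l hl)
  refine ⟨hsummable, (measurable_maximalHaarSquare p φ f).aemeasurable, ?_⟩
  have hpt : ∀ x, maximalHaarSquare p φ f x ^ p.toReal ≤
      seqSquare (matMul (fun j k => ‖pairing (φ k) (haar j)‖ₑ) a) x ^ (p.toReal / 2) := by
    intro x
    have h1 : maximalHaarSquare p φ f x ≤
        seqSquare (matMul (fun j k => ‖pairing (φ k) (haar j)‖ₑ) a) x ^ (1 / 2 : ℝ) := by
      refine iSup₂_le fun l hl => ?_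
      rw [haarSquare_eq]
      exact ENNReal.rpow_le_rpow (seqSquare_mono (haarCoef_le_matMul hp1.le (hb l hl)
        (hsummable l hl).hasLpSum) x) (by norm_num)
    refine (ENNReal.rpow_le_rpow h1 hr0.le).trans (le_of_eq ?_)
    rw [← ENNReal.rpow_mul]
    congr 1
    ring
  rw [eLpNorm_eq_lintegral_rpow_enorm_toReal hp0 hp.ne,
    eLpNorm_eq_lintegral_rpow_enorm_toReal hp0 hp.ne,
    ENNReal.coe_rpow_of_nonneg _ (by positivity), ← ENNReal.mul_rpow_of_nonneg _ _ (by positivity)]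
  refine ENNReal.rpow_le_rpow ?_ (by positivity)
  simp_rw [enorm_eq_self]
  calc ∫⁻ x, maximalHaarSquare p φ f x ^ p.toReal ∂unitMeasure
      ≤ ∫⁻ x, seqSquare (matMul (fun j k => ‖pairing (φ k) (haar j)‖ₑ) a) x ^ (p.toReal / 2)
          ∂unitMeasure := lintegral_mono hpt
    _ ≤ C2 * ∫⁻ x, seqSquare a x ^ (p.toReal / 2) ∂unitMeasure := hC2 _ (hD φ hφ) a
    _ ≤ C2 * (C1 * ∫⁻ x, ‖f x‖ₑ ^ p.toReal ∂unitMeasure) := mul_le_mul' le_rfl (hC1 φ hφ f hfi)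
    _ = _ := by push_cast; ring

end
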